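/- **Setting.** Let $p$ be a prime and let $1\le r\le n-k-1$ and $m$ be integers with $$m\binom{n-k-1}{r}\ \ge\ \binom nr-1 .$$ Let $\mathbb F_q$ be a finite field of characteristic $p$ and let $\alpha\in\mathbb F_{q^m}$ be such that $(1,\alpha,\dots,\alpha^{m-1})$ is an $\mathbb F_q$-basis of $\mathbb F_{q^m}$; write $[\alpha^i]x$ for the coefficient of $\alpha^i$ in $x$. The rank weight of $x\in\mathbb F_{q^m}^n$ is the rank of the $m\times n$ matrix over $\mathbb F_q$ whose columns are the coordinate vectors of the $x_j$. Let $\mathcal C\subseteq\mathbb F_{q^m}^n$ be a linear code of dimension $k$ and $y\in\mathbb F_{q^m}^n$ such that $\mathcal C+\langle y\rangle$ has a generator matrix in systematic form $(I_{k+1}\ R)$, and put $H=(-R^{\mathsf T}\ I_{n-k-1})$. Let $e$ be a vector of rank weight $r$ with $y-e\in\mathcal C$, let $e$ be the only vector of rank weight at most $r$ with this property, and let $e_1,\dots,e_r$ be linearly independent over $\mathbb F_q$ (equivalently, $e=e_1\,(1,S_2,\dots,S_r)\,(I_r\ C')$ for some $S_i\in\mathbb F_{q^m}$ and some matrix $C'$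 over $\mathbb F_q$). Let $\mathrm{MaxMin}$ be the $m\binom{n-k-1}r\times\binom nr$ matrix over $\mathbb F_q$ with rows indexed by $(J,i)$, $J\subseteq\{1,\dots,n-k-1\}$, $|J|=r$, $0\le i<m$, and columns indexed by $T\subseteq\{1,\dots,n\}$, $|T|=r$. Put $T_1=T\cap\{1,\dots,k+1\}$ and $T_2=(T\cap\{k+2,\dots,n\})-(k+1)$. The entry is $0$ if $T_2\not\subseteq J$, and otherwise it is $[\alpha^i]\big((-1)^{\sigma(T_2,J)}\det R_{T_1,\,J\setminus T_2}\big)$ with $\sigma(T_2,J)=|J\setminus T_2|+\#\{(a,b)\in T_2\times(J\setminus T_2):a<b\}$; thus it is the coefficient of the minor $c_T=\det C_{*,T}$ in $[\alpha^i]\det\big((CH^{\mathsf T})_{*,J}\big)$ for a matrix $C\in\mathbb F_q^{r\times n}$. Assume that $\mathrm{MaxMin}$ has rank $\binom nr-1$. **Algorithm.** Input: $R$ and $\alpha^m$, by their coordinates in $\mathbb F_q$. 1. Construct $\mathrm{MaxMin}$. 2. Find the only vector $(c_T)_T$ in its right kernel with $c_{\{1,\dots,r\}}=1$. 3. Form $C=(I_r\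 C')$ with $C_{ij}=(-1)^{r+i}c_{\{1,\dots,r\}\setminus\{i\}\cup\{j\}}$ for $j>r$. 4. Find the only $S\in\mathbb F_{q^m}^r$ with $S\,C\,H^{\mathsf T}=0$ and $S_1=1$. 5. Return $S\,C$. **Model.** Algorithms are algebraic computation trees: for given $p,m,n,k,r$ one tree serves all $\mathbb F_q$ of characteristic $p$ and all instances. It uses integer constants, $+,-,\cdot$, inversion and zero tests in $\mathbb F_q$, each of which counts as one operation. Let $\omega>2$ and $A_0$ be reals such that, for every $d$, such a tree multiplies $d\times d$ matrices over finite fields of characteristic $p$ with at most $A_0d^{\omega}$ operations. **Claim.** There is a constant $A$, which depends only on $\omega$ and $A_0$, such that for all $p,m,n,k,r$ as above the algorithm has an implementation with the following properties, for all instances as above. * All the steps 1–5 are carried out correctly (in particular, the vectors in steps 2 and 4 exist and are unique), $e_1\neq 0$, and the returned vector is $e_1^{-1}e$, the error normalized to first coordinate $1$ (so it is $e$ itself if $e_1=1$). * Steps 2 and 3 use at most $A\,m\binom{n-k-1}r\binom nr^{\omega-1}$ operations in $\mathbb F_q$. * The whole algorithm uses at most $A\,(1+\tfrac mn)\,m\binom{n-k-1}r\binom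 nr^{\omega-1}$ operations in $\mathbb F_q$, which is $O\!\left(m\binom{n-k-1}r\binom nr^{\omega-1}\right)$ whenever $m=O(n)$. -/

import Mathlib

namespace RankDecoding

/-! ### Algebraic algorithms and their number of field operations

An algorithm is a finite tree of elementary steps on registers that hold elements of a field.
It has access to the field only through its operations and through tests for zero, and its
text does not depend on the field: the only constants are the images of the integers. -/

/-- The elementary operations, with arguments taken from registers in `ρ`. -/
inductive Instr (ρ : Type) : Type
  | const (z : ℤ) : Instr ρ
  | add (x y : ρ) : Instr ρ
  | sub (x y : ρ) : Instr ρ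
  | mul (x y : ρ) : Instr ρ
  | inv (x : ρ) : Instr ρ

/-- Programs with registers in `ρ` and outputs indexed by `o`: stop and declare which registers
hold the outputs; execute an operation and store its result in `dst`; or branch on whether a
register holds zero. -/
inductive Prog (ρ o : Type) : Type
  | ret (out : o → ρ) : Prog ρ o
  | step (dst : ρ) (ins : Instr ρ) (next : Prog ρ o) : Prog ρ o
  | ifZero (x : ρ) (yes no : Prog ρ o) : Prog ρ o

/-- The value of an operation. -/
def Instr.eval {ρ F : Type} [Field F] (mem : ρ → F) : Instr ρ → F
  | .const z => (z : F)
  | .add x y => mem x + mem y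
  | .sub x y => mem x - mem y
  | .mul x y => mem x * mem y
  | .inv x => (mem x)⁻¹

open Classical in
/-- The outputs of a program started with the register contents `mem`. -/
noncomputable def Prog.run {ρ o F : Type} [Field F] : Prog ρ o → (ρ → F) → o → F
  | .ret out, mem => fun i => mem (out i)
  | .step dst ins next, mem => next.run (Function.update mem dst (ins.eval mem))
  | .ifZero x yes no, mem => if mem x = 0 then yes.run mem else no.run mem

open Classical in
/-- The number of field operations and zero tests that a program executes when it is started
with the register contents `mem`. -/
noncomputable def Prog.steps {ρ o F : Type} [Field F] : Prog ρ o → (ρ → F) → ℕ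
  | .ret _, _ => 0
  | .step dst ins next, mem => next.steps (Function.update mem dst (ins.eval mem)) + 1
  | .ifZero x yes no, mem => (if mem x = 0 then yes.steps mem else no.steps mem) + 1

/-- Algorithms with inputs indexed by `ι` and outputs indexed by `o`: there is one register for
each input, and there are work registers numbered by `ℕ`. -/
abbrev Alg (ι o : Type) : Type := Prog (ι ⊕ ℕ) o

/-- The initial register contents: the inputs, and zero in every work register. -/
def initMem {ι F : Type} [Field F] (inp : ι → F) : ι ⊕ ℕ → F := Sum.elim inp (fun _ => 0)

/-- The output of an algorithm on an input. -/
noncomputable def Alg.output {ι o F : Type} [Field F] (P : Alg ι o) (inp : ι → F) : o → F :=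
  Prog.run P (initMem inp)

/-- The number of field operations of an algorithm on an input. -/
noncomputable def Alg.cost {ι o F : Type} [Field F] (P : Alg ι o) (inp : ι → F) : ℕ :=
  Prog.steps P (initMem inp)

/-- For every `d`, two `d × d` matrices over a finite field of characteristic `p` can be
multiplied with at most `A₀ * d ^ ω` field operations. -/
def MatMulBound (p : ℕ) (ω A₀ : ℝ) : Prop :=
  ∀ d : ℕ, ∃ P : Alg ((Fin d × Fin d) ⊕ (Fin d × Fin d)) (Fin d × Fin d),
    ∀ (F : Type) [Field F] [Finite F] [CharP F p] (X Y : Matrix (Fin d) (Fin d) F),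
      (∀ i j, P.output (Sum.elim (fun a => X a.1 a.2) (fun a => Y a.1 a.2)) (i, j)
        = (X * Y) i j) ∧
      (P.cost (Sum.elim (fun a => X a.1 a.2) (fun a => Y a.1 a.2)) : ℝ) ≤ A₀ * (d : ℝ) ^ ω

/-! ### Codes in the rank metric -/

/-- The rank weight: the rank over `F` of the matrix whose `j`-th column holds the coordinates
of `x j` in the basis `β`. -/
noncomputable def rankWeight {F K : Type} [Field F] [Field K] [Algebra F K] {m n : ℕ}
    (β : Module.Basis (Fin m) F K) (x : Fin n → K) : ℕ :=
  (Matrix.of fun (i : Fin m) (j : Fin n) => β.repr (x j) i).rank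

/-- The matrix `(I R)` with `k + 1` rows and `n` columns. -/
def sysGen {K : Type} [Field K] {n k : ℕ} (R : Matrix (Fin (k + 1)) (Fin (n - k - 1)) K) :
    Matrix (Fin (k + 1)) (Fin n) K :=
  Matrix.of fun i t =>
    if h : k + 1 ≤ t.val then R i ⟨t.val - (k + 1), by omega⟩
    else if t.val = i.val then 1 else 0

/-- The matrix `(-Rᵀ I)` with `n - k - 1` rows and `n` columns. -/
def parityCheck {K : Type} [Field K] {n k : ℕ}
    (R : Matrix (Fin (k + 1)) (Fin (n - k - 1)) K) : Matrix (Fin (n - k - 1)) (Fin n) K :=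
  Matrix.of fun j t =>
    if h : t.val < k + 1 then - R ⟨t.val, h⟩ j
    else if t.val = k + 1 + j.val then 1 else 0

/-- The decoding instances under consideration. The code `𝒞` of length `n` and dimension `k`
over `K`, together with the received word `y`, spans a code with generator matrix `(I R)` in
systematic form; `e` is the error, of rank weight `r`, and it is the only solution of the
decoding problem; its first `r` coordinates form a basis of its support, in other words the
first `r` columns of its coordinate matrix in a basis of the support are independent. -/
structure IsInstance {F K : Type} [Field F] [Field K] [Algebra F K] {m n k : ℕ} (r : ℕ)
    (β : Module.Basis (Fin m) F K) (R : Matrix (Fin (k + 1)) (Fin (n - k - 1)) K)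
    (𝒞 : Submodule K (Fin n → K)) (y e : Fin n → K) : Prop where
  finrank_code : Module.finrank K 𝒞 = k
  systematic : 𝒞 ⊔ Submodule.span K {y} = Submodule.span K (Set.range (sysGen R).row)
  error_spec : y - e ∈ 𝒞
  weight : rankWeight β e = r
  unique : ∀ e' : Fin n → K, y - e' ∈ 𝒞 → rankWeight β e' ≤ r → e' = e
  first_columns : LinearIndepOn F e {t : Fin n | t.val < r}

/-! ### The matrix `MaxMin` -/

/-- The subsets of `{0, …, a - 1}` with `r` elements. -/
abbrev Sub (a r : ℕ) : Type := {S : Finset (Fin a) // S.card = r}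

/-- The minor of `M` with rows `I` and columns `J`, taken in increasing order. -/
def minor {K : Type} [Field K] {a b : ℕ} (M : Matrix (Fin a) (Fin b) K)
    (I : Finset (Fin a)) (J : Finset (Fin b)) : K :=
  if h : J.card = I.card then
    (M.submatrix (I.orderEmbOfFin rfl) (J.orderEmbOfFin h)).det
  else 0

/-- The part of `T` among the first `k + 1` columns. -/
def headPart {n : ℕ} (k : ℕ) (T : Finset (Fin n)) : Finset (Fin (k + 1)) :=
  Finset.univ.filter fun i => ∃ t ∈ T, t.val = i.val

/-- The part of `T` among the last `n - k - 1` columns, shifted by `k + 1`. -/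
def tailPart {n : ℕ} (k : ℕ) (T : Finset (Fin n)) : Finset (Fin (n - k - 1)) :=
  Finset.univ.filter fun j => ∃ t ∈ T, t.val = k + 1 + j.val

/-- The exponent of the sign: for `S ⊆ J` and `S` the tail part of `T`, the minor of `(-Rᵀ I)ᵀ`
with rows `T` and columns `J` is `(-1) ^ signExp S J` times a minor of `R`. -/
def signExp {a : ℕ} (S J : Finset (Fin a)) : ℕ :=
  (J \ S).card + ((S ×ˢ (J \ S)).filter fun x => x.1 < x.2).card

/-- The matrix over `F` of the linear system in the maximal minors `c_T`, which is obtained by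
unfolding the maximal minors of `C (-Rᵀ I)ᵀ` in the basis `β`. -/
noncomputable def MaxMin {F K : Type} [Field F] [Field K] [Algebra F K] {m n k : ℕ} (r : ℕ)
    (β : Module.Basis (Fin m) F K) (R : Matrix (Fin (k + 1)) (Fin (n - k - 1)) K) :
    Matrix (Sub (n - k - 1) r × Fin m) (Sub n r) F :=
  Matrix.of fun Ji T =>
    if tailPart k T.1 ⊆ Ji.1.1 then
      β.repr ((-1) ^ signExp (tailPart k T.1) Ji.1.1 *
        minor R (headPart k T.1) (Ji.1.1 \ tailPart k T.1)) Ji.2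
    else 0

/-! ### The decoding algorithm -/

/-- The first `r` column indices. -/
def firstCols (n r : ℕ) : Finset (Fin n) := Finset.univ.filter fun t => t.val < r

/-- Indices of the input: the coordinates of the entries of `R`, and those of `α ^ m`, which
describe the arithmetic of `K`. -/
abbrev InputIdx (m n k : ℕ) : Type := (Fin (k + 1) × Fin (n - k - 1) × Fin m) ⊕ Fin m

/-- The input that encodes `R`. -/
noncomputable def encode {F K : Type} [Field F] [Field K] [Algebra F K] {m n k : ℕ}
    (α : K) (β : Module.Basis (Fin m) F K) (R : Matrix (Fin (k + 1)) (Fin (n - k - 1)) K) :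
    InputIdx m n k → F :=
  Sum.elim (fun x => β.repr (R x.1 x.2.1) x.2.2) (fun l => β.repr (α ^ m) l)

/-- An implementation of the decoding algorithm for the parameters `m, n, k, r`:
`build` constructs the matrix `MaxMin` from the input;
`solve` computes from that matrix a vector of its right kernel and the coefficient matrix `C`;
`finish` computes from the input and from `C` the coordinates of the vector `S` and of the
returned vector. -/
structure Decoder (m n k r : ℕ) where
  build : Alg (InputIdx m n k) ((Sub (n - k - 1) r × Fin m) × Sub n r)
  solve : Alg ((Sub (n - k - 1) r × Fin m) × Sub n r) (Sub n r ⊕ (Fin r × Fin n))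
  finish : Alg (InputIdx m n k ⊕ (Fin r × Fin n)) ((Fin r × Fin m) ⊕ (Fin n × Fin m))

namespace Decoder

variable {F : Type} [Field F] {m n k r : ℕ}

/-- The entries of the matrix that is constructed first. -/
noncomputable def entries (D : Decoder m n k r) (inp : InputIdx m n k → F) :
    (Sub (n - k - 1) r × Fin m) × Sub n r → F :=
  D.build.output inp

/-- The computed kernel vector. -/
noncomputable def kernelVec (D : Decoder m n k r) (inp : InputIdx m n k → F) : Sub n r → F :=
  fun T => D.solve.output (D.entries inp) (Sum.inl T)

/-- The computed coefficient matrix. -/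
noncomputable def coeffs (D : Decoder m n k r) (inp : InputIdx m n k → F) :
    Matrix (Fin r) (Fin n) F :=
  Matrix.of fun i j => D.solve.output (D.entries inp) (Sum.inr (i, j))

/-- The input of the last phase. -/
noncomputable def lastInput (D : Decoder m n k r) (inp : InputIdx m n k → F) :
    InputIdx m n k ⊕ (Fin r × Fin n) → F :=
  Sum.elim inp (fun ij => D.coeffs inp ij.1 ij.2)

/-- The computed vector `S`, as a vector over `K`. -/
noncomputable def supportVec {K : Type} [Field K] [Algebra F K] (D : Decoder m n k r)
    (β : Module.Basis (Fin m) F K) (inp : InputIdx m n k → F) : Fin r → K :=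
  fun i => ∑ l, D.finish.output (D.lastInput inp) (Sum.inl (i, l)) • β l

/-- The returned vector, as a vector over `K`. -/
noncomputable def result {K : Type} [Field K] [Algebra F K] (D : Decoder m n k r)
    (β : Module.Basis (Fin m) F K) (inp : InputIdx m n k → F) : Fin n → K :=
  fun j => ∑ l, D.finish.output (D.lastInput inp) (Sum.inr (j, l)) • β l

/-- The number of operations in `F` for finding the kernel vector and the matrix `C` once
`MaxMin` is there. -/
noncomputable def solveCost (D : Decoder m n k r) (inp : InputIdx m n k → F) : ℕ :=
  D.solve.cost (D.entries inp)

/-- The number of operations in `F` of the whole algorithm. -/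
noncomputable def totalCost (D : Decoder m n k r) (inp : InputIdx m n k → F) : ℕ :=
  D.build.cost inp + D.solve.cost (D.entries inp) + D.finish.cost (D.lastInput inp)

/-- On the given input, every line of the decoding algorithm is executed as prescribed. -/
structure Executes {K : Type} [Field K] [Algebra F K] (D : Decoder m n k r)
    (α : K) (β : Module.Basis (Fin m) F K)
    (R : Matrix (Fin (k + 1)) (Fin (n - k - 1)) K) : Prop where
  /-- The first phase constructs `MaxMin`. -/
  entries_eq : ∀ Ji T, D.entries (encode α β R) (Ji, T) = MaxMin r β R Ji T
  /-- The kernel vector lies in the right kernel of `MaxMin`. -/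
  kernel_mem : (MaxMin r β R).mulVec (D.kernelVec (encode α β R)) = 0
  /-- Its component at the first `r` columns is `1`. -/
  kernel_one : ∀ T : Sub n r, T.1 = firstCols n r → D.kernelVec (encode α β R) T = 1
  /-- It is the only such vector. -/
  kernel_unique : ∀ v : Sub n r → F, (MaxMin r β R).mulVec v = 0 →
    (∀ T : Sub n r, T.1 = firstCols n r → v T = 1) → v = D.kernelVec (encode α β R)
  /-- The first `r` columns of `C` form the identity matrix. -/
  coeffs_id : ∀ (i : Fin r) (j : Fin n), j.val < r →
    D.coeffs (encode α β R) i j = if j.val = i.val then 1 else 0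
  /-- The other entries of `C` are read off from the kernel vector: row `i` and column `j` hold,
  up to sign, the component at the first `r` columns with `i` replaced by `j`. -/
  coeffs_read : ∀ (i : Fin r) (j : Fin n), r ≤ j.val → ∀ T : Sub n r,
    T.1 = insert j ((firstCols n r).filter fun t => t.val ≠ i.val) →
    D.coeffs (encode α β R) i j = (-1) ^ (r + (i.val + 1)) * D.kernelVec (encode α β R) T
  /-- `S` solves the linear system `S C Hᵀ = 0` for `H = (-Rᵀ I)`. -/
  support_mem : Matrix.vecMul (D.supportVec β (encode α β R))
    ((D.coeffs (encode α β R)).map (algebraMap F K) * (parityCheck R).transpose) = 0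
  /-- The first component of `S` is `1`. -/
  support_one : ∀ i : Fin r, i.val = 0 → D.supportVec β (encode α β R) i = 1
  /-- It is the only such solution. -/
  support_unique : ∀ s : Fin r → K, Matrix.vecMul s
    ((D.coeffs (encode α β R)).map (algebraMap F K) * (parityCheck R).transpose) = 0 →
    (∀ i : Fin r, i.val = 0 → s i = 1) → s = D.supportVec β (encode α β R)
  /-- The returned vector is `S C`. -/
  result_eq : D.result β (encode α β R) = Matrix.vecMul (D.supportVec β (encode α β R))
    ((D.coeffs (encode α β R)).map (algebraMap F K))

end Decoder

end RankDecoding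

/-!
The decoder is correct because of two facts of linear algebra. Write `e = s C` with a systematic
matrix `C = (I C')` over the base field and `s` the first `r` coordinates of `e`. Since `e` lies in
`𝒞 + ⟨y⟩`, the nonzero vector `s` is in the left kernel of `C Hᵀ`, so all maximal minors of `C Hᵀ`
vanish. By the Cauchy–Binet formula (`det_mul_eq_sum_minors`) and the evaluation of the maximal
minors of `Hᵀ` in terms of minors of `R` (`det_parityCheck_transpose_submatrix`), this says that the
vector of maximal minors of `C` is in the kernel of `MaxMin` (`maxMin_mulVec_maxMinor`). Its
component at the first `r` columns is `1`, and the assumption on the rank makes the kernel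
one-dimensional (`eq_smul_maxMinor`), so the linear system determines the maximal minors of `C`;
the entries of `C'` are among them up to sign (`maxMinor_exchange`). Conversely, a solution `S` of
`S C Hᵀ = 0` gives a vector `S C` in `𝒞 + ⟨y⟩` of rank weight at most `r`. If it were in `𝒞`, adding
it to `e` would contradict the uniqueness of `e`; hence it is, up to a factor, an error vector for
`y`, and `S` is a multiple of `s` (`IsInstance.exists_smul_of_solution`).

For the costs, variables are functions on a family of instances, with values in the base fields,
and `Computes A X Y c` says that the variables in `Y` can be derived from those in `X` with `c`
operations on all instances in `A`. Such statements compose, branch at zero tests, and turn into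
programs (`Computes.exists_alg`); a `FieldModel` does the same for a field whose elements are
represented by several variables. Write `N` for the number of columns of `MaxMin`.

* The minors of `R` are computed order by order, by Laplace expansion along the first row. An order
  takes one multiplication of a matrix of coordinates of minors with a matrix of coordinates of
  multiples of entries, cut into blocks of size `n` (`computes_compound_succ`, `computes_build`).
* The kernel of `MaxMin` is found with `m * (n - k - 1).choose r / N` eliminations of `N` rows
  each, at most one more after rounding up. An elimination uses a generalized inverse, which is
  obtained by recursion on the number of rows with a constant number of matrix products per step
  (`FastMul.exists_generalizedInverse`, `FastMul.kernelVector`). As `2 < ω`, the costs of the levels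
  of the recursion form a geometric series dominated by its first term.
* The normalized error is the common vector of the row spaces of `C` and `(I R)`. Both matrices are
  systematic, so one may expand it in the rows of the matrix that has fewer of them and solve for
  the coefficients (`FieldModel.systematic_intersection`, `computes_finish`). The arithmetic of the
  extension takes `O(m ^ 2)` operations (`fieldModel_ext`); an inverse is found by a variant of the
  Euclidean algorithm that uses no polynomial division (`computes_inv_of_euclidState`).

Polynomial factors in the order `u` of the minors appear in the first and the last phase. They are
absorbed because `n.choose r` is at least `n * 2 ^ (u - 1) / u`, and its exponent `ω - 1` exceeds
`1` (`exists_growth_bound`); this is where the constant depends on `ω`.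
-/

namespace RankDecoding

/-! ### Deriving values from values -/

section Derivations

set_option linter.unusedSectionVars false

variable {Ω : Type*} {E : Ω → Type} [∀ ω, Field (E ω)]

/-- On the instances in `A`, every variable in `X` is held by a register of `mem` which is an
input register or one of the first `N` work registers. -/
def Stored {ι : Type} (A : Set Ω) (mem : ∀ ω, ι ⊕ ℕ → E ω) (N : ℕ) (X : Set (∀ ω, E ω)) : Prop :=
  ∀ x ∈ X, ∃ s : ι ⊕ ℕ, (∀ k, s = Sum.inr k → k < N) ∧ ∀ ω ∈ A, mem ω s = x ω

/-- From every memory that stores the variables in `X`, some program finds the variables `y`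
within `c` steps, uniformly over the instances in `A`. -/
def Reach (A : Set Ω) (X : Set (∀ ω, E ω)) {o : Type} (y : o → ∀ ω, E ω) (c : ℝ) : Prop :=
  ∀ A' ⊆ A, ∀ (ι : Type) (N : ℕ) (mem : ∀ ω, ι ⊕ ℕ → E ω), Stored A' mem N (insert 0 X) →
    ∃ P : Prog (ι ⊕ ℕ) o, ∀ ω ∈ A', P.run (mem ω) = (fun j => y j ω) ∧ (P.steps (mem ω) : ℝ) ≤ c

/-- A variable is a family of field elements, one for each instance in `Ω`. `Computes A X Y c`
says that on the instances in `A` the variables in `Y` can be computed from those in `X` with at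
most `c` operations. It is phrased through continuations: whatever can be reached with the help
of `Y` can be reached without it at the additional cost `c`. -/
def Computes (A : Set Ω) (X Y : Set (∀ ω, E ω)) (c : ℝ) : Prop :=
  ∀ A' ⊆ A, ∀ X' ⊇ X, ∀ (o : Type) (y : o → ∀ ω, E ω) (d : ℝ),
    Reach A' (X' ∪ Y) y d → Reach A' X' y (c + d)

variable {A A' : Set Ω} {X X' Y Y' Z : Set (∀ ω, E ω)} {c c' d : ℝ}

theorem Stored.mono {ι : Type} {mem : ∀ ω, ι ⊕ ℕ → E ω} {N : ℕ} (h : Stored A mem N X)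
    (hX : X' ⊆ X) : Stored A mem N X' := fun x hx => h x (hX hx)

theorem Stored.anti {ι : Type} {mem : ∀ ω, ι ⊕ ℕ → E ω} {N : ℕ} (h : Stored A mem N X)
    (hA : A' ⊆ A) : Stored A' mem N X := fun x hx =>
  let ⟨s, hs, hm⟩ := h x hx
  ⟨s, hs, fun ω hω => hm ω (hA hω)⟩

theorem Reach.mono {o : Type} {y : o → ∀ ω, E ω} (h : Reach A X y c) (hX : X ⊆ X') (hc : c ≤ c') :
    Reach A X' y c' := by
  intro B hB ι N mem hs
  obtain ⟨P, hP⟩ := h B hB ι N mem (hs.mono (Set.insert_subset_insert hX))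
  exact ⟨P, fun ω hω => ⟨(hP ω hω).1, (hP ω hω).2.trans hc⟩⟩

theorem Reach.anti {o : Type} {y : o → ∀ ω, E ω} (h : Reach A X y c) (hA : A' ⊆ A) :
    Reach A' X y c := fun B hB => h B (hB.trans hA)

theorem Computes.mono (h : Computes A X Y c) (hX : X ⊆ X') (hY : Y' ⊆ Y) (hc : c ≤ c') :
    Computes A X' Y' c' := by
  intro B hB X'' hX'' o y d hr
  exact (h B hB X'' (hX.trans hX'') o y d
    (hr.mono (Set.union_subset_union_right _ hY) le_rfl)).mono le_rfl (by linarith)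

theorem Computes.of_subset (h : Y ⊆ X) (hc : 0 ≤ c) : Computes A X Y c := by
  intro B hB X' hX' o y d hr
  refine hr.mono ?_ (by linarith)
  exact Set.union_subset le_rfl (h.trans hX')

theorem Computes.trans (h : Computes A X Y c) (h' : Computes A (X ∪ Y) Z d) :
    Computes A X (Y ∪ Z) (c + d) := by
  intro B hB X' hX' o y e hr
  rw [add_assoc]
  refine h B hB X' hX' o y _ (h' B hB (X' ∪ Y) (Set.union_subset_union_left _ hX') o y e ?_)
  rwa [Set.union_assoc]

/-- Sequential composition, forgetting the intermediate results. -/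
theorem Computes.andThen (h : Computes A X Y c) (h' : Computes A (X ∪ Y) Z d) :
    Computes A X Z (c + d) :=
  (h.trans h').mono le_rfl Set.subset_union_right le_rfl

/-- Values may be replaced by values which agree with them on the instances in `A`. -/
theorem Computes.congr (h : Computes A X Y c)
    (hY : ∀ y' ∈ Y', ∃ y ∈ insert 0 (X ∪ Y), ∀ ω ∈ A, y ω = y' ω) : Computes A X Y' c := by
  intro B hB X' hX' o y d hr
  refine h B hB X' hX' o y d ?_
  intro C hC ι N mem hs
  refine hr C hC ι N mem fun x hx => ?_
  rcases hx with rfl | hx | hx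
  · exact hs 0 (Set.mem_insert _ _)
  · exact hs x (Or.inr (Or.inl hx))
  · obtain ⟨z, hz, hzx⟩ := hY x hx
    have hz' : z ∈ insert 0 (X' ∪ Y) := by
      rcases hz with rfl | hz | hz
      · exact Set.mem_insert _ _
      · exact Or.inr (Or.inl (hX' hz))
      · exact Or.inr (Or.inr hz)
    obtain ⟨s, hs1, hs2⟩ := hs z hz'
    exact ⟨s, hs1, fun ω hω => (hs2 ω hω).trans (hzx ω (hB (hC hω)))⟩

theorem Computes.union (h : Computes A X Y c) (h' : Computes A X Z d) :
    Computes A X (Y ∪ Z) (c + d) :=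
  h.trans (h'.mono Set.subset_union_left le_rfl le_rfl)

theorem Computes.biUnion {κ : Type*} (s : Finset κ) (Y : κ → Set (∀ ω, E ω)) (c : κ → ℝ)
    (h : ∀ a ∈ s, Computes A X (Y a) (c a)) : Computes A X (⋃ a ∈ s, Y a) (∑ a ∈ s, c a) := by
  classical
  induction s using Finset.induction_on with
  | empty => simpa using Computes.of_subset (Set.empty_subset X) le_rfl
  | insert a s ha ih =>
    rw [Finset.sum_insert ha, Finset.set_biUnion_insert]
    exact (h a (Finset.mem_insert_self _ _)).union
      (ih fun b hb => h b (Finset.mem_insert_of_mem hb))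

/-- Computing a finite family of values one by one. -/
theorem Computes.iUnion {κ : Type*} [Fintype κ] {Y : κ → Set (∀ ω, E ω)} {c : ℝ}
    (h : ∀ a, Computes A X (Y a) c) : Computes A X (⋃ a, Y a) (Fintype.card κ * c) := by
  have := Computes.biUnion Finset.univ Y (fun _ => c) (fun a _ => h a)
  simpa using this

/-- The operations with arguments taken from variables. -/
def Instr.value {ρ : Type} (σ : ρ → ∀ ω, E ω) (ins : Instr ρ) : ∀ ω, E ω :=
  fun ω => ins.eval (fun r => σ r ω)

/-- The operation `ins` with its registers replaced. -/
def Instr.rename {ρ ρ' : Type} (f : ρ → ρ') : Instr ρ → Instr ρ'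
  | .const z => .const z
  | .add x y => .add (f x) (f y)
  | .sub x y => .sub (f x) (f y)
  | .mul x y => .mul (f x) (f y)
  | .inv x => .inv (f x)

theorem Instr.eval_rename {ρ ρ' F : Type} [Field F] (f : ρ → ρ') (mem : ρ' → F) (ins : Instr ρ) :
    (ins.rename f).eval mem = ins.eval (fun r => mem (f r)) := by
  cases ins <;> rfl

/-- A single operation on known values has cost one. Its result goes to a fresh register. -/
theorem Computes.instr {ρ : Type} (σ : ρ → ∀ ω, E ω) (hσ : ∀ r, σ r ∈ insert 0 X)
    (ins : Instr ρ) : Computes A X {ins.value σ} 1 := by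
  intro B hB X' hX' o y d hr C hC ι N mem hs
  have hσ' : ∀ r, ∃ s : ι ⊕ ℕ, (∀ k, s = Sum.inr k → k < N) ∧ ∀ ω ∈ C, mem ω s = σ r ω :=
    fun r => hs _ (Set.insert_subset_insert hX' (hσ r))
  choose f hf1 hf2 using hσ'
  classical
  -- the result goes to the first work register that holds no known value
  have key := hr C hC ι (N + 1)
    (fun ω => Function.update (mem ω) (Sum.inr N) ((ins.rename f).eval (mem ω))) (by
      intro x hx
      have hx' : x ∈ insert 0 X' ∨ x = ins.value σ := by
        rcases hx with rfl | hx | hx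
        · exact Or.inl (Set.mem_insert _ _)
        · exact Or.inl (Or.inr hx)
        · exact Or.inr hx
      rcases hx' with hx | rfl
      · obtain ⟨s, hs1, hs2⟩ := hs x hx
        refine ⟨s, fun k hk => (hs1 k hk).trans (Nat.lt_succ_self _), fun ω hω => ?_⟩
        have : s ≠ Sum.inr N := fun h => lt_irrefl _ (hs1 N h)
        simp only [Function.update_of_ne this]
        exact hs2 ω hω
      · refine ⟨Sum.inr N, fun k hk => ?_, fun ω hω => ?_⟩
        · rw [← Sum.inr.inj hk]; exact Nat.lt_succ_self _
        · simp only [Function.update_self]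
          rw [Instr.eval_rename, Instr.value]
          congr 1
          funext r
          exact hf2 r ω hω)
  obtain ⟨P, hP⟩ := key
  refine ⟨Prog.step (Sum.inr N) (ins.rename f) P, fun ω hω => ?_⟩
  have := hP ω hω
  refine ⟨?_, ?_⟩
  · rw [Prog.run, ← this.1]
    congr!
  · have h2 : (P.steps (Function.update (mem ω) (Sum.inr N)
        ((ins.rename f).eval (mem ω))) + 1 : ℝ) ≤ 1 + d := by linarith [this.2]
    rw [Prog.steps, Nat.cast_add, Nat.cast_one]
    refine (le_of_eq ?_).trans h2
    congr!

theorem Computes.add {x y : ∀ ω, E ω} (hx : x ∈ X) (hy : y ∈ X) : Computes A X {x + y} 1 :=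
  Computes.instr (fun b : Bool => if b then x else y)
    (by rintro (_ | _) <;> simp [hx, hy]) (.add true false)

theorem Computes.sub {x y : ∀ ω, E ω} (hx : x ∈ X) (hy : y ∈ X) : Computes A X {x - y} 1 :=
  Computes.instr (fun b : Bool => if b then x else y)
    (by rintro (_ | _) <;> simp [hx, hy]) (.sub true false)

theorem Computes.mul {x y : ∀ ω, E ω} (hx : x ∈ X) (hy : y ∈ X) : Computes A X {x * y} 1 :=
  Computes.instr (fun b : Bool => if b then x else y)
    (by rintro (_ | _) <;> simp [hx, hy]) (.mul true false)

theorem Computes.neg {x : ∀ ω, E ω} (hx : x ∈ X) : Computes A X {-x} 1 := by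
  have := Computes.instr (A := A) (fun b : Bool => if b then 0 else x) (X := X)
    (by rintro (_ | _) <;> simp [hx]) (.sub true false)
  convert this using 2
  funext ω
  simp [Instr.value, Instr.eval]

theorem Computes.const (z : ℤ) : Computes A X {(fun ω => (z : E ω))} 1 :=
  Computes.instr (fun _ : Bool => 0) (by simp) (.const z)

theorem Computes.one : Computes A X {(1 : ∀ ω, E ω)} 1 := by
  have := Computes.const (A := A) (X := X) 1
  convert this using 2
  funext ω
  simp

/-- Zero is free: the work registers start with it. -/
theorem Computes.zero : Computes A X {(0 : ∀ ω, E ω)} 0 :=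
  (Computes.of_subset (Set.empty_subset X) le_rfl).congr fun y' hy' =>
    ⟨0, by simp, fun ω _ => by rw [Set.mem_singleton_iff.1 hy']⟩

/-- Case distinction by a zero test. -/
theorem Computes.branch {z : ∀ ω, E ω} (hz : z ∈ insert 0 X)
    (h0 : Computes {ω ∈ A | z ω = 0} X Y c) (h1 : Computes {ω ∈ A | z ω ≠ 0} X Y c) :
    Computes A X Y (c + 1) := by
  intro B hB X' hX' o y d hr C hC ι N mem hs
  obtain ⟨s, hs1, hs2⟩ := hs z (Set.insert_subset_insert hX' hz)
  obtain ⟨P0, hP0⟩ := h0 {ω ∈ C | z ω = 0} (fun ω hω => ⟨hB (hC hω.1), hω.2⟩) X' hX' o y d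
    (hr.anti fun ω hω => hC hω.1) _ le_rfl ι N mem (hs.anti fun ω hω => hω.1)
  obtain ⟨P1, hP1⟩ := h1 {ω ∈ C | z ω ≠ 0} (fun ω hω => ⟨hB (hC hω.1), hω.2⟩) X' hX' o y d
    (hr.anti fun ω hω => hC hω.1) _ le_rfl ι N mem (hs.anti fun ω hω => hω.1)
  refine ⟨Prog.ifZero s P0 P1, fun ω hω => ?_⟩
  by_cases hzω : z ω = 0
  · have := hP0 ω ⟨hω, hzω⟩
    have hm : mem ω s = 0 := (hs2 ω hω).trans hzω
    simp only [Prog.run, Prog.steps, if_pos hm, Nat.cast_add, Nat.cast_one]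
    exact ⟨this.1, by linarith [this.2]⟩
  · have := hP1 ω ⟨hω, hzω⟩
    have hm : mem ω s ≠ 0 := fun h => hzω ((hs2 ω hω).symm.trans h)
    simp only [Prog.run, Prog.steps, if_neg hm, Nat.cast_add, Nat.cast_one]
    exact ⟨this.1, by linarith [this.2]⟩

/-- The inverse, with value `0` at `0`. The inverse operation is executed only on nonzero
elements. -/
theorem Computes.inv {x : ∀ ω, E ω} (hx : x ∈ X) : Computes A X {x⁻¹} 2 := by
  have : Computes A X {x⁻¹} (1 + 1) := by
    refine Computes.branch (z := x) (Or.inr hx) ?_ ?_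
    · refine (Computes.of_subset (Set.empty_subset X) zero_le_one).congr fun y hy => ?_
      rw [Set.mem_singleton_iff.1 hy]
      exact ⟨0, Set.mem_insert _ _, fun ω hω => by simp [hω.2]⟩
    · exact Computes.instr (fun _ : Bool => x) (by simp [hx]) (.inv true)
  exact this.mono le_rfl le_rfl (by norm_num)

/-- A program can be executed on known values. -/
theorem Computes.prog {ρ o : Type} (P : Prog ρ o) (σ : ρ → ∀ ω, E ω)
    (hσ : ∀ r, σ r ∈ insert 0 X) (hc : ∀ ω ∈ A, (P.steps (fun r => σ r ω) : ℝ) ≤ c) (hc0 : 0 ≤ c)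
    (z : o → ∀ ω, E ω) (hz : ∀ j, ∀ ω ∈ A, z j ω = P.run (fun r => σ r ω) j) :
    Computes A X (Set.range z) c := by
  classical
  induction P generalizing A X σ c with
  | ret out =>
    refine (Computes.of_subset (Set.empty_subset X) hc0).congr ?_
    rintro _ ⟨j, rfl⟩
    exact ⟨σ (out j), by simpa using hσ _, fun ω hω => by rw [hz j ω hω]; rfl⟩
  | step dst ins next ih =>
    -- without an instance there is no bound on the remaining cost `c - 1`, and nothing to compute
    rcases A.eq_empty_or_nonempty with rfl | ⟨ω₀, hω₀⟩
    · exact (Computes.of_subset (Set.empty_subset X) hc0).congr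
        fun y hy => ⟨0, by simp, fun ω hω => hω.elim⟩
    have hupd : ∀ ω, (fun r => Function.update σ dst (ins.value σ) r ω)
        = Function.update (fun r => σ r ω) dst (ins.eval fun r => σ r ω) := by
      intro ω
      funext r
      by_cases hr : r = dst
      · subst hr; simp [Instr.value]
      · simp [Function.update_of_ne hr]
    have hstep : ∀ ω ∈ A, (next.steps (fun r => Function.update σ dst (ins.value σ) r ω) : ℝ)
        ≤ c - 1 := by
      intro ω hω
      have := hc ω hω
      rw [hupd]
      simp only [Prog.steps, Nat.cast_add, Nat.cast_one] at this
      have h2 : (next.steps (Function.update (fun r => σ r ω) dst (ins.eval fun r => σ r ω)) : ℝ)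
        + 1 ≤ c := by convert this
      linarith
    have h := ih (A := A) (X := X ∪ {ins.value σ}) (c := c - 1)
      (Function.update σ dst (ins.value σ)) (by
        intro r
        by_cases hr : r = dst
        · subst hr; simp
        · rw [Function.update_of_ne hr]
          exact Set.insert_subset_insert Set.subset_union_left (hσ r))
      hstep ((Nat.cast_nonneg _).trans (hstep ω₀ hω₀))
      (by
        intro j ω hω
        rw [hz j ω hω, hupd]
        simp only [Prog.run])
    exact ((Computes.instr σ hσ ins).andThen h).mono le_rfl le_rfl (by linarith)
  | ifZero x yes no ih0 ih1 =>
    rcases A.eq_empty_or_nonempty with rfl | ⟨ω₀, hω₀⟩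
    · exact (Computes.of_subset (Set.empty_subset X) hc0).congr
        fun y hy => ⟨0, by simp, fun ω hω => hω.elim⟩
    have hc1 : 0 ≤ c - 1 := by
      have := hc ω₀ hω₀
      simp only [Prog.steps, Nat.cast_add, Nat.cast_one] at this
      have h3 : (0 : ℝ) ≤ ((if σ x ω₀ = 0 then yes.steps (fun r => σ r ω₀)
        else no.steps (fun r => σ r ω₀) : ℕ) : ℝ) := Nat.cast_nonneg _
      have h4 : (((if σ x ω₀ = 0 then yes.steps (fun r => σ r ω₀)
        else no.steps (fun r => σ r ω₀) : ℕ) : ℝ)) + 1 ≤ c := by convert this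
      linarith
    have : Computes A X (Set.range z) (c - 1 + 1) := by
      refine Computes.branch (z := σ x) (hσ x) ?_ ?_
      · refine ih0 σ hσ (fun ω hω => ?_) hc1 (fun j ω hω => ?_)
        · have := hc ω hω.1
          simp only [Prog.steps, hω.2, if_true, Nat.cast_add, Nat.cast_one] at this
          linarith
        · rw [hz j ω hω.1]
          simp only [Prog.run, hω.2, if_true]
      · refine ih1 σ hσ (fun ω hω => ?_) hc1 (fun j ω hω => ?_)
        · have := hc ω hω.1
          have h2 : σ x ω ≠ 0 := hω.2
          simp only [Prog.steps, h2, if_false, Nat.cast_add, Nat.cast_one] at this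
          linarith
        · have h2 : σ x ω ≠ 0 := hω.2
          rw [hz j ω hω.1]
          simp only [Prog.run, h2, if_false]
    exact this.mono le_rfl le_rfl (by linarith)

/-- A derivation yields an algorithm. -/
theorem Computes.exists_alg {ι o : Type} {x : ι → ∀ ω, E ω} {y : o → ∀ ω, E ω}
    (h : Computes Set.univ (Set.range x) (Set.range y) c) :
    ∃ P : Alg ι o, ∀ ω, P.output (fun i => x i ω) = (fun j => y j ω) ∧
      (P.cost (fun i => x i ω) : ℝ) ≤ c := by
  have hr : Reach Set.univ (Set.range x ∪ Set.range y) y 0 := by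
    intro A _ ι N mem hs
    have : ∀ j, ∃ s : ι ⊕ ℕ, (∀ k, s = Sum.inr k → k < N) ∧ ∀ ω ∈ A, mem ω s = y j ω :=
      fun j => hs _ (Or.inr (Or.inr ⟨j, rfl⟩))
    choose f hf1 hf2 using this
    refine ⟨.ret f, fun ω hω => ⟨?_, ?_⟩⟩
    · funext j
      exact hf2 j ω hω
    · simp [Prog.steps]
  -- the first work register is reserved for the value zero
  obtain ⟨P, hP⟩ := h Set.univ le_rfl _ le_rfl o y 0 hr Set.univ le_rfl ι 1
    (fun ω => initMem fun i => x i ω) (by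
      rintro z (rfl | ⟨i, rfl⟩)
      · exact ⟨Sum.inr 0, by simp, fun ω _ => rfl⟩
      · exact ⟨Sum.inl i, by simp, fun ω _ => rfl⟩)
  refine ⟨P, fun ω => ?_⟩
  have := hP ω (Set.mem_univ _)
  rw [add_zero] at this
  exact this

end Derivations

/-! ### Linear algebra in a field whose elements are represented by several variables -/

section FieldModels

set_option linter.unusedSectionVars false

open Matrix

variable {Ω : Type*} {E : Ω → Type} [∀ ω, Field (E ω)] {L : Ω → Type} [∀ ω, Field (L ω)]

/-- A representation of the elements of the fields `L ω` by tuples of elements of `E ω`: the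
family `x` is represented by the variables in `rep x`. With the help of the variables in `X₀`
each operation in `L ω` costs at most `c` operations in `E ω`. -/
structure FieldModel (X₀ : Set (∀ ω, E ω)) (rep : (∀ ω, L ω) → Set (∀ ω, E ω)) (c : ℝ) :
    Prop where
  nonneg : 0 ≤ c
  zero' : Computes Set.univ X₀ (rep 0) c
  one' : Computes Set.univ X₀ (rep 1) c
  add' : ∀ x y, Computes Set.univ (X₀ ∪ (rep x ∪ rep y)) (rep (x + y)) c
  sub' : ∀ x y, Computes Set.univ (X₀ ∪ (rep x ∪ rep y)) (rep (x - y)) c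
  mul' : ∀ x y, Computes Set.univ (X₀ ∪ (rep x ∪ rep y)) (rep (x * y)) c
  inv' : ∀ x, Computes Set.univ (X₀ ∪ rep x) (rep x⁻¹) c

/-- The variables that represent the entries of a vector. -/
def vecReps {κ : Type*} (rep : (∀ ω, L ω) → Set (∀ ω, E ω)) (x : κ → ∀ ω, L ω) :
    Set (∀ ω, E ω) := ⋃ i, rep (x i)

/-- The variables that represent the entries of a matrix. -/
def matReps {ι κ : Type*} (rep : (∀ ω, L ω) → Set (∀ ω, E ω)) (M : Matrix ι κ (∀ ω, L ω)) :
    Set (∀ ω, E ω) := ⋃ i, ⋃ j, rep (M i j)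

variable {X X₀ : Set (∀ ω, E ω)} {rep : (∀ ω, L ω) → Set (∀ ω, E ω)} {c : ℝ}
variable {ι κ μ : Type*}

theorem rep_subset_vecReps (x : κ → ∀ ω, L ω) (i : κ) : rep (x i) ⊆ vecReps rep x :=
  Set.subset_iUnion (fun i => rep (x i)) i

theorem rep_subset_matReps (M : Matrix ι κ (∀ ω, L ω)) (i : ι) (j : κ) :
    rep (M i j) ⊆ matReps rep M :=
  Set.subset_iUnion_of_subset i (Set.subset_iUnion (fun j => rep (M i j)) j)

theorem vecReps_subset {x : κ → ∀ ω, L ω} (h : ∀ i, rep (x i) ⊆ X) : vecReps rep x ⊆ X :=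
  Set.iUnion_subset h

theorem matReps_subset {M : Matrix ι κ (∀ ω, L ω)} (h : ∀ i j, rep (M i j) ⊆ X) :
    matReps rep M ⊆ X :=
  Set.iUnion_subset fun i => Set.iUnion_subset fun j => h i j

theorem Computes.vec [Fintype κ] {A : Set Ω} {x : κ → ∀ ω, L ω} {c : ℝ}
    (h : ∀ i, Computes A X (rep (x i)) c) :
    Computes A X (vecReps rep x) (Fintype.card κ * c) :=
  Computes.iUnion h

theorem Computes.mat [Fintype ι] [Fintype κ] {A : Set Ω} {M : Matrix ι κ (∀ ω, L ω)} {c : ℝ}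
    (h : ∀ i j, Computes A X (rep (M i j)) c) :
    Computes A X (matReps rep M) (Fintype.card ι * (Fintype.card κ * c)) :=
  Computes.iUnion fun i => Computes.iUnion fun j => h i j

namespace FieldModel

variable (hm : FieldModel X₀ rep c) (h0 : X₀ ⊆ X)
include hm h0

theorem zero : Computes Set.univ X (rep 0) c := hm.zero'.mono h0 le_rfl le_rfl

theorem one : Computes Set.univ X (rep 1) c := hm.one'.mono h0 le_rfl le_rfl

variable {x y : ∀ ω, L ω} (hx : rep x ⊆ X) (hy : rep y ⊆ X)

include hx in
theorem inv : Computes Set.univ X (rep x⁻¹) c :=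
  (hm.inv' x).mono (Set.union_subset h0 hx) le_rfl le_rfl

include hx hy

theorem add : Computes Set.univ X (rep (x + y)) c :=
  (hm.add' x y).mono (Set.union_subset h0 (Set.union_subset hx hy)) le_rfl le_rfl

theorem sub : Computes Set.univ X (rep (x - y)) c :=
  (hm.sub' x y).mono (Set.union_subset h0 (Set.union_subset hx hy)) le_rfl le_rfl

theorem mul : Computes Set.univ X (rep (x * y)) c :=
  (hm.mul' x y).mono (Set.union_subset h0 (Set.union_subset hx hy)) le_rfl le_rfl

omit hx hy

theorem mul_add {z : ∀ ω, L ω} (hx : rep x ⊆ X) (hy : rep y ⊆ X) (hz : rep z ⊆ X) :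
    Computes Set.univ X (rep (z + x * y)) (2 * c) :=
  ((hm.mul h0 hx hy).andThen (hm.add (h0.trans Set.subset_union_left)
    (hz.trans Set.subset_union_left) Set.subset_union_right)).mono le_rfl le_rfl (by linarith)

theorem sub_mul {z : ∀ ω, L ω} (hx : rep x ⊆ X) (hy : rep y ⊆ X) (hz : rep z ⊆ X) :
    Computes Set.univ X (rep (z - x * y)) (2 * c) :=
  ((hm.mul h0 hx hy).andThen (hm.sub (h0.trans Set.subset_union_left)
    (hz.trans Set.subset_union_left) Set.subset_union_right)).mono le_rfl le_rfl (by linarith)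

theorem sum_mul {x y : κ → ∀ ω, L ω} (s : Finset κ) (hx : ∀ i ∈ s, rep (x i) ⊆ X)
    (hy : ∀ i ∈ s, rep (y i) ⊆ X) :
    Computes Set.univ X (rep (∑ i ∈ s, x i * y i)) ((2 * s.card + 1) * c) := by
  classical
  induction s using Finset.induction_on with
  | empty => simpa using hm.zero h0
  | insert a s ha ih =>
    rw [Finset.sum_insert ha, Finset.card_insert_of_notMem ha, add_comm]
    refine ((ih (fun i hi => hx i (Finset.mem_insert_of_mem hi))
      (fun i hi => hy i (Finset.mem_insert_of_mem hi))).andThen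
      (hm.mul_add (h0.trans Set.subset_union_left)
        ((hx a (Finset.mem_insert_self _ _)).trans Set.subset_union_left)
        ((hy a (Finset.mem_insert_self _ _)).trans Set.subset_union_left)
        Set.subset_union_right)).mono le_rfl le_rfl ?_
    push_cast
    linarith

theorem dotProduct [Fintype κ] {x y : κ → ∀ ω, L ω} (hx : vecReps rep x ⊆ X)
    (hy : vecReps rep y ⊆ X) :
    Computes Set.univ X (rep (x ⬝ᵥ y)) ((2 * Fintype.card κ + 1) * c) :=
  hm.sum_mul h0 Finset.univ (fun i _ => (rep_subset_vecReps x i).trans hx)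
    (fun i _ => (rep_subset_vecReps y i).trans hy)

theorem mulVec [Fintype ι] [Fintype κ] {M : Matrix ι κ (∀ ω, L ω)} {x : κ → ∀ ω, L ω}
    (hM : matReps rep M ⊆ X) (hx : vecReps rep x ⊆ X) :
    Computes Set.univ X (vecReps rep (M *ᵥ x))
      (Fintype.card ι * ((2 * Fintype.card κ + 1) * c)) :=
  Computes.vec fun i => hm.dotProduct h0 (x := M i)
    (vecReps_subset fun j => (rep_subset_matReps M i j).trans hM) hx

theorem vecMul [Fintype ι] [Fintype κ] {M : Matrix ι κ (∀ ω, L ω)} {x : ι → ∀ ω, L ω}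
    (hM : matReps rep M ⊆ X) (hx : vecReps rep x ⊆ X) :
    Computes Set.univ X (vecReps rep (x ᵥ* M))
      (Fintype.card κ * ((2 * Fintype.card ι + 1) * c)) :=
  Computes.vec fun j => hm.dotProduct h0 hx (y := fun i => M i j)
    (vecReps_subset fun i => (rep_subset_matReps M i j).trans hM)

/-- For a vector `x` one finds a vector `g` with `(x ⬝ g) x = x`. On each instance `g` has at most
one nonzero entry, the inverse of the first nonzero entry of `x`: the auxiliary value `q` is `1`
as long as only zeros were met, and `0` afterwards. -/
theorem exists_pivot [Fintype κ] {x : κ → ∀ ω, L ω} (hx : vecReps rep x ⊆ X) :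
    ∃ g : κ → ∀ ω, L ω, (∀ j, (x ⬝ᵥ g) * x j = x j) ∧
      Computes Set.univ X (vecReps rep g) ((4 * Fintype.card κ + 1) * c) := by
  classical
  have key : ∀ s : Finset κ, ∃ (g : κ → ∀ ω, L ω) (q : ∀ ω, L ω),
      (∑ i ∈ s, x i * g i = 1 - q) ∧ (∀ j ∈ s, x j * q = 0) ∧
      Computes Set.univ X ((⋃ j ∈ s, rep (g j)) ∪ rep q) ((4 * s.card + 1) * c) := by
    intro s
    induction s using Finset.induction_on with
    | empty => exact ⟨0, 1, by simp, by simp, by simpa using hm.one h0⟩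
    | insert a s ha ih =>
      obtain ⟨g, q, hg, hq, hc⟩ := ih
      -- the next entry of `g` is nonzero only where `q = 1` and `x a ≠ 0`, and there `q`
      -- drops to `0`
      set r := q * (x a)⁻¹ with hr
      have hxa : x a * (x a)⁻¹ * x a = x a := by
        funext ω
        simp only [Pi.mul_apply, Pi.inv_apply]
        exact mul_inv_mul_cancel _
      refine ⟨Function.update g a r, q - r * x a, ?_, ?_, ?_⟩
      · rw [Finset.sum_insert ha, Function.update_self]
        have : ∑ i ∈ s, x i * Function.update g a r i = ∑ i ∈ s, x i * g i :=
          Finset.sum_congr rfl fun i hi => by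
            rw [Function.update_of_ne (ne_of_mem_of_not_mem hi ha)]
        rw [this, hg]
        ring
      · intro j hj
        rcases Finset.mem_insert.1 hj with rfl | hj
        · have : x j * (q - r * x j) = q * (x j - x j * (x j)⁻¹ * x j) := by rw [hr]; ring
          rw [this, hxa, sub_self, mul_zero]
        · have : x j * (q - r * x a) = x j * q * (1 - (x a)⁻¹ * x a) := by rw [hr]; ring
          rw [this, hq j hj, zero_mul]
      · set Y := (⋃ j ∈ s, rep (g j)) ∪ rep q with hY
        have hxa' : rep (x a) ⊆ X := (rep_subset_vecReps x a).trans hx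
        have s1 : Computes Set.univ (X ∪ Y) (rep (x a)⁻¹) c :=
          hm.inv (h0.trans Set.subset_union_left) (hxa'.trans Set.subset_union_left)
        have s2 : Computes Set.univ (X ∪ Y) (rep r) (c + c) :=
          s1.andThen (hm.mul (h0.trans (Set.subset_union_left.trans Set.subset_union_left))
            (Set.subset_union_right.trans
              (Set.subset_union_right.trans Set.subset_union_left)) Set.subset_union_right)
        have s3 : Computes Set.univ (X ∪ Y) (rep r ∪ rep (q - r * x a)) (c + c + 2 * c) :=
          s2.trans (hm.sub_mul (h0.trans (Set.subset_union_left.trans Set.subset_union_left))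
            Set.subset_union_right
            (hxa'.trans (Set.subset_union_left.trans Set.subset_union_left))
            (Set.subset_union_right.trans
              (Set.subset_union_right.trans Set.subset_union_left)))
        refine (hc.trans s3).mono le_rfl ?_ ?_
        · refine Set.union_subset (Set.iUnion₂_subset fun j hj => ?_) ?_
          · rcases Finset.mem_insert.1 hj with rfl | hj
            · rw [Function.update_self]
              exact Set.subset_union_left.trans Set.subset_union_right
            · rw [Function.update_of_ne (ne_of_mem_of_not_mem hj ha)]
              exact (Set.subset_biUnion_of_mem (u := fun j => rep (g j))
                (Finset.mem_coe.2 hj)).trans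
                (Set.subset_union_left.trans Set.subset_union_left)
          · exact Set.subset_union_right.trans Set.subset_union_right
        · rw [Finset.card_insert_of_notMem ha]
          push_cast
          linarith
  obtain ⟨g, q, hg, hq, hc⟩ := key Finset.univ
  refine ⟨g, fun j => ?_, hc.mono le_rfl ?_ le_rfl⟩
  · have : x ⬝ᵥ g = 1 - q := hg
    rw [this, _root_.sub_mul, one_mul, mul_comm q, hq j (Finset.mem_univ _), sub_zero]
  · refine (vecReps_subset fun j => ?_).trans Set.subset_union_left
    exact Set.subset_biUnion_of_mem (u := fun j => rep (g j)) (Finset.mem_coe.2 (Finset.mem_univ j))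

/-- Elimination of the rows of a matrix one by one: a matrix `K` with columns in the right kernel
of `M` which fixes the right kernel. -/
theorem exists_kernelProjector [Fintype ι] [Fintype κ] [DecidableEq κ] [Nonempty κ]
    {M : Matrix ι κ (∀ ω, L ω)} (hM : matReps rep M ⊆ X) :
    ∃ K : Matrix κ κ (∀ ω, L ω), M * K = 0 ∧ (∀ v, M *ᵥ v = 0 → K *ᵥ v = v) ∧
      Computes Set.univ X (matReps rep K)
        ((13 * Fintype.card ι + 1) * (Fintype.card κ : ℝ) ^ 2 * c) := by
  classical
  set n := Fintype.card κ with hn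
  have hn1 : (1 : ℝ) ≤ n := by exact_mod_cast Fintype.card_pos
  have key : ∀ s : Finset ι, ∃ K : Matrix κ κ (∀ ω, L ω), (∀ i ∈ s, M i ᵥ* K = 0) ∧
      (∀ v, M *ᵥ v = 0 → K *ᵥ v = v) ∧
      Computes Set.univ X (matReps rep K) ((13 * s.card + 1) * (n : ℝ) ^ 2 * c) := by
    intro s
    induction s using Finset.induction_on with
    | empty =>
      refine ⟨1, by simp, by simp, ?_⟩
      refine (Computes.mat (c := c) fun i j => ?_).mono le_rfl le_rfl
        (le_of_eq (by rw [← hn]; simp; ring))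
      rcases eq_or_ne i j with rfl | h
      · rw [Matrix.one_apply_eq]; exact hm.one h0
      · rw [Matrix.one_apply_ne h]; exact hm.zero h0
    | insert a s ha ih =>
      obtain ⟨K, hK, hv, hc⟩ := ih
      -- a row that does not vanish on the columns of `K` is used to clear itself: `K - (K g) x`
      set x := M a ᵥ* K with hx
      have hMa : vecReps rep (M a) ⊆ X := vecReps_subset fun j => (rep_subset_matReps M a j).trans hM
      have s1 := hm.vecMul (X := X ∪ matReps rep K) (h0.trans Set.subset_union_left)
        (M := K) (x := M a) Set.subset_union_right (hMa.trans Set.subset_union_left)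
      rw [← hx] at s1
      obtain ⟨g, hg, s2⟩ := hm.exists_pivot (X := X ∪ matReps rep K ∪ vecReps rep x)
        (h0.trans (Set.subset_union_left.trans Set.subset_union_left)) (x := x)
        Set.subset_union_right
      have s3 := hm.mulVec (X := X ∪ matReps rep K ∪ vecReps rep x ∪ vecReps rep g)
        (M := K) (x := g)
        (h0.trans ((Set.subset_union_left.trans Set.subset_union_left).trans
          Set.subset_union_left))
        ((Set.subset_union_right.trans Set.subset_union_left).trans Set.subset_union_left)
        Set.subset_union_right
      set h := K *ᵥ g with hh
      have s23 := s2.andThen s3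
      have s4 : Computes Set.univ (X ∪ matReps rep K ∪ vecReps rep x ∪ vecReps rep h)
          (matReps rep (K - Matrix.vecMulVec h x)) (n * (n * (2 * c))) := by
        refine Computes.mat fun i j => ?_
        rw [Matrix.sub_apply, Matrix.vecMulVec_apply]
        exact hm.sub_mul
          (h0.trans ((Set.subset_union_left.trans Set.subset_union_left).trans
            Set.subset_union_left))
          ((rep_subset_vecReps h i).trans Set.subset_union_right)
          ((rep_subset_vecReps x j).trans (Set.subset_union_right.trans Set.subset_union_left))
          ((rep_subset_matReps K i j).trans ((Set.subset_union_right.trans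
            Set.subset_union_left).trans Set.subset_union_left))
      have hxg : ∀ i : κ → ∀ ω, L ω, i ⬝ᵥ h = (i ᵥ* K) ⬝ᵥ g := fun i => by
        rw [hh, Matrix.dotProduct_mulVec]
      refine ⟨K - Matrix.vecMulVec h x, ?_, ?_, ?_⟩
      · intro i hi
        have e : M i ᵥ* (K - Matrix.vecMulVec h x) = M i ᵥ* K - (M i ⬝ᵥ h) • x := by
          rw [Matrix.vecMul_sub, Matrix.vecMul_vecMulVec]
        rw [e, hxg]
        rcases Finset.mem_insert.1 hi with rfl | hi
        · rw [← hx]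
          funext j
          simp only [Pi.sub_apply, Pi.smul_apply, smul_eq_mul, hg j, sub_self, Pi.zero_apply]
        · rw [hK i hi, zero_dotProduct, zero_smul, sub_zero]
      · intro v hMv
        have hxv : x ⬝ᵥ v = 0 := by
          rw [hx, ← Matrix.dotProduct_mulVec, hv v hMv]
          exact congrFun hMv a
        rw [Matrix.sub_mulVec, hv v hMv, Matrix.vecMulVec_mulVec, hxv]
        simp
      · refine (hc.andThen (s1.andThen (s23.andThen s4))).mono le_rfl le_rfl ?_
        rw [Finset.card_insert_of_notMem ha, ← hn]
        push_cast
        have hc0 := hm.nonneg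
        nlinarith [mul_nonneg hc0 (sub_nonneg.2 hn1),
          mul_nonneg (mul_nonneg hc0 (sub_nonneg.2 hn1)) (by linarith : (0:ℝ) ≤ n)]
  obtain ⟨K, hK, hv, hc⟩ := key Finset.univ
  refine ⟨K, ?_, hv, hc⟩
  refine Matrix.ext fun i j => ?_
  exact congrFun (hK i (Finset.mem_univ _)) j

/-- A kernel spanned on each instance by a vector with entry `1` at `i₀`: this vector is found from
a matrix with columns in the kernel that fixes it. -/
theorem normalize [Fintype κ] {K : Matrix κ κ (∀ ω, L ω)} {v : κ → ∀ ω, L ω} {i₀ : κ}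
    (hK : matReps rep K ⊆ X) (hcol : ∀ j l, K j l = v j * K i₀ l) (hv : K *ᵥ v = v)
    (hi : v i₀ = 1) :
    Computes Set.univ X (vecReps rep v)
      ((4 * Fintype.card κ + 1) * c + Fintype.card κ * ((2 * Fintype.card κ + 1) * c)) := by
  obtain ⟨g, hg, hc⟩ := hm.exists_pivot h0 (x := K i₀)
    (vecReps_subset fun j => (rep_subset_matReps K i₀ j).trans hK)
  have s := hm.mulVec (X := X ∪ vecReps rep g) (h0.trans Set.subset_union_left) (M := K) (x := g)
    (hK.trans Set.subset_union_left) Set.subset_union_right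
  have h1 : K i₀ ⬝ᵥ v = 1 := (congrFun hv i₀).trans hi
  have h2 : K i₀ ⬝ᵥ g = 1 := by
    have : (K i₀ ⬝ᵥ g) * (K i₀ ⬝ᵥ v) = K i₀ ⬝ᵥ v := by
      simp only [_root_.dotProduct, Finset.mul_sum]
      refine Finset.sum_congr rfl fun j _ => ?_
      rw [← mul_assoc]
      exact congrArg (· * v j) (hg j)
    rwa [h1, mul_one] at this
  have e : K *ᵥ g = v := by
    funext j
    have : (K *ᵥ g) j = v j * (K i₀ ⬝ᵥ g) := by
      simp only [Matrix.mulVec, _root_.dotProduct, Finset.mul_sum]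
      exact Finset.sum_congr rfl fun l _ => by rw [hcol j l, mul_assoc]
    rw [this, h2, mul_one]
  rw [e] at s
  exact hc.andThen s

end FieldModel

/-- A field represents itself. -/
theorem fieldModel_self : FieldModel (L := E) (∅ : Set (∀ ω, E ω)) (fun x => {x}) 2 where
  nonneg := by norm_num
  zero' := Computes.zero.mono le_rfl le_rfl (by norm_num)
  one' := Computes.one.mono le_rfl le_rfl (by norm_num)
  add' x y := (Computes.add (by simp) (by simp)).mono le_rfl le_rfl (by norm_num)
  sub' x y := (Computes.sub (by simp) (by simp)).mono le_rfl le_rfl (by norm_num)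
  mul' x y := (Computes.mul (by simp) (by simp)).mono le_rfl le_rfl (by norm_num)
  inv' x := Computes.inv (by simp)

end FieldModels

/-! ### Fast elimination over the base field -/

section FastElimination

set_option linter.unusedSectionVars false

open Matrix

variable {Ω : Type*} {E : Ω → Type} [∀ ω, Field (E ω)]

/-- The entries of a matrix of variables. -/
abbrev entrySet {ι κ : Type*} (M : Matrix ι κ (∀ ω, E ω)) : Set (∀ ω, E ω) :=
  matReps (L := E) (fun x => {x}) M

theorem mem_entrySet {ι κ : Type*} (M : Matrix ι κ (∀ ω, E ω)) (i : ι) (j : κ) :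
    M i j ∈ entrySet M :=
  rep_subset_matReps (L := E) (rep := fun x => {x}) M i j rfl

theorem entrySet_subset {ι κ : Type*} {M : Matrix ι κ (∀ ω, E ω)} {X : Set (∀ ω, E ω)}
    (h : ∀ i j, M i j ∈ X) : entrySet M ⊆ X :=
  matReps_subset fun i j => Set.singleton_subset_iff.2 (h i j)

variable (E) in
/-- Square matrices of variables can be multiplied with `A₀ * d ^ w` operations. -/
structure FastMul (w A₀ : ℝ) : Prop where
  exponent : 2 < w
  nonneg : 0 ≤ A₀
  mul' : ∀ (d : ℕ) (M N : Matrix (Fin d) (Fin d) (∀ ω, E ω)),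
    Computes Set.univ (entrySet M ∪ entrySet N) (entrySet (M * N)) (A₀ * (d : ℝ) ^ w)

/-- The assumption on matrix multiplication, with `|A₀|` in place of `A₀`, so that the bounds derived
from it are monotone. -/
theorem MatMulBound.fastMul {p : ℕ} {w A₀ : ℝ} (h : MatMulBound p w A₀) (hw : 2 < w)
    [∀ ω, Finite (E ω)] [∀ ω, CharP (E ω) p] : FastMul E w |A₀| where
  exponent := hw
  nonneg := abs_nonneg _
  mul' d M N := by
    obtain ⟨P, hP⟩ := h d
    set x : (Fin d × Fin d) ⊕ (Fin d × Fin d) → ∀ ω, E ω :=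
      Sum.elim (fun a => M a.1 a.2) (fun a => N a.1 a.2) with hx
    have hmem : ∀ ω, (fun r => (Sum.elim x (fun _ => 0) : _ ⊕ ℕ → ∀ ω, E ω) r ω)
        = initMem (Sum.elim (fun a => M a.1 a.2 ω) (fun a => N a.1 a.2 ω)) := by
      intro ω
      funext r
      rcases r with (r | r) | r <;> rfl
    have hpow : A₀ * (d : ℝ) ^ w ≤ |A₀| * (d : ℝ) ^ w :=
      mul_le_mul_of_nonneg_right (le_abs_self _) (Real.rpow_nonneg (Nat.cast_nonneg _) _)
    have := Computes.prog (A := Set.univ) (X := entrySet M ∪ entrySet N) (c := |A₀| * (d : ℝ) ^ w) P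
      (Sum.elim x (fun _ => 0)) (by
        rintro ((a | a) | a)
        · exact Or.inr (Or.inl (mem_entrySet M a.1 a.2))
        · exact Or.inr (Or.inr (mem_entrySet N a.1 a.2))
        · exact Or.inl rfl)
      (fun ω _ => by
        rw [hmem]
        exact ((hP (E ω) (M.map fun z => z ω) (N.map fun z => z ω)).2).trans hpow)
      (mul_nonneg (abs_nonneg _) (Real.rpow_nonneg (Nat.cast_nonneg _) _))
      (fun ij => (M * N) ij.1 ij.2) (fun ij ω _ => by
        rw [hmem]
        refine Eq.trans ?_ ((hP (E ω) (M.map fun z => z ω) (N.map fun z => z ω)).1 ij.1 ij.2).symm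
        simp [Matrix.mul_apply])
    exact this.mono le_rfl (entrySet_subset fun i j => ⟨(i, j), rfl⟩) le_rfl

variable {X : Set (∀ ω, E ω)} {ι κ μ : Type*} {w A₀ : ℝ}

theorem Computes.sum {A : Set Ω} (s : Finset κ) {x : κ → ∀ ω, E ω} (hx : ∀ i ∈ s, x i ∈ X) :
    Computes A X {∑ i ∈ s, x i} s.card := by
  classical
  induction s using Finset.induction_on with
  | empty => simpa using Computes.zero
  | insert a s ha ih =>
    rw [Finset.sum_insert ha, Finset.card_insert_of_notMem ha, Nat.cast_add, Nat.cast_one]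
    exact (ih fun i hi => hx i (Finset.mem_insert_of_mem hi)).andThen
      (Computes.add (Or.inl (hx a (Finset.mem_insert_self _ _))) (Or.inr rfl))

theorem Computes.matSub [Fintype ι] [Fintype κ] {M N : Matrix ι κ (∀ ω, E ω)}
    (hM : entrySet M ⊆ X) (hN : entrySet N ⊆ X) :
    Computes Set.univ X (entrySet (M - N)) (Fintype.card ι * Fintype.card κ) := by
  refine (Computes.mat (c := 1) fun i j => ?_).mono le_rfl le_rfl (le_of_eq (by ring))
  exact Computes.sub (hM (mem_entrySet M i j)) (hN (mem_entrySet N i j))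

namespace FastMul

/-- Rectangular matrices are multiplied by cutting them into square blocks of size `d`. -/
theorem mul_of_blocks [Fintype ι] [Fintype κ] [Fintype μ] (hf : FastMul E w A₀)
    {M : Matrix ι κ (∀ ω, E ω)} {N : Matrix κ μ (∀ ω, E ω)} (d a b e : ℕ)
    (hι : Fintype.card ι ≤ a * d) (hκ : Fintype.card κ ≤ b * d) (hμ : Fintype.card μ ≤ e * d)
    (hM : entrySet M ⊆ X) (hN : entrySet N ⊆ X) :
    Computes Set.univ X (entrySet (M * N)) (a * b * e * (A₀ * (d : ℝ) ^ w + (d : ℝ) ^ 2)) := by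
  classical
  obtain ⟨f⟩ := Function.Embedding.nonempty_of_card_le (α := ι) (β := Fin a × Fin d) (by simpa using hι)
  obtain ⟨g⟩ := Function.Embedding.nonempty_of_card_le (α := κ) (β := Fin b × Fin d) (by simpa using hκ)
  obtain ⟨h⟩ := Function.Embedding.nonempty_of_card_le (α := μ) (β := Fin e × Fin d) (by simpa using hμ)
  -- both matrices are padded with zeros to whole numbers of blocks
  set M' : (Fin a × Fin d) × (Fin b × Fin d) → ∀ ω, E ω :=
    Function.extend (Prod.map f g) (fun x => M x.1 x.2) 0 with hM'
  set N' : (Fin b × Fin d) × (Fin e × Fin d) → ∀ ω, E ω :=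
    Function.extend (Prod.map g h) (fun x => N x.1 x.2) 0 with hN'
  have hfg : Function.Injective (Prod.map f g) := f.injective.prodMap g.injective
  have hgh : Function.Injective (Prod.map g h) := g.injective.prodMap h.injective
  have hM1 : ∀ i j, M' (f i, g j) = M i j := fun i j => hfg.extend_apply _ _ (i, j)
  have hN1 : ∀ i j, N' (g i, h j) = N i j := fun i j => hgh.extend_apply _ _ (i, j)
  have hM2 : ∀ x, M' x ∈ X ∪ {0} := by
    intro x
    by_cases hx : ∃ y, Prod.map f g y = x
    · obtain ⟨y, rfl⟩ := hx
      exact Or.inl (hM (by rw [hM']; simp only [hfg.extend_apply]; exact mem_entrySet M _ _))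
    · exact Or.inr (by rw [hM', Function.extend_apply' _ _ _ hx]; rfl)
  have hN2 : ∀ x, N' x ∈ X ∪ {0} := by
    intro x
    by_cases hx : ∃ y, Prod.map g h y = x
    · obtain ⟨y, rfl⟩ := hx
      exact Or.inl (hN (by rw [hN']; simp only [hgh.extend_apply]; exact mem_entrySet N _ _))
    · exact Or.inr (by rw [hN', Function.extend_apply' _ _ _ hx]; rfl)
  have hM3 : ∀ i y, y ∉ Set.range g → M' (f i, y) = 0 := by
    intro i y hy
    rw [hM', Function.extend_apply']
    · rfl
    · rintro ⟨⟨i', j'⟩, hij⟩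
      exact hy ⟨j', congrArg Prod.snd hij⟩
  let Mb : Fin a → Fin b → Matrix (Fin d) (Fin d) (∀ ω, E ω) :=
    fun p q => Matrix.of fun s t => M' ((p, s), (q, t))
  let Nb : Fin b → Fin e → Matrix (Fin d) (Fin d) (∀ ω, E ω) :=
    fun q r => Matrix.of fun s t => N' ((q, s), (r, t))
  have hprod : ∀ i k, (M * N) i k
      = ∑ q, (Mb (f i).1 q * Nb q (h k).1) (f i).2 (h k).2 := by
    intro i k
    simp only [Matrix.mul_apply, Mb, Nb, Matrix.of_apply, Prod.mk.eta]
    rw [← Fintype.sum_prod_type' (f := fun q t => M' (f i, (q, t)) * N' ((q, t), h k))]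
    refine Fintype.sum_of_injective g g.injective _ _ (fun y hy => ?_) (fun j => ?_)
    · rw [Prod.mk.eta, hM3 i y hy, zero_mul]
    · rw [Prod.mk.eta, hM1, hN1]
  have s1 : Computes Set.univ (X ∪ {0})
      (⋃ p, ⋃ q, ⋃ r, entrySet (Mb p q * Nb q r)) (a * (b * (e * (A₀ * (d : ℝ) ^ w)))) := by
    have := Computes.iUnion (A := Set.univ) (X := X ∪ {0}) fun p => Computes.iUnion fun q =>
      Computes.iUnion fun r => (hf.mul' d (Mb p q) (Nb q r)).mono (X' := X ∪ {0})
      (Set.union_subset (entrySet_subset fun s t => hM2 _) (entrySet_subset fun s t => hN2 _))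
      le_rfl le_rfl
    simpa using this
  have s2 := (Computes.zero (A := Set.univ) (X := X)).andThen s1
  have s3 : Computes Set.univ (X ∪ ⋃ p, ⋃ q, ⋃ r, entrySet (Mb p q * Nb q r)) (entrySet (M * N))
      (Fintype.card ι * (Fintype.card μ * b)) := by
    refine Computes.mat fun i k => ?_
    rw [hprod i k]
    have := Computes.sum (A := Set.univ)
      (X := X ∪ ⋃ p, ⋃ q, ⋃ r, entrySet (Mb p q * Nb q r)) (Finset.univ : Finset (Fin b))
      (x := fun q => (Mb (f i).1 q * Nb q (h k).1) (f i).2 (h k).2) (fun q _ => Or.inr (by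
        simp only [Set.mem_iUnion]
        exact ⟨(f i).1, q, (h k).1, mem_entrySet _ _ _⟩))
    simpa using this
  refine (s2.andThen s3).mono le_rfl le_rfl ?_
  have h1 : (Fintype.card ι : ℝ) ≤ a * d := by exact_mod_cast hι
  have h2 : (Fintype.card μ : ℝ) ≤ e * d := by exact_mod_cast hμ
  have h3 : (Fintype.card ι : ℝ) * (Fintype.card μ * b) ≤ (a * d) * ((e * d) * b) := by gcongr
  nlinarith

/-- A product of matrices all of whose dimensions are at most `d`, except that the inner
dimension may be up to `b * d`, or the last one up to `e * d`. -/
theorem mul_le [Fintype ι] [Fintype κ] [Fintype μ] (hf : FastMul E w A₀)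
    {M : Matrix ι κ (∀ ω, E ω)} {N : Matrix κ μ (∀ ω, E ω)} (d a b e : ℕ) {c : ℝ} (hd : 1 ≤ d)
    (hι : Fintype.card ι ≤ a * d) (hκ : Fintype.card κ ≤ b * d) (hμ : Fintype.card μ ≤ e * d)
    (hM : entrySet M ⊆ X) (hN : entrySet N ⊆ X) (hc : (a * b * e : ℝ) ≤ c) :
    Computes Set.univ X (entrySet (M * N)) (c * ((A₀ + 1) * (d : ℝ) ^ w)) := by
  refine (hf.mul_of_blocks d a b e hι hκ hμ hM hN).mono le_rfl le_rfl ?_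
  have hd' : (1 : ℝ) ≤ d := by exact_mod_cast hd
  have h2 : (d : ℝ) ^ 2 ≤ (d : ℝ) ^ w := by
    rw [← Real.rpow_natCast]
    exact Real.rpow_le_rpow_of_exponent_le hd' (by exact_mod_cast hf.exponent.le)
  have h3 : (0 : ℝ) ≤ (d : ℝ) ^ w := Real.rpow_nonneg (Nat.cast_nonneg _) _
  have h4 : A₀ * (d : ℝ) ^ w + (d : ℝ) ^ 2 ≤ (A₀ + 1) * (d : ℝ) ^ w := by linarith
  have := hf.nonneg
  have h5 : 0 ≤ A₀ * (d : ℝ) ^ w + (d : ℝ) ^ 2 := by positivity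
  have h6 : (0 : ℝ) ≤ c := le_trans (by positivity) hc
  exact mul_le_mul hc h4 h5 h6

/-- The constant in the cost of a generalized inverse. It dominates the cost of the leaves of
the recursion and makes up for the two half-size calls being worth a factor `2 / 2 ^ (w - 1)`. -/
noncomputable def invConst (w A₀ : ℝ) : ℝ :=
  10 + 13 * (A₀ + 1) / ((2 : ℝ) ^ (w - 1) - 2)

theorem two_lt_rpow (hw : 2 < w) : 0 < (2 : ℝ) ^ (w - 1) - 2 := by
  have : (2 : ℝ) ^ (1 : ℝ) < (2 : ℝ) ^ (w - 1) :=
    Real.rpow_lt_rpow_of_exponent_lt (by norm_num) (by linarith)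
  rw [Real.rpow_one] at this
  linarith

/-- A generalized inverse `G` of `M`, that is `M * G * M = M`, is computed by recursion on the
number of rows: for `M` with row blocks `M₁` and `M₂` and `G₁` for `M₁`, the matrix
`N₂ = M₂ - M₂ G₁ M₁` is `M₂` on the kernel of `M₁`, and a generalized inverse `G₂` of `N₂`
completes `G₁`. Since `2 < w` the cost is dominated by the top level. -/
theorem exists_generalizedInverse (hf : FastMul E w A₀) {κ : Type} [Fintype κ] [Nonempty κ]
    (t : ℕ) (ht : 2 ^ t ≤ 2 * Fintype.card κ) {ι : Type} [Fintype ι] (hι : Fintype.card ι ≤ 2 ^ t)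
    {M : Matrix ι κ (∀ ω, E ω)} {X : Set (∀ ω, E ω)} (hM : entrySet M ⊆ X) :
    ∃ G : Matrix κ ι (∀ ω, E ω), M * G * M = M ∧ Computes Set.univ X (entrySet G)
      (invConst w A₀ * Fintype.card κ * ((2 : ℝ) ^ t) ^ (w - 1)) := by
  classical
  set n := Fintype.card κ with hn
  have hn1 : 1 ≤ n := Fintype.card_pos
  have hn1' : (1 : ℝ) ≤ n := by exact_mod_cast hn1
  have hA := hf.nonneg
  have hw := hf.exponent
  have hθ := two_lt_rpow hw
  have hB : 10 ≤ invConst w A₀ := by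
    have : 0 ≤ 13 * (A₀ + 1) / ((2 : ℝ) ^ (w - 1) - 2) := by positivity
    unfold invConst
    linarith
  induction t generalizing ι X with
  | zero =>
    have h1 : ((2 : ℝ) ^ 0) ^ (w - 1) = 1 := by simp
    rw [h1, mul_one]
    rcases isEmpty_or_nonempty ι with hE | ⟨⟨i₀⟩⟩
    · refine ⟨0, by ext i; exact isEmptyElim i, Computes.of_subset ?_ (by positivity)⟩
      exact entrySet_subset fun _ i => isEmptyElim i
    · have hsub : Subsingleton ι := Fintype.card_le_one_iff_subsingleton.1 (by simpa using hι)
      obtain ⟨g, hg, hc⟩ := (fieldModel_self (E := E)).exists_pivot (X := X) (Set.empty_subset _)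
        (x := M i₀) (vecReps_subset fun j =>
          Set.singleton_subset_iff.2 (hM (mem_entrySet M i₀ j)))
      refine ⟨Matrix.of fun j _ => g j, ?_, hc.mono le_rfl ?_ ?_⟩
      · refine Matrix.ext fun i j => ?_
        rw [Subsingleton.elim i i₀, Matrix.mul_apply, Fintype.sum_subsingleton _ i₀]
        exact hg j
      · exact entrySet_subset fun j _ =>
          rep_subset_vecReps (L := E) (rep := fun x => {x}) g j rfl
      · rw [← hn]
        nlinarith
  | succ t ih =>
    set a : ℕ := 2 ^ t with ha
    have ha1 : 1 ≤ a := Nat.one_le_two_pow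
    have han : a ≤ n := by rw [pow_succ] at ht; omega
    have hcard : Fintype.card ι ≤ a + a := by rw [pow_succ] at hι; omega
    -- two blocks of at most `a` rows
    obtain ⟨a₁, a₂, h1, h2, h12⟩ : ∃ a₁ a₂, a₁ ≤ a ∧ a₂ ≤ a ∧ Fintype.card ι = a₁ + a₂ :=
      ⟨min (Fintype.card ι) a, Fintype.card ι - min (Fintype.card ι) a, by omega, by omega,
        by omega⟩
    let e : Fin a₁ ⊕ Fin a₂ ≃ ι := Fintype.equivOfCardEq (by simp [h12])
    set M₁ : Matrix (Fin a₁) κ (∀ ω, E ω) := M.submatrix (fun i => e (Sum.inl i)) id with hM₁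
    set M₂ : Matrix (Fin a₂) κ (∀ ω, E ω) := M.submatrix (fun i => e (Sum.inr i)) id with hM₂
    have hX1 : entrySet M₁ ⊆ X := entrySet_subset fun i j => hM (mem_entrySet M _ _)
    have hX2 : entrySet M₂ ⊆ X := entrySet_subset fun i j => hM (mem_entrySet M _ _)
    -- every product has one dimension up to `n` and two dimensions up to `a`
    obtain ⟨b, hb1, hb2⟩ : ∃ b : ℕ, n ≤ b * a ∧ (b : ℝ) ≤ 2 * n / a := by
      refine ⟨n / a + 1, ?_, ?_⟩
      · have := Nat.div_add_mod n a
        have := Nat.mod_lt n ha1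
        nlinarith
      · have : (0 : ℝ) < a := by exact_mod_cast ha1
        have h3 : ((n / a : ℕ) : ℝ) ≤ n / a := Nat.cast_div_le
        have h4 : (1 : ℝ) ≤ n / a := (one_le_div this).2 (by exact_mod_cast han)
        push_cast
        rw [mul_div_assoc]
        linarith
    have hc1 : Fintype.card (Fin a₁) ≤ 1 * a := by simpa using h1
    have hc2 : Fintype.card (Fin a₂) ≤ 1 * a := by simpa using h2
    have hb3 : (1 : ℝ) * b * 1 ≤ 2 * n / a := by simpa using hb2
    have hb4 : (1 : ℝ) * 1 * b ≤ 2 * n / a := by simpa using hb2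
    have hb5 : (b : ℝ) * 1 * 1 ≤ 2 * n / a := by simpa using hb2
    set c := 2 * n / a * ((A₀ + 1) * (a : ℝ) ^ w) with hcdef
    obtain ⟨G₁, hG₁, k1⟩ := ih (ι := Fin a₁) (by simpa using h1) hX1 (by omega)
    set X1 := X ∪ entrySet G₁ with hX1def
    have XX1 : X ⊆ X1 := Set.subset_union_left
    have hG1X : entrySet G₁ ⊆ X1 := Set.subset_union_right
    have k2 : Computes Set.univ X1 (entrySet (M₂ * G₁)) c :=
      hf.mul_le a 1 b 1 ha1 hc2 hb1 hc1 (hX2.trans XX1) hG1X (by simpa using hb3)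
    set X2 := X1 ∪ entrySet (M₂ * G₁) with hX2def
    have X12 : X1 ⊆ X2 := Set.subset_union_left
    have k3 : Computes Set.univ X2 (entrySet (M₂ * G₁ * M₁)) c :=
      hf.mul_le a 1 1 b ha1 hc2 hc1 hb1 Set.subset_union_right ((hX1.trans XX1).trans X12)
        (by simpa using hb4)
    have k4 : Computes Set.univ (X2 ∪ entrySet (M₂ * G₁ * M₁)) (entrySet (M₂ - M₂ * G₁ * M₁))
        (a * n) :=
      (Computes.matSub (((hX2.trans XX1).trans X12).trans Set.subset_union_left)
        Set.subset_union_right).mono le_rfl le_rfl (by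
          rw [Fintype.card_fin]
          gcongr)
    set N₂ := M₂ - M₂ * G₁ * M₁ with hN₂
    set X3 := X2 ∪ entrySet N₂ with hX3def
    have X23 : X2 ⊆ X3 := Set.subset_union_left
    obtain ⟨G₂, hG₂, k5⟩ := ih (ι := Fin a₂) (M := N₂) (by simpa using h2)
      (Set.subset_union_right : _ ⊆ X3) (by omega)
    set X4 := X3 ∪ entrySet G₂ with hX4def
    have X34 : X3 ⊆ X4 := Set.subset_union_left
    have k6 : Computes Set.univ X4 (entrySet (M₁ * G₂)) c :=
      hf.mul_le a 1 b 1 ha1 hc1 hb1 hc2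
        ((((hX1.trans XX1).trans X12).trans X23).trans X34) Set.subset_union_right
        (by simpa using hb3)
    have k7 : Computes Set.univ (X4 ∪ entrySet (M₁ * G₂)) (entrySet (G₁ * (M₁ * G₂))) c :=
      hf.mul_le a b 1 1 ha1 hb1 hc1 hc2
        ((((hG1X.trans X12).trans X23).trans X34).trans Set.subset_union_left)
        Set.subset_union_right (by simpa using hb5)
    have k8 : Computes Set.univ (X4 ∪ entrySet (G₁ * (M₁ * G₂)))
        (entrySet (G₂ - G₁ * (M₁ * G₂))) (a * n) :=
      (Computes.matSub (Set.subset_union_right.trans Set.subset_union_left)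
        Set.subset_union_right).mono le_rfl le_rfl (by
          rw [Fintype.card_fin, mul_comm]
          gcongr)
    -- the generalized inverse of the whole matrix has the column blocks `Z₁` and `Z₂`
    set Z₂ := G₂ - G₁ * (M₁ * G₂) with hZ₂
    set X5 := X4 ∪ entrySet Z₂ with hX5def
    have X45 : X4 ⊆ X5 := Set.subset_union_left
    have k9 : Computes Set.univ X5 (entrySet (Z₂ * (M₂ * G₁))) c :=
      hf.mul_le a b 1 1 ha1 hb1 hc2 hc1 Set.subset_union_right
        (((Set.subset_union_right.trans X23).trans X34).trans X45) (by simpa using hb5)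
    have k10 : Computes Set.univ (X5 ∪ entrySet (Z₂ * (M₂ * G₁)))
        (entrySet (G₁ - Z₂ * (M₂ * G₁))) (a * n) :=
      (Computes.matSub (((((hG1X.trans X12).trans X23).trans X34).trans X45).trans
        Set.subset_union_left) Set.subset_union_right).mono le_rfl le_rfl (by
          rw [Fintype.card_fin, mul_comm]
          gcongr)
    set Z₁ := G₁ - Z₂ * (M₂ * G₁) with hZ₁
    have kfin : Computes Set.univ X (entrySet Z₂ ∪ entrySet Z₁) _ :=
      k1.andThen (k2.andThen ((k3.andThen k4).andThen (k5.andThen ((k6.andThen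
        (k7)).andThen k8 |>.trans (k9.andThen k10)))))
    have hMZ : M₁ * Z₂ = 0 := by
      rw [hZ₂, Matrix.mul_sub, ← Matrix.mul_assoc, ← Matrix.mul_assoc, hG₁, sub_self]
    have hMZ' : M₂ * Z₂ = N₂ * G₂ := by
      rw [hZ₂, hN₂, Matrix.mul_sub, Matrix.sub_mul]
      simp only [Matrix.mul_assoc]
    refine ⟨Matrix.of fun j i => Sum.elim (Z₁ j) (Z₂ j) (e.symm i), ?_,
      kfin.mono le_rfl (entrySet_subset fun j i => ?_) ?_⟩
    · set G : Matrix κ ι (∀ ω, E ω) := Matrix.of fun j i => Sum.elim (Z₁ j) (Z₂ j) (e.symm i)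
        with hG
      have hGM : G * M = Z₁ * M₁ + Z₂ * M₂ := by
        ext j l : 2
        rw [Matrix.add_apply, Matrix.mul_apply, Matrix.mul_apply, Matrix.mul_apply,
          ← Equiv.sum_comp e, Fintype.sum_sum_type]
        simp [hG, hM₁, hM₂]
      have e1 : G * M = G₁ * M₁ + Z₂ * N₂ := by
        rw [hGM, hZ₁, hN₂, Matrix.sub_mul, Matrix.mul_sub]
        simp only [Matrix.mul_assoc]
        abel
      have r1 : M₁ * (G * M) = M₁ := by
        rw [e1, Matrix.mul_add, ← Matrix.mul_assoc, ← Matrix.mul_assoc, hG₁, hMZ,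
          Matrix.zero_mul, add_zero]
      have r2 : M₂ * (G * M) = M₂ := by
        rw [e1, Matrix.mul_add, ← Matrix.mul_assoc, ← Matrix.mul_assoc, hMZ', hG₂, hN₂]
        abel
      rw [Matrix.mul_assoc]
      refine Matrix.ext fun i j => ?_
      obtain ⟨i', rfl⟩ := e.surjective i
      rcases i' with i' | i'
      · exact congrFun (congrFun r1 i') j
      · exact congrFun (congrFun r2 i') j
    · rw [Matrix.of_apply]
      rcases e.symm i with i' | i'
      · exact Or.inr (mem_entrySet Z₁ j i')
      · exact Or.inl (mem_entrySet Z₂ j i')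
    · have ha' : (1 : ℝ) ≤ a := by exact_mod_cast ha1
      have ha0 : (0 : ℝ) < a := by linarith
      set u := (a : ℝ) ^ (w - 1) with hu
      have hcu : c = 2 * (A₀ + 1) * n * u := by
        rw [hcdef, hu, Real.rpow_sub_one ha0.ne']
        field_simp
      have hau : (a : ℝ) ≤ u := by
        rw [hu]
        calc (a : ℝ) = (a : ℝ) ^ (1 : ℝ) := (Real.rpow_one _).symm
          _ ≤ _ := Real.rpow_le_rpow_of_exponent_le ha' (by linarith)
      have hpow : ((2 : ℝ) ^ (t + 1)) ^ (w - 1) = (2 : ℝ) ^ (w - 1) * u := by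
        rw [pow_succ, mul_comm, Real.mul_rpow (by norm_num) (by positivity), hu, ha]
        push_cast
        rfl
      have hau2 : ((2 : ℝ) ^ t) ^ (w - 1) = u := by rw [hu, ha]; push_cast; rfl
      rw [hpow, hau2, hcu]
      have hBθ : 13 * (A₀ + 1) ≤ invConst w A₀ * ((2 : ℝ) ^ (w - 1) - 2) := by
        unfold invConst
        rw [add_mul, div_mul_cancel₀ _ hθ.ne']
        linarith
      have hnu : 0 ≤ n * u := by positivity
      have h3 := mul_le_mul_of_nonneg_right hBθ hnu
      have h4 : (a : ℝ) * n ≤ n * u := by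
        rw [mul_comm]
        gcongr
      have h5 : 0 ≤ A₀ * (n * u) := by positivity
      nlinarith

/-- The constant in the cost of eliminating one block of rows. -/
noncomputable def blockConst (w A₀ : ℝ) : ℝ :=
  invConst w A₀ * (2 : ℝ) ^ (w - 1) + 3 * (A₀ + 1) + 1

theorem blockConst_nonneg (hw : 2 < w) (hA : 0 ≤ A₀) : 0 ≤ blockConst w A₀ := by
  have hθ := two_lt_rpow hw
  unfold blockConst invConst
  positivity

/-- Elimination of `q` blocks of rows, each with at most as many rows as there are columns. -/
theorem exists_kernelProjector (hf : FastMul E w A₀) {κ : Type} [Fintype κ] [Nonempty κ]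
    [DecidableEq κ] {ι : Type} [Fintype ι] (hι : Fintype.card ι ≤ Fintype.card κ) (q : ℕ)
    {M : Fin q → Matrix ι κ (∀ ω, E ω)} (hM : ∀ i, entrySet (M i) ⊆ X) :
    ∃ K : Matrix κ κ (∀ ω, E ω), (∀ i, M i * K = 0) ∧ (∀ v, (∀ i, M i *ᵥ v = 0) → K *ᵥ v = v) ∧
      Computes Set.univ X (entrySet K) (2 * (Fintype.card κ : ℝ) ^ 2 +
        q * (blockConst w A₀ * (Fintype.card κ : ℝ) ^ w)) := by
  classical
  set n := Fintype.card κ with hn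
  have hn1 : 1 ≤ n := Fintype.card_pos
  have hn1' : (1 : ℝ) ≤ n := by exact_mod_cast hn1
  have hn0 : (0 : ℝ) < n := by linarith
  have hA := hf.nonneg
  have hw := hf.exponent
  -- the recursion for generalized inverses works with numbers of rows that are powers of two
  obtain ⟨t, ht1, ht2⟩ : ∃ t, n ≤ 2 ^ t ∧ 2 ^ t ≤ 2 * n :=
    ⟨Nat.clog 2 n, Nat.le_pow_clog (by norm_num) n, by
      rcases Nat.eq_or_lt_of_le hn1 with h | h
      · rw [← h]; simp
      · have h1 := Nat.pow_pred_clog_lt_self (b := 2) (by norm_num) h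
        have h2 : 0 < Nat.clog 2 n := Nat.clog_pos (by norm_num) h
        obtain ⟨s, hs⟩ : ∃ s, Nat.clog 2 n = s + 1 := ⟨Nat.clog 2 n - 1, by omega⟩
        rw [hs] at h1 ⊢
        rw [pow_succ]
        simp only [Nat.pred_succ] at h1
        omega⟩
  have key : ∀ s : Finset (Fin q), ∃ K : Matrix κ κ (∀ ω, E ω), (∀ i ∈ s, M i * K = 0) ∧
      (∀ v, (∀ i, M i *ᵥ v = 0) → K *ᵥ v = v) ∧
      Computes Set.univ X (entrySet K) (2 * (n : ℝ) ^ 2 +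
        s.card * (blockConst w A₀ * (n : ℝ) ^ w)) := by
    intro s
    induction s using Finset.induction_on with
    | empty =>
      refine ⟨1, by simp, by simp, ?_⟩
      refine (Computes.mat (c := 2) fun i j => ?_).mono le_rfl le_rfl
        (le_of_eq (by rw [← hn]; simp; ring))
      rcases eq_or_ne i j with rfl | h
      · rw [Matrix.one_apply_eq]; exact (fieldModel_self (E := E)).one (Set.empty_subset _)
      · rw [Matrix.one_apply_ne h]; exact (fieldModel_self (E := E)).zero (Set.empty_subset _)
    | insert b s hb ih =>
      obtain ⟨K, hK, hv, hc⟩ := ih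
      have c1 : Fintype.card ι ≤ 1 * n := by simpa using hι
      have c2 : Fintype.card κ ≤ 1 * n := by simp [hn]
      have c3 : ((1 : ℕ) * (1 : ℕ) * (1 : ℕ) : ℝ) ≤ 1 := by norm_num
      set X1 := X ∪ entrySet K with hX1
      have XX1 : X ⊆ X1 := Set.subset_union_left
      have k1 : Computes Set.univ X1 (entrySet (M b * K)) (1 * ((A₀ + 1) * (n : ℝ) ^ w)) :=
        hf.mul_le n 1 1 1 hn1 c1 c2 c2 ((hM b).trans XX1) Set.subset_union_right c3
      set N := M b * K with hN
      set X2 := X1 ∪ entrySet N with hX2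
      obtain ⟨G, hG, k2⟩ := hf.exists_generalizedInverse t (hn ▸ ht2) (hι.trans ht1)
        (M := N) (Set.subset_union_right : _ ⊆ X2)
      have k3 : Computes Set.univ (X2 ∪ entrySet G) (entrySet (G * N))
          (1 * ((A₀ + 1) * (n : ℝ) ^ w)) :=
        hf.mul_le n 1 1 1 hn1 c2 c1 c2 Set.subset_union_right
          (Set.subset_union_right.trans Set.subset_union_left) c3
      have k4 : Computes Set.univ (X2 ∪ entrySet (G * N)) (entrySet (K * (G * N)))
          (1 * ((A₀ + 1) * (n : ℝ) ^ w)) :=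
        hf.mul_le n 1 1 1 hn1 c2 c2 c2 ((Set.subset_union_right.trans
          Set.subset_union_left).trans Set.subset_union_left) Set.subset_union_right c3
      have k5 : Computes Set.univ (X2 ∪ entrySet (K * (G * N))) (entrySet (K - K * (G * N)))
          (n * n) :=
        Computes.matSub ((Set.subset_union_right.trans
          Set.subset_union_left).trans Set.subset_union_left) Set.subset_union_right
      have hMK : ∀ i, M i * (K - K * (G * N)) = M i * K - M i * K * (G * N) := fun i => by
        rw [Matrix.mul_sub, Matrix.mul_assoc (M i)]
      refine ⟨K - K * (G * N), ?_, ?_, ?_⟩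
      · intro i hi
        rw [hMK]
        rcases Finset.mem_insert.1 hi with rfl | hi
        · rw [← hN, ← Matrix.mul_assoc, hG, sub_self]
        · rw [hK i hi, Matrix.zero_mul, sub_zero]
      · intro v hMv
        have hNv : N *ᵥ v = 0 := by
          rw [hN, ← Matrix.mulVec_mulVec, hv v hMv, hMv b]
        rw [Matrix.sub_mulVec, hv v hMv, ← Matrix.mulVec_mulVec, ← Matrix.mulVec_mulVec, hNv]
        simp
      · refine (hc.andThen (k1.andThen (((k2.andThen k3).andThen k4).andThen k5))).mono
          le_rfl le_rfl ?_
        rw [Finset.card_insert_of_notMem hb, ← hn]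
        have hB : 0 ≤ invConst w A₀ := by
          have hθ := two_lt_rpow hw
          unfold invConst
          positivity
        have h2 : (n : ℝ) * n ≤ (n : ℝ) ^ w := by
          rw [← sq, ← Real.rpow_natCast]
          exact Real.rpow_le_rpow_of_exponent_le hn1' (by exact_mod_cast hw.le)
        have h3 : (n : ℝ) * ((2 : ℝ) ^ t) ^ (w - 1) ≤ (2 : ℝ) ^ (w - 1) * (n : ℝ) ^ w := by
          have h4 : ((2 : ℝ) ^ t) ^ (w - 1) ≤ (2 * (n : ℝ)) ^ (w - 1) :=
            Real.rpow_le_rpow (by positivity) (by exact_mod_cast ht2) (by linarith)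
          rw [Real.mul_rpow (by norm_num) hn0.le] at h4
          calc (n : ℝ) * ((2 : ℝ) ^ t) ^ (w - 1)
              ≤ n * ((2 : ℝ) ^ (w - 1) * (n : ℝ) ^ (w - 1)) := by gcongr
            _ = (2 : ℝ) ^ (w - 1) * (n : ℝ) ^ w := by
              rw [Real.rpow_sub_one hn0.ne']
              field_simp
        have h5 := mul_le_mul_of_nonneg_left h3 hB
        unfold blockConst
        push_cast
        nlinarith
  obtain ⟨K, hK, hv, hc⟩ := key Finset.univ
  exact ⟨K, fun i => hK i (Finset.mem_univ _), hv, by simpa using hc⟩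

/-- The normalized vector in a kernel of dimension one. -/
theorem kernelVector (hf : FastMul E w A₀) {κ : Type} [Fintype κ] {ρ : Type} [Fintype ρ]
    {M : Matrix ρ κ (∀ ω, E ω)} (hM : entrySet M ⊆ X) (q : ℕ) (hq : 1 ≤ q)
    (hρ : Fintype.card ρ ≤ q * Fintype.card κ) {v : κ → ∀ ω, E ω} {i₀ : κ} (hv : M *ᵥ v = 0)
    (hi : v i₀ = 1) (huniq : ∀ u, M *ᵥ u = 0 → ∀ j, u j = v j * u i₀) :
    Computes Set.univ X (Set.range v)
      ((blockConst w A₀ + 18) * (q * (Fintype.card κ : ℝ) ^ w)) := by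
  classical
  have : Nonempty κ := ⟨i₀⟩
  set n := Fintype.card κ with hn
  have hn1' : (1 : ℝ) ≤ n := by exact_mod_cast (Fintype.card_pos : 0 < Fintype.card κ)
  obtain ⟨f⟩ := Function.Embedding.nonempty_of_card_le (α := ρ) (β := Fin q × Fin n)
    (by simpa using hρ)
  -- the rows are distributed over `q` blocks, which are filled up with zero rows
  set M' : Fin q × Fin n → κ → ∀ ω, E ω := Function.extend f (fun i => M i) 0 with hM'
  have hM1 : ∀ i, M' (f i) = M i := fun i => f.injective.extend_apply _ _ i
  have hM2 : ∀ x, (∃ i, f i = x) ∨ M' x = 0 := by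
    intro x
    by_cases hx : ∃ y, f y = x
    · exact Or.inl hx
    · exact Or.inr (by rw [hM', Function.extend_apply' _ _ _ hx]; rfl)
  obtain ⟨K, hK, hKv, hc⟩ := hf.exists_kernelProjector (X := X ∪ {0}) (κ := κ) (ι := Fin n)
    (by simp [hn]) q (M := fun i => Matrix.of fun j => M' (i, j)) (fun i => entrySet_subset (by
      intro j l
      rcases hM2 (i, j) with ⟨y, hy⟩ | hy
      · left
        rw [Matrix.of_apply, ← hy, hM1]
        exact hM (mem_entrySet M y l)
      · right
        rw [Matrix.of_apply, hy]
        rfl))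
  have hMu : ∀ u, M *ᵥ u = 0 ↔ ∀ i : Fin q, (Matrix.of fun j => M' (i, j)) *ᵥ u = 0 := by
    intro u
    constructor
    · intro h i
      funext j
      rcases hM2 (i, j) with ⟨y, hy⟩ | hy
      · have := congrFun h y
        simp only [Matrix.mulVec, Matrix.of_apply, ← hy, hM1]
        exact this
      · simp [Matrix.mulVec, Matrix.of_apply, hy]
    · intro h
      funext y
      have := congrFun (h (f y).1) (f y).2
      simp only [Matrix.mulVec, Matrix.of_apply, Prod.mk.eta, hM1] at this
      exact this
  have hcol : ∀ j l, K j l = v j * K i₀ l := fun j l =>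
    huniq (fun j => K j l) ((hMu _).2 fun i => by
      funext a
      exact congrFun (congrFun (hK i) a) l) j
  have s := (fieldModel_self (E := E)).normalize (X := X ∪ {0} ∪ entrySet K) (Set.empty_subset _)
    (K := K) Set.subset_union_right hcol (hKv v ((hMu v).1 hv)) hi
  refine ((Computes.zero (A := Set.univ) (X := X)).andThen (hc.andThen s)).mono le_rfl ?_ ?_
  · rintro _ ⟨j, rfl⟩
    exact rep_subset_vecReps (L := E) (rep := fun x => {x}) v j rfl
  · rw [← hn]
    have h2 : (n : ℝ) * n ≤ (n : ℝ) ^ w := by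
      rw [← sq, ← Real.rpow_natCast]
      exact Real.rpow_le_rpow_of_exponent_le hn1' (by exact_mod_cast hf.exponent.le)
    have hq' : (1 : ℝ) ≤ q := by exact_mod_cast hq
    have h3 : (n : ℝ) ^ w ≤ q * (n : ℝ) ^ w :=
      le_mul_of_one_le_left (Real.rpow_nonneg (Nat.cast_nonneg _) _) hq'
    nlinarith

end FastMul

end FastElimination

/-! ### Arithmetic in a simple field extension -/

section ExtensionArithmetic

set_option linter.unusedSectionVars false

open Polynomial

section Coordinates

variable {F K : Type*} [Field F] [Field K] [Algebra F K] {s : ℕ}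
  {β : Module.Basis (Fin (s + 1)) F K} {α : K}

/-- Multiplication by the generator shifts the coordinates. -/
theorem repr_generator_mul (hβ : ∀ i, β i = α ^ (i : ℕ)) (y : K) (l : Fin (s + 1)) :
    β.repr (α * y) l = (Fin.cons 0 (fun j : Fin s => β.repr y j.castSucc) : Fin (s + 1) → F) l
      + β.repr y (Fin.last s) * β.repr (α ^ (s + 1)) l := by
  have h : α * y = (∑ i, (Fin.cons 0 (fun j : Fin s => β.repr y j.castSucc) : Fin (s + 1) → F) i
      • β i) + β.repr y (Fin.last s) • α ^ (s + 1) := by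
    conv_lhs => rw [← β.sum_repr y, Fin.sum_univ_castSucc]
    rw [Fin.sum_univ_succ]
    simp only [Fin.cons_zero, zero_smul, zero_add, Fin.cons_succ, mul_add, Finset.mul_sum,
      mul_smul_comm, hβ, Fin.val_castSucc, Fin.val_last, Fin.val_succ, pow_succ']
  rw [h, map_add, map_smul, Finsupp.add_apply, Finsupp.smul_apply, smul_eq_mul,
    Module.Basis.repr_sum_self]

/-- Division by the generator shifts the coordinates in the other direction. -/
theorem repr_mul_generator_inv (hβ : ∀ i, β i = α ^ (i : ℕ)) (hα : α ≠ 0) (y : K)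
    (l : Fin (s + 1)) :
    β.repr (y * α⁻¹) l = (Fin.snoc (fun j : Fin s => β.repr y j.succ) 0 : Fin (s + 1) → F) l
      + β.repr y 0 * β.repr α⁻¹ l := by
  have h : y * α⁻¹ = (∑ i, (Fin.snoc (fun j : Fin s => β.repr y j.succ) 0 : Fin (s + 1) → F) i
      • β i) + β.repr y 0 • α⁻¹ := by
    conv_lhs => rw [← β.sum_repr y, Fin.sum_univ_succ]
    rw [Fin.sum_univ_castSucc]
    simp only [Fin.snoc_last, zero_smul, add_zero, Fin.snoc_castSucc, add_mul, Finset.sum_mul,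
      smul_mul_assoc, hβ, Fin.val_castSucc, Fin.val_zero, pow_zero, one_mul, Fin.val_succ, pow_succ,
      mul_inv_cancel_right₀ hα]
    rw [add_comm]
  rw [h, map_add, map_smul, Finsupp.add_apply, Finsupp.smul_apply, smul_eq_mul,
    Module.Basis.repr_sum_self]

theorem repr_pow_zero_ne_zero (hβ : ∀ i, β i = α ^ (i : ℕ)) (hα : α ≠ 0) :
    β.repr (α ^ (s + 1)) 0 ≠ 0 := by
  intro h0
  have h := repr_mul_generator_inv hβ hα (α ^ (s + 1)) (Fin.last s)
  rw [pow_succ, mul_inv_cancel_right₀ hα, ← pow_succ, h0, zero_mul, Fin.snoc_last, add_zero] at h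
  have h2 : β (Fin.last s) = α ^ s := by rw [hβ, Fin.val_last]
  rw [← h2, Module.Basis.repr_self, Finsupp.single_eq_same] at h
  exact one_ne_zero h

/-- The inverse of the generator, from the last equation that is divided by the generator:
`α ^ (s + 1)` becomes `α ^ s`, the last element of the basis. -/
theorem repr_generator_inv (hβ : ∀ i, β i = α ^ (i : ℕ)) (hα : α ≠ 0) (l : Fin (s + 1)) :
    β.repr α⁻¹ l = ((Fin.snoc (fun _ => 0) 1 : Fin (s + 1) → F) l -
      (Fin.snoc (fun j : Fin s => β.repr (α ^ (s + 1)) j.succ) 0 : Fin (s + 1) → F) l) *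
        (β.repr (α ^ (s + 1)) 0)⁻¹ := by
  have h := repr_mul_generator_inv hβ hα (α ^ (s + 1)) l
  rw [pow_succ, mul_inv_cancel_right₀ hα, ← pow_succ] at h
  have h2 : β (Fin.last s) = α ^ s := by rw [hβ, Fin.val_last]
  rw [← h2, Module.Basis.repr_self] at h
  have h3 : (Finsupp.single (Fin.last s) (1 : F)) l = (Fin.snoc (fun _ => 0) 1 : Fin (s + 1) → F) l := by
    refine Fin.lastCases ?_ (fun j => ?_) l
    · simp
    · simp
  rw [← h3, h, add_sub_cancel_left, mul_comm (β.repr _ 0), mul_assoc,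
    mul_inv_cancel₀ (repr_pow_zero_ne_zero hβ hα), mul_one]

end Coordinates

variable {Ω : Type*} {E : Ω → Type} [∀ ω, Field (E ω)] {K : Ω → Type} [∀ ω, Field (K ω)]
  [∀ ω, Algebra (E ω) (K ω)] {m s : ℕ}

/-- The variable that holds a coordinate of a family of elements of the extensions. -/
noncomputable def coord (β : ∀ ω, Module.Basis (Fin m) (E ω) (K ω)) (x : ∀ ω, K ω) (i : Fin m) :
    ∀ ω, E ω := fun ω => (β ω).repr (x ω) i

/-- The variables that hold the coordinates of a family of elements of the extensions. -/
def coords (β : ∀ ω, Module.Basis (Fin m) (E ω) (K ω)) (x : ∀ ω, K ω) : Set (∀ ω, E ω) :=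
  Set.range (coord β x)

theorem coord_mem (β : ∀ ω, Module.Basis (Fin m) (E ω) (K ω)) (x : ∀ ω, K ω) (i : Fin m) :
    coord β x i ∈ coords β x := ⟨i, rfl⟩

variable {X : Set (∀ ω, E ω)} {A : Set Ω}

theorem Computes.coords {β : ∀ ω, Module.Basis (Fin m) (E ω) (K ω)} {x : ∀ ω, K ω} {c : ℝ}
    (h : ∀ i, Computes A X {coord β x i} c) : Computes A X (coords β x) (m * c) := by
  have := Computes.iUnion h
  rw [Fintype.card_fin] at this
  exact this.mono le_rfl (by rintro _ ⟨i, rfl⟩; exact Set.mem_iUnion.2 ⟨i, rfl⟩) le_rfl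

theorem Computes.mulAdd {x y z : ∀ ω, E ω} (hx : x ∈ X) (hy : y ∈ X) (hz : z ∈ X) :
    Computes A X {z + x * y} 2 :=
  ((Computes.mul hx hy).andThen (Computes.add (Or.inl hz) (Or.inr rfl))).mono le_rfl le_rfl
    (by norm_num)

theorem Computes.mulAdd' {x y z : ∀ ω, E ω} (hx : x ∈ X) (hy : y ∈ X) (hz : z ∈ insert 0 X) :
    Computes A X {z + x * y} 2 := by
  have h : Computes A (X ∪ {0}) {z + x * y} 2 :=
    Computes.mulAdd (Or.inl hx) (Or.inl hy) (by
      rcases hz with rfl | hz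
      · exact Or.inr rfl
      · exact Or.inl hz)
  exact (Computes.zero.andThen h).mono le_rfl le_rfl (by norm_num)

theorem Computes.mulSubMul {x y z w : ∀ ω, E ω} (hx : x ∈ X) (hy : y ∈ X) (hz : z ∈ X)
    (hw : w ∈ X) : Computes A X {x * y - z * w} 3 :=
  ((Computes.mul hx hy).andThen ((Computes.mul (Or.inl hz) (Or.inl hw)).andThen
    (Computes.sub (Or.inl (Or.inr rfl)) (Or.inr rfl)))).mono le_rfl le_rfl (by norm_num)

/-- Two variables which agree on the instances in `A` are equally expensive. -/
theorem Computes.singleton_congr {x y : ∀ ω, E ω} {c : ℝ} (h : Computes A X {x} c)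
    (hxy : ∀ ω ∈ A, x ω = y ω) : Computes A X {y} c :=
  h.congr fun y' hy' => ⟨x, by simp, by rw [Set.mem_singleton_iff.1 hy']; exact hxy⟩

variable (α : ∀ ω, K ω) (β : ∀ ω, Module.Basis (Fin (s + 1)) (E ω) (K ω))
  (hβ : ∀ ω i, β ω i = α ω ^ (i : ℕ))

section

include hβ

theorem computes_generator_mul (hX : coords β (α ^ (s + 1)) ⊆ X) {y : ∀ ω, K ω}
    (hy : coords β y ⊆ X) : Computes A X (coords β (α * y)) ((s + 1 : ℕ) * 2) := by
  refine Computes.coords fun l => ?_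
  have hmem : ∀ l : Fin (s + 1), (Fin.cons 0 (fun j : Fin s => coord β y j.castSucc) :
      Fin (s + 1) → ∀ ω, E ω) l ∈ insert 0 X := by
    refine Fin.cases (by simp) (fun j => Or.inr ?_)
    rw [Fin.cons_succ]
    exact hy (coord_mem β y _)
  refine (Computes.mulAdd' (hy (coord_mem β y (Fin.last s))) (hX (coord_mem β _ l))
    (hmem l)).singleton_congr fun ω _ => ?_
  refine Eq.trans ?_ (repr_generator_mul (hβ ω) (y ω) l).symm
  refine congrArg₂ (fun a b : E ω => a + b) ?_ rfl
  refine Fin.cases ?_ (fun j => ?_) l <;> rfl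

theorem computes_mul_generator_inv (hα : ∀ ω, α ω ≠ 0) (hX : coords β α⁻¹ ⊆ X) {y : ∀ ω, K ω}
    (hy : coords β y ⊆ X) : Computes A X (coords β (y * α⁻¹)) ((s + 1 : ℕ) * 2) := by
  refine Computes.coords fun l => ?_
  have hmem : ∀ l : Fin (s + 1), (Fin.snoc (fun j : Fin s => coord β y j.succ) 0 :
      Fin (s + 1) → ∀ ω, E ω) l ∈ insert 0 X := by
    refine Fin.lastCases (by simp) (fun j => Or.inr ?_)
    rw [Fin.snoc_castSucc]
    exact hy (coord_mem β y _)
  refine (Computes.mulAdd' (hy (coord_mem β y 0)) (hX (coord_mem β _ l))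
    (hmem l)).singleton_congr fun ω _ => ?_
  refine Eq.trans ?_ (repr_mul_generator_inv (hβ ω) (hα ω) (y ω) l).symm
  refine congrArg₂ (fun a b : E ω => a + b) ?_ rfl
  refine Fin.lastCases ?_ (fun j => ?_) l
  · simp only [Fin.snoc_last, Pi.zero_apply]
  · simp only [Fin.snoc_castSucc]
    rfl

theorem computes_generator_inv (hα : ∀ ω, α ω ≠ 0) (hX : coords β (α ^ (s + 1)) ⊆ X) :
    Computes A X (coords β α⁻¹) (3 + (s + 1 : ℕ) * 2) := by
  set a := coord β (α ^ (s + 1)) with ha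
  have h1 : Computes A X ({0} ∪ ({1} ∪ {(a 0)⁻¹})) (0 + (1 + 2)) :=
    Computes.zero.union (Computes.one.union (Computes.inv (hX (coord_mem β _ 0))))
  set Y := X ∪ ({0} ∪ ({1} ∪ {(a 0)⁻¹})) with hY
  have h0Y : (0 : ∀ ω, E ω) ∈ Y := Or.inr (Or.inl rfl)
  have h1Y : (1 : ∀ ω, E ω) ∈ Y := Or.inr (Or.inr (Or.inl rfl))
  have hXY : X ⊆ Y := Set.subset_union_left
  refine (h1.andThen (Computes.coords fun l => ?_)).mono le_rfl le_rfl
    (le_of_eq (by ring) : 0 + (1 + 2) + ((s + 1 : ℕ) : ℝ) * 2 ≤ _)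
  have hmem : ∀ l : Fin (s + 1), (Fin.snoc (fun j : Fin s => a j.succ) 0 :
      Fin (s + 1) → ∀ ω, E ω) l ∈ Y := by
    refine Fin.lastCases (by simpa using h0Y) (fun j => ?_)
    rw [Fin.snoc_castSucc]
    exact hXY (hX (coord_mem β _ _))
  have hmem' : ∀ l : Fin (s + 1), (Fin.snoc (fun _ => 0) 1 :
      Fin (s + 1) → ∀ ω, E ω) l ∈ Y := by
    refine Fin.lastCases (by simpa using h1Y) (fun j => ?_)
    rw [Fin.snoc_castSucc]
    exact h0Y
  have h2 := (Computes.sub (A := A) (hmem' l) (hmem l)).andThen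
    (Computes.mul (A := A) (x := _) (y := (a 0)⁻¹) (Or.inr rfl)
      (Or.inl (Or.inr (Or.inr (Or.inr rfl)))))
  refine (h2.mono le_rfl le_rfl (by norm_num)).singleton_congr fun ω _ => ?_
  refine Eq.trans ?_ (repr_generator_inv (hβ ω) (hα ω) l).symm
  refine congrArg₂ (fun a b : E ω => a * b) (congrArg₂ (fun a b : E ω => a - b) ?_ ?_) rfl
  · refine Fin.lastCases ?_ (fun j => ?_) l
    · simp only [Fin.snoc_last, Pi.one_apply]
    · simp only [Fin.snoc_castSucc, Pi.zero_apply]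
  · refine Fin.lastCases ?_ (fun j => ?_) l
    · simp only [Fin.snoc_last, Pi.zero_apply]
    · simp only [Fin.snoc_castSucc]
      rfl

/-- The multiples of `y` by the elements of the basis. -/
theorem computes_generator_pow_mul (hX : coords β (α ^ (s + 1)) ⊆ X) {y : ∀ ω, K ω}
    (hy : coords β y ⊆ X) (N : ℕ) :
    Computes A X (⋃ i ∈ Finset.range (N + 1), coords β (α ^ i * y)) (N * ((s + 1 : ℕ) * 2)) := by
  induction N with
  | zero =>
    refine Computes.of_subset ?_ (by simp)
    simpa using hy
  | succ N ih =>
    have h : Computes A (X ∪ ⋃ i ∈ Finset.range (N + 1), coords β (α ^ i * y))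
        (coords β (α * (α ^ N * y))) ((s + 1 : ℕ) * 2) :=
      computes_generator_mul α β hβ (hX.trans Set.subset_union_left)
        ((Set.subset_biUnion_of_mem (u := fun i => coords β (α ^ i * y))
          (by simp : N ∈ (Finset.range (N + 1) : Set ℕ))).trans Set.subset_union_right)
    refine (ih.trans h).mono le_rfl ?_ (by push_cast; linarith)
    refine Set.iUnion₂_subset fun i hi => ?_
    rcases Finset.mem_range_succ_iff.1 hi |>.lt_or_eq with hi | rfl
    · exact (Set.subset_biUnion_of_mem (u := fun i => coords β (α ^ i * y))
          (by simpa using hi : i ∈ (Finset.range (N + 1) : Set ℕ))).trans Set.subset_union_left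
    · rw [pow_succ', mul_assoc]
      exact Set.subset_union_right

theorem coord_mul (x y : ∀ ω, K ω) (l : Fin (s + 1)) :
    coord β (x * y) l = ∑ i : Fin (s + 1), coord β x i * coord β (α ^ (i : ℕ) * y) l := by
  funext ω
  simp only [coord, Pi.mul_apply, Finset.sum_apply, Pi.pow_apply]
  conv_lhs => rw [← (β ω).sum_repr (x ω), Finset.sum_mul]
  simp only [map_sum, Finsupp.finsetSum_apply, smul_mul_assoc, map_smul, Finsupp.smul_apply,
    smul_eq_mul, hβ ω]

theorem computes_ext_mul (hX : coords β (α ^ (s + 1)) ⊆ X) {x y : ∀ ω, K ω}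
    (hx : coords β x ⊆ X) (hy : coords β y ⊆ X) :
    Computes Set.univ X (coords β (x * y)) (8 * ((s + 1 : ℕ) : ℝ) ^ 2) := by
  have h1 := computes_generator_pow_mul (A := Set.univ) α β hβ hX hy s
  set Y := ⋃ i ∈ Finset.range (s + 1), coords β (α ^ i * y) with hY
  have h2 : Computes Set.univ (X ∪ Y) (coords β (x * y))
      ((s + 1 : ℕ) * ((2 * (s + 1 : ℕ) + 1) * 2)) := by
    refine Computes.coords fun l => ?_
    rw [coord_mul α β hβ]
    have := (fieldModel_self (E := E)).sum_mul (X := X ∪ Y) (Set.empty_subset _)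
      (x := fun i => coord β x i) (y := fun i : Fin (s + 1) => coord β (α ^ (i : ℕ) * y) l)
      Finset.univ (fun i _ => Set.singleton_subset_iff.2 (Or.inl (hx (coord_mem β x i))))
      (fun i _ => Set.singleton_subset_iff.2 (Or.inr (by
        exact Set.mem_iUnion₂.2 ⟨i, Finset.mem_range.2 i.isLt, coord_mem β _ l⟩)))
    simpa using this
  refine (h1.andThen h2).mono le_rfl le_rfl ?_
  push_cast
  have : (0 : ℝ) ≤ s := Nat.cast_nonneg _
  nlinarith

end

/-- The variables that hold the coefficients of a family of polynomials of degree at most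
`s + 1`. -/
def coeffSet (s : ℕ) (f : ∀ ω, (E ω)[X]) : Set (∀ ω, E ω) :=
  Set.range fun i : Fin (s + 2) => fun ω => (f ω).coeff i

/-- The state of the division-free Euclidean algorithm for inverting `x`: the polynomials `f`
and `g` are coprime, if `x ≠ 0`, and their values at the generator are `u * x` and `v * x`.
The degree of `f` is at most `a`, that of `g` is less than `b`. -/
structure EuclidState (A : Set Ω) (α x : ∀ ω, K ω) (f g : ∀ ω, (E ω)[X]) (u v : ∀ ω, K ω)
    (a b : ℕ) : Prop where
  degree_f : ∀ ω ∈ A, ∀ i, a < i → (f ω).coeff i = 0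
  degree_g : ∀ ω ∈ A, ∀ i, b ≤ i → (g ω).coeff i = 0
  coeff_zero : ∀ ω ∈ A, (f ω).coeff 0 ≠ 0
  aeval_f : ∀ ω ∈ A, aeval (α ω) (f ω) = u ω * x ω
  aeval_g : ∀ ω ∈ A, aeval (α ω) (g ω) = v ω * x ω
  coprime : ∀ ω ∈ A, x ω ≠ 0 → IsCoprime (f ω) (g ω)
  zero : ∀ ω ∈ A, x ω = 0 → g ω = 0 ∧ u ω = 0

theorem aeval_divX {F L : Type*} [Field F] [Field L] [Algebra F L] {a : L} (ha : a ≠ 0) {f : F[X]}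
    (hf : f.coeff 0 = 0) : aeval a f.divX = aeval a f * a⁻¹ := by
  conv_rhs => rw [← divX_mul_X_add f]
  simp [hf, ha]

theorem isCoprime_divX {F : Type*} [Field F] {f g : F[X]} (h : IsCoprime f g)
    (hg : g.coeff 0 = 0) : IsCoprime f g.divX := by
  rw [← divX_mul_X_add g, hg, map_zero, add_zero] at h
  exact h.of_mul_right_left

section

include hβ

/-- The recursion of the Euclidean algorithm. Each step cancels one constant coefficient and
divides by the indeterminate, so that it lowers `a + b` by one and costs a number of operations
that is linear in the degree of the extension. -/
theorem computes_inv_of_euclidState (hα : ∀ ω, α ω ≠ 0) (x : ∀ ω, K ω) (t : ℕ) :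
    ∀ (A : Set Ω) (X : Set (∀ ω, E ω)) (f g : ∀ ω, (E ω)[X]) (u v : ∀ ω, K ω) (a b : ℕ),
    EuclidState A α x f g u v a b → a + b ≤ t → a ≤ s + 1 → b ≤ s + 1 → coords β α⁻¹ ⊆ X →
    coeffSet s f ⊆ X → coeffSet s g ⊆ X → coords β u ⊆ X → coords β v ⊆ X →
    Computes A X (coords β x⁻¹) (3 * (s + 1 : ℕ) + t * (12 * (s + 1 : ℕ))) := by
  -- if `g = 0`, then `f` is a nonzero constant by coprimality, and `u` is this constant over `x`
  have base : ∀ (t : ℕ) (A : Set Ω) (X : Set (∀ ω, E ω)) (f g : ∀ ω, (E ω)[X]) (u v : ∀ ω, K ω)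
      (a : ℕ), EuclidState A α x f g u v a 0 → coeffSet s f ⊆ X → coords β u ⊆ X →
      Computes A X (coords β x⁻¹) (3 * (s + 1 : ℕ) + t * (12 * (s + 1 : ℕ))) := by
    intro t A X f g u v a h hf hu
    have hf0 : (fun ω => (f ω).coeff 0) ∈ X := hf ⟨0, rfl⟩
    refine ((Computes.inv hf0).andThen (Computes.coords (c := 1) fun l => ?_)).mono le_rfl
      le_rfl (?_ : 2 + ((s + 1 : ℕ) : ℝ) * 1 ≤ _)
    · refine (Computes.mul (x := coord β u l) (Or.inl (hu (coord_mem β u l)))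
        (Or.inr rfl)).singleton_congr fun ω hω => ?_
      simp only [coord, Pi.mul_apply, Pi.inv_apply]
      have hg0 : g ω = 0 := Polynomial.ext fun i => h.degree_g ω hω i (Nat.zero_le _)
      have key : (x ω)⁻¹ = ((f ω).coeff 0)⁻¹ • u ω := by
        by_cases hx : x ω = 0
        · rw [hx, inv_zero, (h.zero ω hω hx).2, smul_zero]
        · have hco := h.coprime ω hω hx
          rw [hg0, isCoprime_zero_right] at hco
          have hc : f ω = C ((f ω).coeff 0) := eq_C_of_natDegree_eq_zero
            (natDegree_eq_zero_of_isUnit hco)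
          have h1 := h.aeval_f ω hω
          rw [hc, aeval_C] at h1
          have h2 : algebraMap (E ω) (K ω) ((f ω).coeff 0) ≠ 0 := by
            rw [Ne, map_eq_zero]
            exact h.coeff_zero ω hω
          rw [Algebra.smul_def, map_inv₀, h1]
          have h3 : u ω ≠ 0 := fun h0 => h2 (by rw [h1, h0, zero_mul])
          field_simp
      rw [key, map_smul, Finsupp.smul_apply, smul_eq_mul, mul_comm]
    · push_cast
      have : (0 : ℝ) ≤ s := Nat.cast_nonneg _
      have : (0 : ℝ) ≤ t * (12 * (s + 1)) := by positivity
      linarith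
  induction t with
  | zero =>
    intro A X f g u v a b h hab _ _ _ hf _ hu _
    obtain rfl : b = 0 := by omega
    exact base 0 A X f g u v a h hf hu
  | succ t ih =>
    intro A X f g u v a b h hab ha hb hαX hf hg hu hv
    rcases b with _ | b
    · exact base (t + 1) A X f g u v a h hf hu
    have hg0 : (fun ω => (g ω).coeff 0) ∈ X := hg ⟨0, rfl⟩
    have hf0 : (fun ω => (f ω).coeff 0) ∈ X := hf ⟨0, rfl⟩
    have hs1 : (1 : ℝ) ≤ ((s + 1 : ℕ) : ℝ) := by push_cast; linarith [(Nat.cast_nonneg s : (0:ℝ) ≤ s)]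
    -- cancellation of the constant coefficient of `q` by means of `p`, and division by the
    -- indeterminate, on the side of the values a division by the generator
    have elim : ∀ (B : Set Ω) (p q : ∀ ω, (E ω)[X]) (y z : ∀ ω, K ω),
        (∀ ω ∈ B, ∀ i, s + 1 < i → (p ω).coeff i = 0) →
        (∀ ω ∈ B, ∀ i, s + 1 < i → (q ω).coeff i = 0) →
        coeffSet s p ⊆ X → coeffSet s q ⊆ X → coords β y ⊆ X → coords β z ⊆ X →
        Computes B X (coeffSet s (fun ω => (C ((p ω).coeff 0) * q ω
            - C ((q ω).coeff 0) * p ω).divX) ∪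
          coords β ((fun ω => (p ω).coeff 0 • z ω - (q ω).coeff 0 • y ω) * α⁻¹))
          (11 * (s + 1 : ℕ)) := by
      intro B p q y z hpd hqd hp hq hy hz
      have hp0 : (fun ω => (p ω).coeff 0) ∈ X := hp ⟨0, rfl⟩
      have hq0 : (fun ω => (q ω).coeff 0) ∈ X := hq ⟨0, rfl⟩
      have e1 : Computes B X (coeffSet s (fun ω => (C ((p ω).coeff 0) * q ω
            - C ((q ω).coeff 0) * p ω).divX)) ((s + 2 : ℕ) * 3) := by
        have : ∀ i : Fin (s + 2), Computes B X {fun ω => ((C ((p ω).coeff 0) * q ω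
            - C ((q ω).coeff 0) * p ω).divX).coeff i} 3 := by
          intro i
          rcases Nat.lt_or_ge (i + 1 : ℕ) (s + 2) with hi | hi
          · refine (Computes.mulSubMul hp0 (hq ⟨⟨i + 1, hi⟩, rfl⟩) hq0
              (hp ⟨⟨i + 1, hi⟩, rfl⟩)).singleton_congr fun ω _ => ?_
            simp [coeff_divX]
          · refine (Computes.zero.mono le_rfl le_rfl (by norm_num)).singleton_congr
              fun ω hω => ?_
            simp [coeff_divX, hpd ω hω _ hi, hqd ω hω _ hi]
        have := Computes.iUnion this
        rw [Fintype.card_fin] at this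
        exact this.mono le_rfl (by rintro _ ⟨i, rfl⟩; exact Set.mem_iUnion.2 ⟨i, rfl⟩) le_rfl
      have e2 : Computes B X (coords β (fun ω => (p ω).coeff 0 • z ω - (q ω).coeff 0 • y ω))
          ((s + 1 : ℕ) * 3) := by
        refine Computes.coords fun l => ?_
        refine (Computes.mulSubMul hp0 (hz (coord_mem β z l)) hq0
          (hy (coord_mem β y l))).singleton_congr fun ω _ => ?_
        simp [coord]
      have e3 := e2.andThen (computes_mul_generator_inv (A := B) α β hβ hα
        (hαX.trans Set.subset_union_left) Set.subset_union_right)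
      refine (e1.union e3).mono le_rfl le_rfl ?_
      push_cast at hs1 ⊢
      linarith
    have hfd : ∀ ω ∈ A, ∀ i, s + 1 < i → (f ω).coeff i = 0 := fun ω hω i hi =>
      h.degree_f ω hω i (by omega)
    have hgd : ∀ ω ∈ A, ∀ i, s + 1 < i → (g ω).coeff i = 0 := fun ω hω i hi =>
      h.degree_g ω hω i (by omega)
    have hx0 : ∀ ω ∈ A, (g ω).coeff 0 ≠ 0 → x ω ≠ 0 := fun ω hω hg1 hx1 =>
      hg1 (by rw [(h.zero ω hω hx1).1, coeff_zero])
    have hinner : ∀ p q : ∀ ω, (E ω)[X], ∀ ω,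
        (C ((p ω).coeff 0) * q ω - C ((q ω).coeff 0) * p ω).coeff 0 = 0 := fun p q ω => by
      simp [mul_comm]
    have hcop : ∀ ω, ∀ p q : (E ω)[X], p.coeff 0 ≠ 0 → IsCoprime p q →
        IsCoprime p (C (p.coeff 0) * q - C (q.coeff 0) * p) := by
      intro ω p q hp hpq
      have h1 : IsUnit (C (p.coeff 0)) := isUnit_C.2 (isUnit_iff_ne_zero.2 hp)
      have h2 : IsCoprime p (C (p.coeff 0) * q) := (isCoprime_mul_unit_left_right h1 p q).2 hpq
      have h3 := h2.add_mul_left_right (-C (q.coeff 0))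
      rwa [mul_neg, ← sub_eq_add_neg, mul_comm p] at h3
    have step : Computes A X (coords β x⁻¹)
        (11 * (s + 1 : ℕ) + (3 * (s + 1 : ℕ) + t * (12 * (s + 1 : ℕ))) + 1) := by
      refine Computes.branch (Or.inr hg0) ?_ ?_
      -- the constant coefficient is zero already
      · have e1 : Computes {ω ∈ A | (g ω).coeff 0 = 0} X (coeffSet s (fun ω => (g ω).divX)) 0 := by
          refine (Computes.of_subset (Set.empty_subset X) le_rfl).congr ?_
          rintro _ ⟨i, rfl⟩
          rcases Nat.lt_or_ge (i + 1 : ℕ) (s + 2) with hi | hi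
          · exact ⟨_, Or.inr (Or.inl (hg ⟨⟨i + 1, hi⟩, rfl⟩)), fun ω _ => by simp [coeff_divX]⟩
          · exact ⟨0, Or.inl rfl, fun ω hω => by simp [coeff_divX, hgd ω hω.1 _ hi]⟩
        have e2 := e1.union (computes_mul_generator_inv (A := {ω ∈ A | (g ω).coeff 0 = 0})
          α β hβ hα hαX hv)
        refine (e2.andThen (ih _ _ f (fun ω => (g ω).divX) u (v * α⁻¹) a b ?_ (by omega) ha
          (by omega) (hαX.trans Set.subset_union_left) (hf.trans Set.subset_union_left)
          (Set.subset_union_left.trans Set.subset_union_right) (hu.trans Set.subset_union_left)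
          (Set.subset_union_right.trans Set.subset_union_right))).mono le_rfl le_rfl
          (by linarith)
        exact
          { degree_f := fun ω hω => h.degree_f ω hω.1
            degree_g := fun ω hω i hi => by
              rw [coeff_divX]
              exact h.degree_g ω hω.1 _ (by omega)
            coeff_zero := fun ω hω => h.coeff_zero ω hω.1
            aeval_f := fun ω hω => h.aeval_f ω hω.1
            aeval_g := fun ω hω => by
              rw [aeval_divX (hα ω) hω.2, h.aeval_g ω hω.1, Pi.mul_apply, Pi.inv_apply]
              ring
            coprime := fun ω hω hx => isCoprime_divX (h.coprime ω hω.1 hx) hω.2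
            zero := fun ω hω hx => by
              obtain ⟨h1, h2⟩ := h.zero ω hω.1 hx
              exact ⟨by rw [h1, divX_zero], h2⟩ }
      · rcases Nat.lt_or_ge b a with hba | hab'
        -- `g` has the smaller degree bound: the polynomials change their roles
        · have e := elim {ω ∈ A | (g ω).coeff 0 ≠ 0} g f v u (fun ω hω => hgd ω hω.1)
            (fun ω hω => hfd ω hω.1) hg hf hv hu
          refine e.andThen (ih _ _ g _ v _ b a ?_ (by omega) (by omega) ha
            (hαX.trans Set.subset_union_left) (hg.trans Set.subset_union_left)
            (Set.subset_union_left.trans Set.subset_union_right) (hv.trans Set.subset_union_left)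
            (Set.subset_union_right.trans Set.subset_union_right))
          exact
            { degree_f := fun ω hω i hi => h.degree_g ω hω.1 i hi
              degree_g := fun ω hω i hi => by
                simp [coeff_divX, h.degree_f ω hω.1 (i + 1) (by omega),
                  h.degree_g ω hω.1 (i + 1) (by omega)]
              coeff_zero := fun ω hω => hω.2
              aeval_f := fun ω hω => h.aeval_g ω hω.1
              aeval_g := fun ω hω => by
                rw [aeval_divX (hα ω) (hinner g f ω)]
                simp only [map_sub, map_mul, aeval_C, h.aeval_g ω hω.1, h.aeval_f ω hω.1,
                  Algebra.smul_def, Pi.mul_apply, Pi.inv_apply]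
                ring
              coprime := fun ω hω hx => isCoprime_divX (hcop ω _ _ hω.2
                (h.coprime ω hω.1 hx).symm) (hinner g f ω)
              zero := fun ω hω hx => (hx0 ω hω.1 hω.2 hx).elim }
        · have e := elim {ω ∈ A | (g ω).coeff 0 ≠ 0} f g u v (fun ω hω => hfd ω hω.1)
            (fun ω hω => hgd ω hω.1) hf hg hu hv
          refine e.andThen (ih _ _ f _ u _ a b ?_ (by omega) ha (by omega)
            (hαX.trans Set.subset_union_left) (hf.trans Set.subset_union_left)
            (Set.subset_union_left.trans Set.subset_union_right) (hu.trans Set.subset_union_left)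
            (Set.subset_union_right.trans Set.subset_union_right))
          exact
            { degree_f := fun ω hω => h.degree_f ω hω.1
              degree_g := fun ω hω i hi => by
                simp [coeff_divX, h.degree_f ω hω.1 (i + 1) (by omega),
                  h.degree_g ω hω.1 (i + 1) (by omega)]
              coeff_zero := fun ω hω => h.coeff_zero ω hω.1
              aeval_f := fun ω hω => h.aeval_f ω hω.1
              aeval_g := fun ω hω => by
                rw [aeval_divX (hα ω) (hinner f g ω)]
                simp only [map_sub, map_mul, aeval_C, h.aeval_g ω hω.1, h.aeval_f ω hω.1,
                  Algebra.smul_def, Pi.mul_apply, Pi.inv_apply]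
                ring
              coprime := fun ω hω hx => isCoprime_divX (hcop ω _ _ (h.coeff_zero ω hω.1)
                (h.coprime ω hω.1 hx)) (hinner f g ω)
              zero := fun ω hω hx => (hx0 ω hω.1 hω.2 hx).elim }
    refine step.mono le_rfl le_rfl ?_
    push_cast at hs1 ⊢
    nlinarith

/-- Inversion in an extension of degree at least two. -/
theorem computes_ext_inv_of_ne_zero (hα : ∀ ω, α ω ≠ 0) (hX : coords β (α ^ (s + 1)) ⊆ X)
    {x : ∀ ω, K ω} (hx : coords β x ⊆ X) :
    Computes Set.univ X (coords β x⁻¹) (40 * ((s + 1 : ℕ) : ℝ) ^ 2) := by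
  classical
  let pb : ∀ ω, PowerBasis (E ω) (K ω) := fun ω => ⟨α ω, s + 1, β ω, hβ ω⟩
  have hfg : ∀ ω, minpoly (E ω) (α ω) = (pb ω).minpolyGen := fun ω => ((pb ω).minpolyGen_eq).symm
  have hint : ∀ ω, IsIntegral (E ω) (α ω) := fun ω => (pb ω).isIntegral_gen
  -- the algorithm starts with the minimal polynomial of `α`, whose value is `0 * x`, and with the
  -- polynomial of `x`, whose value is `1 * x`
  let f : ∀ ω, (E ω)[X] := fun ω => minpoly (E ω) (α ω)
  let g : ∀ ω, (E ω)[X] := fun ω => ∑ i : Fin (s + 1),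
    C ((β ω).repr (x ω) i) * Polynomial.X ^ (i : ℕ)
  have hfdeg : ∀ ω, (f ω).natDegree = s + 1 := fun ω => (pb ω).natDegree_minpoly
  have hfc : ∀ ω, ∀ i : Fin (s + 1), (f ω).coeff i = -coord β (α ^ (s + 1)) i ω := by
    intro ω i
    simp only [f, hfg, PowerBasis.minpolyGen, pb]
    have h1 : ((Polynomial.X : (E ω)[X]) ^ (s + 1)).coeff (i : ℕ) = 0 := by
      rw [coeff_X_pow, if_neg (by omega)]
    rw [coeff_sub, h1, zero_sub, finsetSum_coeff]
    simp only [coeff_C_mul, coeff_X_pow, coord, Pi.pow_apply, neg_inj]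
    rw [Finset.sum_eq_single i]
    · simp
    · intro j _ hj
      rw [if_neg (fun h => hj (Fin.ext h.symm)), mul_zero]
    · simp
  have hgc : ∀ ω, ∀ i : Fin (s + 1), (g ω).coeff i = coord β x i ω := by
    intro ω i
    simp only [g, finsetSum_coeff, coeff_C_mul, coeff_X_pow, coord]
    rw [Finset.sum_eq_single i]
    · simp
    · intro j _ hj
      rw [if_neg (fun h => hj (Fin.ext h.symm)), mul_zero]
    · simp
  have hgd : ∀ ω, ∀ i, s + 1 ≤ i → (g ω).coeff i = 0 := by
    intro ω i hi
    simp only [g, finsetSum_coeff, coeff_C_mul, coeff_X_pow]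
    refine Finset.sum_eq_zero fun j _ => ?_
    rw [if_neg (by omega), mul_zero]
  have hga : ∀ ω, aeval (α ω) (g ω) = x ω := by
    intro ω
    conv_rhs => rw [← (β ω).sum_repr (x ω)]
    simp [g, hβ ω, Algebra.smul_def]
  set a := coord β (α ^ (s + 1)) with ha
  have hneg : ∀ i : Fin (s + 1), Computes Set.univ X {-a i} 1 := fun i =>
    Computes.neg (hX (coord_mem β _ i))
  have e1 := (Computes.iUnion hneg).union (Computes.zero.union (Computes.one (X := X)))
  set Y := X ∪ ((⋃ i, {-a i}) ∪ ({0} ∪ {1})) with hY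
  have hXY : X ⊆ Y := Set.subset_union_left
  have h0Y : (0 : ∀ ω, E ω) ∈ Y := Or.inr (Or.inr (Or.inl rfl))
  have h1Y : (1 : ∀ ω, E ω) ∈ Y := Or.inr (Or.inr (Or.inr rfl))
  have haY : ∀ i, -a i ∈ Y := fun i => Or.inr (Or.inl (Set.mem_iUnion.2 ⟨i, rfl⟩))
  have e2 := computes_generator_inv (A := Set.univ) (X := Y) α β hβ hα (hX.trans hXY)
  have hone : ∀ ω, (1 : K ω) = β ω 0 := fun ω => by rw [hβ]; simp
  have e3 := computes_inv_of_euclidState α β hβ hα x (2 * (s + 1)) Set.univ (Y ∪ coords β α⁻¹)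
    f g 0 1 (s + 1) (s + 1)
    { degree_f := fun ω _ i hi => coeff_eq_zero_of_natDegree_lt (by rw [hfdeg]; exact hi)
      degree_g := fun ω _ => hgd ω
      coeff_zero := fun ω _ => by
        have := hfc ω 0
        rw [Fin.val_zero] at this
        rw [this]
        exact neg_ne_zero.2 (repr_pow_zero_ne_zero (hβ ω) (hα ω))
      aeval_f := fun ω _ => by simp [f]
      aeval_g := fun ω _ => by simp [hga]
      coprime := fun ω _ hx => by
        refine ((minpoly.irreducible (hint ω)).coprime_iff_not_dvd).2 fun hdvd => hx ?_
        have hg0 : g ω = 0 := by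
          refine eq_zero_of_dvd_of_natDegree_lt hdvd ?_
          have h2 : (g ω).natDegree ≤ s := natDegree_le_iff_coeff_eq_zero.2 fun i hi => hgd ω i hi
          have h3 := hfdeg ω
          simp only [f] at h3
          omega
        rw [← hga ω, hg0, map_zero]
      zero := fun ω _ hx => by simp [g, hx] }
    (by omega) le_rfl le_rfl Set.subset_union_right
    (by
      rintro _ ⟨i, rfl⟩
      left
      rcases Nat.lt_or_ge (i : ℕ) (s + 1) with hi | hi
      · have : (fun ω => (f ω).coeff (i : ℕ)) = -a ⟨i, hi⟩ := funext fun ω => hfc ω ⟨i, hi⟩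
        exact (this ▸ haY _ : (fun ω => (f ω).coeff (i : ℕ)) ∈ Y)
      · have hi' : (i : ℕ) = s + 1 := by omega
        have : (fun ω => (f ω).coeff (i : ℕ)) = 1 := funext fun ω => by
          rw [hi', ← hfdeg ω]
          exact minpoly.monic (hint ω)
        exact (this ▸ h1Y : (fun ω => (f ω).coeff (i : ℕ)) ∈ Y))
    (by
      rintro _ ⟨i, rfl⟩
      left
      rcases Nat.lt_or_ge (i : ℕ) (s + 1) with hi | hi
      · have : (fun ω => (g ω).coeff (i : ℕ)) = coord β x ⟨i, hi⟩ := funext fun ω => hgc ω ⟨i, hi⟩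
        exact (this ▸ hXY (hx (coord_mem β x _)) : (fun ω => (g ω).coeff (i : ℕ)) ∈ Y)
      · have : (fun ω => (g ω).coeff (i : ℕ)) = 0 := funext fun ω => hgd ω i hi
        exact (this ▸ h0Y : (fun ω => (g ω).coeff (i : ℕ)) ∈ Y))
    (by
      rintro _ ⟨i, rfl⟩
      left
      have : coord β 0 i = 0 := by funext ω; simp [coord]
      rw [this]
      exact h0Y)
    (by
      rintro _ ⟨i, rfl⟩
      left
      refine Fin.cases ?_ (fun j => ?_) i
      · have : coord β 1 0 = 1 := by funext ω; simp [coord, hone]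
        rw [this]
        exact h1Y
      · have : coord β 1 j.succ = 0 := by
          funext ω
          simp [coord, hone]
        rw [this]
        exact h0Y)
  refine (e1.andThen (e2.andThen e3)).mono le_rfl le_rfl ?_
  rw [Fintype.card_fin]
  push_cast
  have : (0 : ℝ) ≤ s := Nat.cast_nonneg _
  nlinarith

/-- With the coordinates of `α ^ m` at hand, the arithmetic operations of an extension of degree
`m` with basis `1, α, …, α ^ (m - 1)` cost `O(m ^ 2)` operations in the base field. -/
theorem fieldModel_ext : FieldModel (coords β (α ^ (s + 1))) (coords β)
    (40 * ((s + 1 : ℕ) : ℝ) ^ 2) := by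
  have hs : (0 : ℝ) ≤ s := Nat.cast_nonneg _
  have hle : ((s + 1 : ℕ) : ℝ) * 1 ≤ 40 * ((s + 1 : ℕ) : ℝ) ^ 2 := by
    push_cast
    nlinarith
  have hone : ∀ ω, (1 : K ω) = β ω 0 := fun ω => by rw [hβ]; simp
  refine ⟨by positivity, ?_, ?_, ?_, ?_, ?_, ?_⟩
  · refine (Computes.coords (c := 1) fun i => ?_).mono le_rfl le_rfl hle
    have : coord β 0 i = 0 := by funext ω; simp [coord]
    rw [this]
    exact Computes.zero.mono le_rfl le_rfl zero_le_one
  · refine (Computes.coords (c := 1) fun i => ?_).mono le_rfl le_rfl hle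
    refine Fin.cases ?_ (fun j => ?_) i
    · have : coord β 1 0 = 1 := by funext ω; simp [coord, hone]
      rw [this]
      exact Computes.one
    · have : coord β 1 j.succ = 0 := by
        funext ω
        simp [coord, hone]
      rw [this]
      exact Computes.zero.mono le_rfl le_rfl zero_le_one
  · intro x y
    refine (Computes.coords (c := 1) fun i => ?_).mono le_rfl le_rfl hle
    have : coord β (x + y) i = coord β x i + coord β y i := by funext ω; simp [coord]
    rw [this]
    exact Computes.add (Or.inr (Or.inl (coord_mem β x i))) (Or.inr (Or.inr (coord_mem β y i)))
  · intro x y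
    refine (Computes.coords (c := 1) fun i => ?_).mono le_rfl le_rfl hle
    have : coord β (x - y) i = coord β x i - coord β y i := by funext ω; simp [coord]
    rw [this]
    exact Computes.sub (Or.inr (Or.inl (coord_mem β x i))) (Or.inr (Or.inr (coord_mem β y i)))
  · intro x y
    exact (computes_ext_mul α β hβ Set.subset_union_left
      (Set.subset_union_left.trans Set.subset_union_right)
      (Set.subset_union_right.trans Set.subset_union_right)).mono le_rfl le_rfl (by
        push_cast
        nlinarith)
  · intro x
    rcases s with _ | s
    · -- in an extension of degree one the only coordinate is inverted
      refine (Computes.coords (c := 2) fun i => ?_).mono le_rfl le_rfl (by norm_num)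
      have : coord β x⁻¹ i = (coord β x i)⁻¹ := by
        funext ω
        have hx : x ω = algebraMap (E ω) (K ω) ((β ω).repr (x ω) 0) := by
          conv_lhs => rw [← (β ω).sum_repr (x ω)]
          simp [← hone, Algebra.smul_def]
        have hr : ∀ z : E ω, (β ω).repr (algebraMap (E ω) (K ω) z) 0 = z := fun z => by
          rw [Algebra.algebraMap_eq_smul_one, hone, map_smul]
          simp
        obtain rfl : i = 0 := Fin.ext (by omega)
        simp only [coord, Pi.inv_apply]
        rw [hx, ← map_inv₀, hr, hr]
      rw [this]
      exact Computes.inv (Or.inr (coord_mem β x i))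
    · refine computes_ext_inv_of_ne_zero α β hβ (fun ω h0 => ?_) Set.subset_union_left
        Set.subset_union_right
      have h1 := (β ω).ne_zero 1
      rw [hβ, h0] at h1
      simp at h1

end

end ExtensionArithmetic

/-! ### The Cauchy–Binet formula -/

section CauchyBinet

open Matrix

variable {R : Type*} [CommRing R] {r n : ℕ}

theorem orderEmbOfFin_comp_injective :
    Function.Injective fun x : Sub n r × Equiv.Perm (Fin r) =>
      (fun i => x.1.1.orderEmbOfFin x.1.2 (x.2 i) : Fin r → Fin n) := by
  rintro ⟨⟨T, hT⟩, σ⟩ ⟨⟨T', hT'⟩, σ'⟩ h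
  simp only at h
  have h1 : T = T' := by
    have h2 : Set.range (fun i => T.orderEmbOfFin hT (σ i))
        = Set.range (fun i => T'.orderEmbOfFin hT' (σ' i)) := by rw [h]
    have h3 : ∀ (U : Finset (Fin n)) (hU : U.card = r) (τ : Equiv.Perm (Fin r)),
        Set.range (fun i => U.orderEmbOfFin hU (τ i)) = U := fun U hU τ => by
      rw [← Finset.range_orderEmbOfFin U hU]
      exact τ.surjective.range_comp _
    rw [h3, h3] at h2
    exact_mod_cast h2
  subst h1
  have h4 : σ = σ' := Equiv.ext fun i => (T.orderEmbOfFin hT).injective (congrFun h i)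
  rw [h4]

/-- An injective function is an increasing one after a permutation. -/
theorem exists_orderEmbOfFin_comp {f : Fin r → Fin n} (hf : Function.Injective f) :
    ∃ (T : Sub n r) (σ : Equiv.Perm (Fin r)), (fun i => T.1.orderEmbOfFin T.2 (σ i)) = f := by
  classical
  have hcard : (Finset.univ.image f).card = r := by
    rw [Finset.card_image_of_injective _ hf, Finset.card_univ, Fintype.card_fin]
  have hmem : ∀ i, f i ∈ Finset.univ.image f := fun i =>
    Finset.mem_image_of_mem _ (Finset.mem_univ _)
  let g : Fin r → Fin r := fun i => ((Finset.univ.image f).orderIsoOfFin hcard).symm ⟨f i, hmem i⟩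
  have hg : ∀ i, (Finset.univ.image f).orderEmbOfFin hcard (g i) = f i := fun i => by
    simp only [g, ← Finset.coe_orderIsoOfFin_apply, OrderIso.apply_symm_apply]
  have hgi : Function.Injective g := fun i j hij => hf (by rw [← hg i, ← hg j, hij])
  exact ⟨⟨_, hcard⟩, Equiv.ofBijective g (Finite.injective_iff_bijective.1 hgi), funext hg⟩

/-- Multilinearity of the determinant in the rows of `A * B`. -/
theorem det_mul_eq_sum_functions (A : Matrix (Fin r) (Fin n) R) (B : Matrix (Fin n) (Fin r) R) :
    (A * B).det = ∑ f : Fin r → Fin n, (∏ i, A i (f i)) * (B.submatrix f id).det := by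
  have h : (A * B) = Matrix.of fun i => ∑ j, A i j • B j := by
    ext i k
    simp [Matrix.mul_apply, Finset.sum_apply]
  rw [h]
  change Matrix.detRowAlternating (fun i => ∑ j, A i j • B j) = _
  have h2 := (Matrix.detRowAlternating (n := Fin r) (R := R)).toMultilinearMap.map_sum
    (fun i j => A i j • B j)
  refine h2.trans (Finset.sum_congr rfl fun f _ => ?_)
  rw [MultilinearMap.map_smul_univ]
  rfl

/-- The Cauchy–Binet formula. -/
theorem det_mul_eq_sum_minors (A : Matrix (Fin r) (Fin n) R) (B : Matrix (Fin n) (Fin r) R) :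
    (A * B).det = ∑ T : Sub n r, (A.submatrix id (T.1.orderEmbOfFin T.2)).det *
      (B.submatrix (T.1.orderEmbOfFin T.2) id).det := by
  classical
  rw [det_mul_eq_sum_functions]
  have h : ∀ T : Sub n r, (A.submatrix id (T.1.orderEmbOfFin T.2)).det *
      (B.submatrix (T.1.orderEmbOfFin T.2) id).det = ∑ σ : Equiv.Perm (Fin r),
        (∏ i, A i (T.1.orderEmbOfFin T.2 (σ i))) *
          (B.submatrix (fun i => T.1.orderEmbOfFin T.2 (σ i)) id).det := by
    intro T
    rw [← Matrix.det_transpose (A.submatrix _ _), Matrix.det_apply', Finset.sum_mul]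
    refine Finset.sum_congr rfl fun σ _ => ?_
    have := Matrix.det_permute σ (B.submatrix (T.1.orderEmbOfFin T.2) id)
    rw [Matrix.submatrix_submatrix] at this
    have h2 : (B.submatrix (fun i => T.1.orderEmbOfFin T.2 (σ i)) id).det
      = (Equiv.Perm.sign σ : R) * (B.submatrix (T.1.orderEmbOfFin T.2) id).det := this
    rw [h2]
    simp only [Matrix.transpose_apply, Matrix.submatrix_apply, id]
    ring
  rw [Finset.sum_congr rfl fun T _ => h T, ← Fintype.sum_prod_type' (f := fun (T : Sub n r)
    (σ : Equiv.Perm (Fin r)) => (∏ i, A i (T.1.orderEmbOfFin T.2 (σ i))) *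
          (B.submatrix (fun i => T.1.orderEmbOfFin T.2 (σ i)) id).det)]
  symm
  refine Fintype.sum_of_injective _ orderEmbOfFin_comp_injective _ _ (fun f hf => ?_)
    (fun x => rfl)
  have hni : ¬ Function.Injective f := fun hi => hf (by
    obtain ⟨T, σ, h⟩ := exists_orderEmbOfFin_comp hi
    exact ⟨(T, σ), h⟩)
  rw [Function.Injective] at hni
  push Not at hni
  obtain ⟨i, j, hij, hne⟩ := hni
  rw [Matrix.det_zero_of_row_eq hne (by funext l; simp [hij]), mul_zero]

end CauchyBinet

/-! ### The maximal minors of the parity check matrix -/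

section ParityMinors

variable {K : Type} [Field K] {n k : ℕ}

theorem card_filter_lt_orderEmbOfFin {a r : ℕ} (J : Finset (Fin a)) (hJ : J.card = r)
    (j : Fin r) : (J.filter fun b => b < J.orderEmbOfFin hJ j).card = j := by
  classical
  have : J.filter (fun b => b < J.orderEmbOfFin hJ j)
      = (Finset.Iio j).map (J.orderEmbOfFin hJ).toEmbedding := by
    ext b
    simp only [Finset.mem_filter, Finset.mem_map, Finset.mem_Iio]
    constructor
    · rintro ⟨hb, hlt⟩
      rw [← Finset.mem_coe, ← Finset.range_orderEmbOfFin J hJ] at hb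
      obtain ⟨i, rfl⟩ := hb
      exact ⟨i, (J.orderEmbOfFin hJ).lt_iff_lt.1 hlt, rfl⟩
    · rintro ⟨i, hi, rfl⟩
      exact ⟨Finset.orderEmbOfFin_mem J hJ i, (J.orderEmbOfFin hJ).lt_iff_lt.2 hi⟩
  rw [this, Finset.card_map, Fin.card_Iio]

/-- Expansion of a minor along its last row, when that row is a unit vector. -/
theorem det_submatrix_of_unit_last_row {a b r : ℕ} (M : Matrix (Fin a) (Fin b) K)
    (T : Finset (Fin a)) (hT : T.card = r + 1) (J : Finset (Fin b)) (hJ : J.card = r + 1)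
    (t : Fin a) (ht : t ∈ T) (hmax : ∀ x ∈ T, x ≤ t) (c : Fin b)
    (hrow : ∀ j, M t j = if j = c then 1 else 0) :
    (M.submatrix (T.orderEmbOfFin hT) (J.orderEmbOfFin hJ)).det =
      if h : c ∈ J then (-1) ^ (J.filter fun x => c < x).card *
        (M.submatrix ((T.erase t).orderEmbOfFin (k := r) (by rw [Finset.card_erase_of_mem ht, hT]; rfl))
          ((J.erase c).orderEmbOfFin (k := r) (by rw [Finset.card_erase_of_mem h, hJ]; rfl))).det
      else 0 := by
  classical
  have hlast : T.orderEmbOfFin hT (Fin.last r) = t := by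
    refine le_antisymm (hmax _ (Finset.orderEmbOfFin_mem T hT _)) ?_
    rw [← Finset.mem_coe, ← Finset.range_orderEmbOfFin T hT] at ht
    obtain ⟨i, rfl⟩ := ht
    exact (T.orderEmbOfFin hT).le_iff_le.2 (Fin.le_last i)
  split_ifs with hc
  · have hc' := hc
    rw [← Finset.mem_coe, ← Finset.range_orderEmbOfFin J hJ] at hc'
    obtain ⟨j, hj⟩ := hc'
    have hTe : (T.erase t).orderEmbOfFin (k := r) (by rw [Finset.card_erase_of_mem ht, hT]; rfl)
        = fun i => T.orderEmbOfFin hT ((Fin.last r).succAbove i) := by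
      symm
      refine Finset.orderEmbOfFin_unique _ (fun i => ?_)
        ((T.orderEmbOfFin hT).strictMono.comp (Fin.strictMono_succAbove _))
      refine Finset.mem_erase.2 ⟨?_, Finset.orderEmbOfFin_mem T hT _⟩
      rw [← hlast]
      exact fun h => Fin.succAbove_ne _ _ ((T.orderEmbOfFin hT).injective h)
    have hJe : (J.erase c).orderEmbOfFin (k := r) (by rw [Finset.card_erase_of_mem hc, hJ]; rfl)
        = fun i => J.orderEmbOfFin hJ (j.succAbove i) := by
      symm
      refine Finset.orderEmbOfFin_unique _ (fun i => ?_)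
        ((J.orderEmbOfFin hJ).strictMono.comp (Fin.strictMono_succAbove _))
      refine Finset.mem_erase.2 ⟨?_, Finset.orderEmbOfFin_mem J hJ _⟩
      rw [← hj]
      exact fun h => Fin.succAbove_ne _ _ ((J.orderEmbOfFin hJ).injective h)
    rw [Matrix.det_succ_row _ (Fin.last r), Finset.sum_eq_single j]
    -- `r + j` and the number of columns to the right of `c` have the same parity
    · have hsign : ((-1 : K)) ^ (((Fin.last r : Fin (r + 1)) : ℕ) + (j : ℕ))
          = (-1) ^ (J.filter fun x => c < x).card := by
        have h1 := card_filter_lt_orderEmbOfFin J hJ j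
        rw [hj] at h1
        have h2 : (J.filter fun x => x < c).card + ((J.filter fun x => c < x).card + 1) = r + 1 := by
          rw [← hJ, ← Finset.card_filter_add_card_filter_not (s := J) (fun x => x < c)]
          congr 1
          have : J.filter (fun x => ¬ x < c) = insert c (J.filter fun x => c < x) := by
            ext x
            simp only [Finset.mem_filter, Finset.mem_insert, not_lt]
            constructor
            · rintro ⟨hx, hle⟩
              rcases hle.eq_or_lt with h | h
              · exact Or.inl h.symm
              · exact Or.inr ⟨hx, h⟩
            · rintro (rfl | ⟨hx, h⟩)
              · exact ⟨hc, le_rfl⟩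
              · exact ⟨hx, h.le⟩
          rw [this, Finset.card_insert_of_notMem (by simp)]
        rw [Fin.val_last]
        have h3 : r + (j : ℕ) = (J.filter fun x => c < x).card + 2 * (j : ℕ) := by omega
        rw [h3, pow_add, pow_mul]
        simp
      rw [hsign, Matrix.submatrix_apply, hlast, hrow, hj, if_pos rfl, mul_one, hTe, hJe]
      rfl
    · intro i _ hi
      have : J.orderEmbOfFin hJ i ≠ c := fun h => hi ((J.orderEmbOfFin hJ).injective (h.trans hj.symm))
      rw [Matrix.submatrix_apply, hlast, hrow, if_neg this]
      simp
    · simp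
  · refine Matrix.det_eq_zero_of_row_eq_zero (Fin.last r) fun j => ?_
    have : J.orderEmbOfFin hJ j ≠ c := fun h => hc (h ▸ Finset.orderEmbOfFin_mem J hJ j)
    rw [Matrix.submatrix_apply, hlast, hrow, if_neg this]

theorem mem_headPart {T : Finset (Fin n)} {i : Fin (k + 1)} :
    i ∈ headPart k T ↔ ∃ t ∈ T, t.val = i.val := by simp [headPart]

theorem mem_tailPart {T : Finset (Fin n)} {j : Fin (n - k - 1)} :
    j ∈ tailPart k T ↔ ∃ t ∈ T, t.val = k + 1 + j.val := by simp [tailPart]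

theorem signExp_insert {a : ℕ} {S J : Finset (Fin a)} {c : Fin a} (hc : c ∉ S)
    (hS : ∀ x ∈ S, x < c) (hJ : c ∈ J) :
    signExp (insert c S) J = signExp S (J.erase c) + (J.filter fun x => c < x).card := by
  classical
  have h1 : J \ insert c S = J.erase c \ S := by
    ext x
    simp only [Finset.mem_sdiff, Finset.mem_insert, Finset.mem_erase]
    tauto
  have h2 : ((insert c S ×ˢ (J.erase c \ S)).filter fun x => x.1 < x.2)
      = ((S ×ˢ (J.erase c \ S)).filter fun x => x.1 < x.2) ∪
        (J.filter fun x => c < x).image fun x => (c, x) := by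
    ext ⟨x, y⟩
    simp only [Finset.mem_filter, Finset.mem_product, Finset.mem_insert, Finset.mem_sdiff,
      Finset.mem_erase, Finset.mem_union, Finset.mem_image, Prod.mk.injEq]
    constructor
    · rintro ⟨⟨rfl | hx, ⟨hy1, hy2⟩, hy3⟩, hxy⟩
      · exact Or.inr ⟨y, ⟨hy2, hxy⟩, rfl, rfl⟩
      · exact Or.inl ⟨⟨hx, ⟨hy1, hy2⟩, hy3⟩, hxy⟩
    · rintro (⟨⟨hx, ⟨hy1, hy2⟩, hy3⟩, hxy⟩ | ⟨z, ⟨hz, hcz⟩, rfl, rfl⟩)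
      · exact ⟨⟨Or.inr hx, ⟨hy1, hy2⟩, hy3⟩, hxy⟩
      · exact ⟨⟨Or.inl rfl, ⟨hcz.ne', hz⟩, fun h => absurd (hS z h) hcz.le.not_gt⟩, hcz⟩
  unfold signExp
  rw [h1, h2, Finset.card_union_of_disjoint,
    Finset.card_image_of_injective _ (fun x y h => (Prod.mk.inj h).2)]
  · ring
  · rw [Finset.disjoint_left]
    rintro ⟨x, y⟩ hx hy
    simp only [Finset.mem_filter, Finset.mem_product, Finset.mem_image, Prod.mk.injEq]
      at hx hy
    obtain ⟨z, _, rfl, _⟩ := hy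
    exact hc hx.1.1

/-- The maximal minors of the transposed parity check matrix: by expansion along the unit vectors
among the rows, the last one first, they are minors of `R` up to sign. -/
theorem det_parityCheck_transpose_submatrix (hk : k + 1 ≤ n)
    (R : Matrix (Fin (k + 1)) (Fin (n - k - 1)) K) (r : ℕ) :
    ∀ (T : Finset (Fin n)) (hT : T.card = r) (J : Finset (Fin (n - k - 1))) (hJ : J.card = r),
    ((parityCheck R).transpose.submatrix (T.orderEmbOfFin hT) (J.orderEmbOfFin hJ)).det =
      if tailPart k T ⊆ J then
        (-1) ^ signExp (tailPart k T) J * minor R (headPart k T) (J \ tailPart k T)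
      else 0 := by
  classical
  -- without rows from the identity block the minor is one of `-R`
  have base : ∀ (r : ℕ) (T : Finset (Fin n)) (hT : T.card = r) (J : Finset (Fin (n - k - 1)))
      (hJ : J.card = r), (∀ t ∈ T, t.val < k + 1) →
      ((parityCheck R).transpose.submatrix (T.orderEmbOfFin hT) (J.orderEmbOfFin hJ)).det =
      if tailPart k T ⊆ J then
        (-1) ^ signExp (tailPart k T) J * minor R (headPart k T) (J \ tailPart k T)
      else 0 := by
    intro r T hT J hJ hlt
    have htail : tailPart k T = ∅ := by
      refine Finset.eq_empty_of_forall_notMem fun j hj => ?_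
      obtain ⟨t, ht, htj⟩ := mem_tailPart.1 hj
      have := hlt t ht
      omega
    have hmap : (headPart k T).map (Fin.castLEEmb hk) = T := by
      ext t
      simp only [Finset.mem_map, mem_headPart, Fin.castLEEmb_apply]
      constructor
      · rintro ⟨i, ⟨t', ht', h⟩, rfl⟩
        have : t' = Fin.castLE hk i := Fin.ext (by simpa using h)
        rwa [← this]
      · intro ht
        exact ⟨⟨t.val, hlt t ht⟩, ⟨t, ht, rfl⟩, Fin.ext rfl⟩
    have hcard : (headPart k T).card = r := by
      rw [← hT, ← hmap, Finset.card_map]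
      congr 1
      rw [hmap]
    subst hcard
    have hTe : (T.orderEmbOfFin hT : _ → Fin n)
        = fun i => Fin.castLE hk ((headPart k T).orderEmbOfFin rfl i) := by
      symm
      refine Finset.orderEmbOfFin_unique _ (fun i => ?_)
        ((Fin.strictMono_castLE hk).comp ((headPart k T).orderEmbOfFin rfl).strictMono)
      exact (Finset.ext_iff.1 hmap _).1
        (Finset.mem_map_of_mem _ (Finset.orderEmbOfFin_mem _ rfl i))
    rw [htail, if_pos (Finset.empty_subset _), Finset.sdiff_empty]
    have hs : signExp ∅ J = (headPart k T).card := by simp [signExp, hJ]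
    rw [hs, minor, dif_pos hJ]
    have hM : (parityCheck R).transpose.submatrix (T.orderEmbOfFin hT) (J.orderEmbOfFin hJ)
        = -(R.submatrix ((headPart k T).orderEmbOfFin rfl) (J.orderEmbOfFin hJ)) := by
      ext i j
      simp only [Matrix.submatrix_apply, Matrix.transpose_apply, Matrix.neg_apply, hTe, parityCheck,
        Matrix.of_apply, Fin.val_castLE, Fin.is_lt, dif_pos]
    rw [hM, Matrix.det_neg, Fintype.card_fin]
  induction r with
  | zero =>
    intro T hT J hJ
    refine base 0 T hT J hJ fun t ht => ?_
    rw [Finset.card_eq_zero] at hT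
    rw [hT] at ht
    simp at ht
  | succ r ih =>
    intro T hT J hJ
    by_cases hall : ∀ t ∈ T, t.val < k + 1
    · exact base _ T hT J hJ hall
    push Not at hall
    obtain ⟨t₀, ht₀, hkt₀⟩ := hall
    obtain ⟨t, ht, hmax⟩ := T.exists_max_image id ⟨t₀, ht₀⟩
    have hkt : k + 1 ≤ t.val := hkt₀.trans (hmax t₀ ht₀)
    have htn := t.isLt
    set c : Fin (n - k - 1) := ⟨t.val - (k + 1), by omega⟩ with hc
    have hct : t.val = k + 1 + c.val := by simp only [hc]; omega
    have hcT : c ∈ tailPart k T := mem_tailPart.2 ⟨t, ht, hct⟩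
    have hhead : headPart k (T.erase t) = headPart k T := by
      ext i
      simp only [mem_headPart, Finset.mem_erase]
      constructor
      · rintro ⟨x, ⟨_, hx⟩, h⟩
        exact ⟨x, hx, h⟩
      · rintro ⟨x, hx, h⟩
        refine ⟨x, ⟨fun hxt => ?_, hx⟩, h⟩
        have := i.isLt
        subst hxt
        omega
    have htail : tailPart k T = insert c (tailPart k (T.erase t)) := by
      ext j
      simp only [mem_tailPart, Finset.mem_erase, Finset.mem_insert]
      constructor
      · rintro ⟨x, hx, h⟩
        by_cases hxt : x = t
        · left
          subst hxt
          exact Fin.ext (by omega)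
        · exact Or.inr ⟨x, ⟨hxt, hx⟩, h⟩
      · rintro (rfl | ⟨x, ⟨_, hx⟩, h⟩)
        · exact ⟨t, ht, hct⟩
        · exact ⟨x, hx, h⟩
    have hlt : ∀ x ∈ tailPart k (T.erase t), x < c := by
      intro x hx
      obtain ⟨y, hy, hyx⟩ := mem_tailPart.1 hx
      obtain ⟨hyt, hyT⟩ := Finset.mem_erase.1 hy
      have h1 : y ≤ t := hmax y hyT
      have h2 : y < t := lt_of_le_of_ne h1 hyt
      rw [Fin.lt_def] at h2 ⊢
      omega
    have hcn : c ∉ tailPart k (T.erase t) := fun h => lt_irrefl _ (hlt c h)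
    rw [det_submatrix_of_unit_last_row _ T hT J hJ t ht hmax c (fun j => by
      rw [Matrix.transpose_apply, parityCheck, Matrix.of_apply, dif_neg (by omega)]
      by_cases hj : j = c
      · rw [if_pos hj, if_pos (by rw [hj]; exact hct)]
      · rw [if_neg hj, if_neg (fun h => hj (Fin.ext (by omega)))])]
    by_cases hcJ : c ∈ J
    · rw [dif_pos hcJ, ih, hhead, htail]
      have hsub : insert c (tailPart k (T.erase t)) ⊆ J ↔ tailPart k (T.erase t) ⊆ J.erase c := by
        rw [Finset.insert_subset_iff, Finset.subset_erase]
        exact ⟨fun h => ⟨h.2, hcn⟩, fun h => ⟨hcJ, h.1⟩⟩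
      by_cases hsJ : tailPart k (T.erase t) ⊆ J.erase c
      · rw [if_pos hsJ, if_pos (hsub.2 hsJ), signExp_insert hcn hlt hcJ, pow_add]
        have : J \ insert c (tailPart k (T.erase t)) = J.erase c \ tailPart k (T.erase t) := by
          ext x
          simp only [Finset.mem_sdiff, Finset.mem_insert, Finset.mem_erase]
          tauto
        rw [this]
        ring
      · rw [if_neg hsJ, if_neg (fun h => hsJ (hsub.1 h)), mul_zero]
    · rw [dif_neg hcJ, if_neg (fun h => hcJ (h hcT))]

end ParityMinors

/-! ### Solutions of the decoding problem -/

section Decoding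

open Matrix

variable {F K : Type} [Field F] [Field K] [Algebra F K] {m n k r : ℕ}

theorem sum_head_tail {M : Type*} [AddCommMonoid M] (hk : k + 1 ≤ n) (f : Fin n → M) :
    ∑ t, f t = (∑ i : Fin (k + 1), f ⟨i, by omega⟩)
      + ∑ j : Fin (n - k - 1), f ⟨k + 1 + j, by omega⟩ := by
  have h : k + 1 + (n - k - 1) = n := by omega
  rw [← Equiv.sum_comp (finCongr h), Fin.sum_univ_add]
  rfl

theorem vecMul_parityCheck_transpose (hk : k + 1 ≤ n)
    (R : Matrix (Fin (k + 1)) (Fin (n - k - 1)) K) (x : Fin n → K) (j : Fin (n - k - 1)) :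
    (x ᵥ* (parityCheck R).transpose) j
      = x ⟨k + 1 + j, by omega⟩ - ∑ i : Fin (k + 1), x ⟨i, by omega⟩ * R i j := by
  have h1 : ∀ i : Fin (k + 1), (parityCheck R).transpose ⟨i, by omega⟩ j = -R i j := fun i => by
    rw [transpose_apply, parityCheck, Matrix.of_apply, dif_pos i.isLt]
  have h2 : ∀ l : Fin (n - k - 1), (parityCheck R).transpose ⟨k + 1 + l, by omega⟩ j
      = if l = j then 1 else 0 := fun l => by
    rw [transpose_apply, parityCheck, Matrix.of_apply, dif_neg (by simp only; omega)]
    simp [Fin.ext_iff]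
  simp only [vecMul, dotProduct]
  rw [sum_head_tail hk]
  simp only [h1, h2, mul_neg, Finset.sum_neg_distrib, mul_ite, mul_one, mul_zero,
    Finset.sum_ite_eq', Finset.mem_univ, if_true]
  ring

/-- The code with generator matrix `(I R)` has the parity check matrix `(-Rᵀ I)`. -/
theorem mem_span_sysGen_iff (hk : k + 1 ≤ n) (R : Matrix (Fin (k + 1)) (Fin (n - k - 1)) K)
    (x : Fin n → K) :
    x ∈ Submodule.span K (Set.range (sysGen R).row) ↔ x ᵥ* (parityCheck R).transpose = 0 := by
  have g1 : ∀ i l : Fin (k + 1), sysGen R i ⟨l, by omega⟩ = if l = i then 1 else 0 := fun i l => by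
    have := l.isLt
    rw [sysGen, Matrix.of_apply, dif_neg (by simp only; omega)]
    simp [Fin.ext_iff]
  have g2 : ∀ (i : Fin (k + 1)) (j : Fin (n - k - 1)), sysGen R i ⟨k + 1 + j, by omega⟩ = R i j :=
    fun i j => by
      rw [sysGen, Matrix.of_apply, dif_pos (by simp)]
      congr 1
      exact Fin.ext (by simp)
  rw [Submodule.mem_span_range_iff_exists_fun]
  constructor
  · rintro ⟨c, rfl⟩
    funext j
    rw [vecMul_parityCheck_transpose hk]
    simp only [Finset.sum_apply, Pi.smul_apply, smul_eq_mul, Matrix.row, g1, g2, Pi.zero_apply]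
    simp
  · intro h
    refine ⟨fun i => x ⟨i, by omega⟩, ?_⟩
    funext t
    simp only [Finset.sum_apply, Pi.smul_apply, smul_eq_mul, Matrix.row]
    rcases Nat.lt_or_ge t.val (k + 1) with ht | ht
    · have : ∀ i, sysGen R i t = if (⟨t.val, ht⟩ : Fin (k + 1)) = i then 1 else 0 :=
        fun i => g1 i ⟨t.val, ht⟩
      simp [this]
    · have htj := t.isLt
      have e : t = ⟨k + 1 + (⟨t.val - (k + 1), by omega⟩ : Fin (n - k - 1)).val, by omega⟩ :=
        Fin.ext (by simp only; omega)
      have h2 := congrFun h ⟨t.val - (k + 1), by omega⟩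
      rw [vecMul_parityCheck_transpose hk, Pi.zero_apply, sub_eq_zero] at h2
      refine Eq.trans (Finset.sum_congr rfl fun i _ => ?_) (h2.symm.trans (congrArg x e.symm))
      rw [← g2 i ⟨t.val - (k + 1), by omega⟩]
      exact congrArg (fun t => x ⟨i, by omega⟩ * sysGen R i t) e

/-- The rank weight of a combination of `r` elements with coefficients in the base field. -/
theorem rankWeight_vecMul_le (β : Module.Basis (Fin m) F K) (S : Fin r → K)
    (C : Matrix (Fin r) (Fin n) F) : rankWeight β (S ᵥ* C.map (algebraMap F K)) ≤ r := by
  have : (Matrix.of fun (i : Fin m) (j : Fin n) => β.repr ((S ᵥ* C.map (algebraMap F K)) j) i)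
      = (Matrix.of fun (i : Fin m) (l : Fin r) => β.repr (S l) i) * C := by
    ext i j
    simp only [Matrix.of_apply, Matrix.mul_apply, vecMul, dotProduct, Matrix.map_apply, map_sum,
      Finsupp.finsetSum_apply]
    refine Finset.sum_congr rfl fun l _ => ?_
    rw [mul_comm, ← Algebra.smul_def, map_smul, Finsupp.smul_apply, smul_eq_mul, mul_comm]
  rw [rankWeight, this]
  exact (Matrix.rank_mul_le_right _ _).trans (Matrix.rank_le_height C)

theorem rankWeight_eq_finrank_span (β : Module.Basis (Fin m) F K) (x : Fin n → K) :
    rankWeight β x = Module.finrank F (Submodule.span F (Set.range x)) := by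
  rw [rankWeight, Matrix.rank_eq_finrank_span_cols]
  have : Set.range (Matrix.col (Matrix.of fun (i : Fin m) (j : Fin n) => β.repr (x j) i))
      = β.equivFun '' Set.range x := by
    rw [← Set.range_comp]
    rfl
  rw [this]
  have h2 := Submodule.map_span β.equivFun.toLinearMap (Set.range x)
  have h3 : Submodule.span F (β.equivFun '' Set.range x)
      = (Submodule.span F (Set.range x)).map β.equivFun.toLinearMap := h2.symm
  rw [h3]
  exact LinearEquiv.finrank_map_eq β.equivFun _

/-- The matrix `C` starts with the identity matrix. -/
def IsSystematic {R : Type*} [Zero R] [One R] (C : Matrix (Fin r) (Fin n) R) : Prop :=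
  ∀ (i : Fin r) (j : Fin n), j.val < r → C i j = if j.val = i.val then 1 else 0

theorem IsSystematic.map {C : Matrix (Fin r) (Fin n) F} (hC : IsSystematic C) :
    IsSystematic (C.map (algebraMap F K)) := fun i j hj => by
  rw [Matrix.map_apply, hC i j hj, apply_ite (algebraMap F K), map_one, map_zero]

theorem IsSystematic.vecMul_apply {R : Type*} [CommRing R] (hr : r ≤ n)
    {C : Matrix (Fin r) (Fin n) R} (hC : IsSystematic C) (S : Fin r → R) (i : Fin r) :
    (S ᵥ* C) ⟨i, by omega⟩ = S i := by
  simp only [vecMul, dotProduct]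
  rw [Finset.sum_eq_single i]
  · rw [hC i ⟨i, by omega⟩ i.isLt, if_pos rfl, mul_one]
  · intro j _ hj
    rw [hC j ⟨i, by omega⟩ i.isLt, if_neg (fun h => hj (Fin.ext h.symm)), mul_zero]
  · simp

/-- The first `r` coordinates. -/
def headVec {R : Type*} (hr : r ≤ n) (e : Fin n → R) : Fin r → R := fun i => e ⟨i, by omega⟩

namespace IsInstance

variable {β : Module.Basis (Fin m) F K} {R : Matrix (Fin (k + 1)) (Fin (n - k - 1)) K}
  {𝒞 : Submodule K (Fin n → K)} {y e : Fin n → K}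

theorem linearIndependent_headVec (h : IsInstance r β R 𝒞 y e) (hr : r ≤ n) :
    LinearIndependent F (headVec hr e) := by
  have h1 : LinearIndependent F fun t : {t : Fin n | t.val < r} => e t := h.first_columns
  exact h1.comp (fun i : Fin r => ⟨⟨i, by omega⟩, i.isLt⟩) fun i j hij => by
    simpa [Fin.ext_iff] using hij

/-- The first `r` coordinates are a basis of the support of the error. -/
theorem exists_coefficients (h : IsInstance r β R 𝒞 y e) (hr : r ≤ n) :
    ∃ C : Matrix (Fin r) (Fin n) F, IsSystematic C ∧
      headVec hr e ᵥ* C.map (algebraMap F K) = e := by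
  have hli := h.linearIndependent_headVec hr
  have hfd : FiniteDimensional F K := Module.Basis.finiteDimensional_of_finite β
  have hspan : Submodule.span F (Set.range (headVec hr e)) = Submodule.span F (Set.range e) := by
    refine Submodule.eq_of_le_of_finrank_eq (Submodule.span_mono ?_) ?_
    · rintro _ ⟨i, rfl⟩
      exact ⟨_, rfl⟩
    · rw [finrank_span_eq_card hli, Fintype.card_fin, ← rankWeight_eq_finrank_span β, h.weight]
  have hc : ∀ j, ∃ c : Fin r → F, ∑ i, c i • headVec hr e i = e j := fun j => by
    rw [← Submodule.mem_span_range_iff_exists_fun, hspan]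
    exact Submodule.subset_span ⟨j, rfl⟩
  choose c hc using hc
  refine ⟨Matrix.of fun i j => c j i, fun i j hj => ?_, ?_⟩
  · have h1 : ∑ i, c j i • headVec hr e i
        = ∑ i : Fin r, (if j.val = i.val then (1 : F) else 0) • headVec hr e i := by
      rw [hc, Finset.sum_eq_single ⟨j.val, hj⟩]
      · simp [headVec]
      · intro l _ hl
        rw [if_neg (fun hjl => hl (Fin.ext hjl.symm)), zero_smul]
      · simp
    have h2 := hli.eq_coords_of_eq h1
    exact h2 i
  · funext j
    rw [← hc j]
    simp only [vecMul, dotProduct, Matrix.map_apply, Matrix.of_apply]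
    exact Finset.sum_congr rfl fun i _ => by rw [mul_comm, Algebra.smul_def]

theorem error_parityCheck (h : IsInstance r β R 𝒞 y e) (hk : k + 1 ≤ n) :
    e ᵥ* (parityCheck R).transpose = 0 := by
  rw [← mem_span_sysGen_iff hk, ← h.systematic]
  have : e = -(y - e) + y := by abel
  rw [this]
  exact Submodule.add_mem_sup (Submodule.neg_mem _ h.error_spec)
    (Submodule.mem_span_singleton_self y)

/-- The uniqueness of the error makes the solution space of the linear system for the support
one-dimensional: a solution `S` gives the word `S C`, of weight at most `r`, in `𝒞 + ⟨y⟩`; up to a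
factor it is a solution of the decoding problem, or it can be added to one. -/
theorem exists_smul_of_solution (h : IsInstance r β R 𝒞 y e) (hk : k + 1 ≤ n) (hr : r ≤ n)
    {C : Matrix (Fin r) (Fin n) F} (hC : IsSystematic C)
    (hCe : headVec hr e ᵥ* C.map (algebraMap F K) = e) {S : Fin r → K}
    (hS : S ᵥ* (C.map (algebraMap F K) * (parityCheck R).transpose) = 0) :
    ∃ a : K, S = a • headVec hr e := by
  have hinj : ∀ S S' : Fin r → K, S ᵥ* C.map (algebraMap F K) = S' ᵥ* C.map (algebraMap F K) →
      S = S' := fun S S' hSS' => funext fun i => by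
    rw [← hC.map.vecMul_apply hr S i, hSS', hC.map.vecMul_apply hr S' i]
  rw [← vecMul_vecMul, ← mem_span_sysGen_iff hk, ← h.systematic, Submodule.mem_sup] at hS
  obtain ⟨c, hc, z, hz, hcz⟩ := hS
  obtain ⟨a, rfl⟩ := Submodule.mem_span_singleton.1 hz
  -- `S C` lies in the code itself, so that `e + S C` solves the decoding problem as well
  rcases eq_or_ne a 0 with rfl | ha
  · rw [zero_smul, add_zero] at hcz
    have := h.unique (e + c) (by
      rw [← sub_sub]
      exact 𝒞.sub_mem h.error_spec hc) (by
      rw [hcz]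
      conv_lhs => rw [← hCe]
      rw [← add_vecMul]
      exact rankWeight_vecMul_le β _ C)
    have hc0 : c = 0 := by simpa using this
    refine ⟨0, hinj _ _ ?_⟩
    rw [zero_smul, zero_vecMul, ← hcz, hc0]
  · have h1 : a⁻¹ • c + y = (a⁻¹ • S) ᵥ* C.map (algebraMap F K) := by
      rw [smul_vecMul, ← hcz, smul_add, inv_smul_smul₀ ha]
    have := h.unique (a⁻¹ • c + y) (by
      have : y - (a⁻¹ • c + y) = -(a⁻¹ • c) := by abel
      rw [this]
      exact 𝒞.neg_mem (𝒞.smul_mem _ hc)) (by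
      rw [h1]
      exact rankWeight_vecMul_le β _ C)
    refine ⟨a, ?_⟩
    have h2 : a⁻¹ • S = headVec hr e := hinj _ _ (by rw [← h1, this, hCe])
    rw [← h2, smul_inv_smul₀ ha]

end IsInstance

/-! ### The linear system in the maximal minors -/

theorem card_firstCols (hr : r ≤ n) : (firstCols n r).card = r := by
  have : firstCols n r = (Finset.univ : Finset (Fin r)).map (Fin.castLEEmb hr) := by
    ext t
    simp only [firstCols, Finset.mem_filter, Finset.mem_univ, true_and, Finset.mem_map,
      Fin.castLEEmb_apply]
    exact ⟨fun h => ⟨⟨t.val, h⟩, rfl⟩, by rintro ⟨i, rfl⟩; exact i.isLt⟩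
  rw [this, Finset.card_map, Finset.card_univ, Fintype.card_fin]

/-- The maximal minor with columns `T`. -/
def maxMinor (C : Matrix (Fin r) (Fin n) F) (T : Sub n r) : F :=
  (C.submatrix id (T.1.orderEmbOfFin T.2)).det

theorem maxMinor_firstCols (hr : r ≤ n) {C : Matrix (Fin r) (Fin n) F} (hC : IsSystematic C)
    (T : Sub n r) (hT : T.1 = firstCols n r) : maxMinor C T = 1 := by
  have h : (T.1.orderEmbOfFin T.2 : Fin r → Fin n) = Fin.castLE hr := by
    symm
    refine Finset.orderEmbOfFin_unique _ (fun i => ?_) (Fin.strictMono_castLE hr)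
    rw [hT]
    simp [firstCols]
  have h2 : C.submatrix id (T.1.orderEmbOfFin T.2) = 1 := by
    ext i j
    rw [Matrix.submatrix_apply, h, id, hC i _ (by simp), Matrix.one_apply]
    simp only [Fin.val_castLE, Fin.ext_iff, eq_comm]
  rw [maxMinor, h2, Matrix.det_one]

/-- For a matrix `(I C')` the entries of `C'` are maximal minors up to sign. -/
theorem maxMinor_exchange (hr : r ≤ n) {C : Matrix (Fin r) (Fin n) F} (hC : IsSystematic C)
    (i : Fin r) (j : Fin n) (hj : r ≤ j.val) (T : Sub n r)
    (hT : T.1 = insert j ((firstCols n r).filter fun t => t.val ≠ i.val)) :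
    C i j = (-1) ^ (r + (i.val + 1)) * maxMinor C T := by
  obtain ⟨r, rfl⟩ : ∃ s, r = s + 1 := ⟨r - 1, by have := i.isLt; omega⟩
  let f : Fin (r + 1) → Fin n := Fin.snoc (fun l : Fin r => Fin.castLE hr (i.succAbove l)) j
  have hf : (T.1.orderEmbOfFin T.2 : Fin (r + 1) → Fin n) = f := by
    symm
    refine Finset.orderEmbOfFin_unique _ (fun l => ?_) ?_
    · rw [hT]
      refine Fin.lastCases ?_ (fun l => ?_) l
      · simp [f]
      · simp only [f, Fin.snoc_castSucc]
        refine Finset.mem_insert_of_mem (Finset.mem_filter.2 ⟨?_, ?_⟩)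
        · simpa [firstCols] using Nat.lt_succ_iff.1 (i.succAbove l).isLt
        · simpa [Fin.ext_iff] using Fin.succAbove_ne i l
    · intro a b
      refine Fin.lastCases ?_ (fun a => ?_) a
      · intro hlt
        exact absurd hlt (Fin.le_last b).not_gt
      · refine Fin.lastCases ?_ (fun b => ?_) b
        · intro _
          simp only [f, Fin.snoc_castSucc, Fin.snoc_last]
          rw [Fin.lt_def, Fin.val_castLE]
          exact lt_of_lt_of_le (i.succAbove a).isLt hj
        · intro hlt
          simp only [f, Fin.snoc_castSucc]
          exact Fin.strictMono_castLE hr (Fin.strictMono_succAbove i (by simpa using hlt))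
  have hCf : ∀ a (l : Fin r), C a (f l.castSucc) = if a = i.succAbove l then 1 else 0 := by
    intro a l
    simp only [f, Fin.snoc_castSucc]
    rw [hC a _ (by rw [Fin.val_castLE]; exact (i.succAbove l).isLt)]
    simp only [Fin.val_castLE, Fin.ext_iff, eq_comm]
  have hdet : maxMinor C T = (-1) ^ (i.val + r) * C i j := by
    rw [maxMinor, hf, Matrix.det_succ_column _ (Fin.last r), Finset.sum_eq_single i]
    · have h1 : ((C.submatrix id f).submatrix i.succAbove (Fin.last r).succAbove) = 1 := by
        ext a b
        simp only [Matrix.submatrix_apply, id, Fin.succAbove_last, hCf, Matrix.one_apply,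
          Fin.succAbove_right_inj]
      rw [h1, Matrix.det_one]
      simp [f]
    · intro a _ ha
      obtain ⟨b, hb⟩ := Fin.exists_succAbove_eq (Ne.symm ha)
      rw [Matrix.det_eq_zero_of_row_eq_zero b, mul_zero]
      intro l
      simp only [Matrix.submatrix_apply, id, Fin.succAbove_last, hCf, hb]
      rw [if_neg (Fin.succAbove_ne i l).symm]
    · simp
  rw [hdet, ← mul_assoc, ← pow_add]
  have : r + 1 + (i.val + 1) + (i.val + r) = 2 * (r + i.val + 1) := by ring
  rw [this, pow_mul]
  simp

/-- If `C Hᵀ` has a nonzero vector in its left kernel, then all its maximal minors vanish, and by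
the Cauchy–Binet formula the maximal minors of `C` lie in the right kernel of `MaxMin`. -/
theorem maxMin_mulVec_maxMinor (hk : k + 1 ≤ n) (β : Module.Basis (Fin m) F K)
    (R : Matrix (Fin (k + 1)) (Fin (n - k - 1)) K) (C : Matrix (Fin r) (Fin n) F)
    {S : Fin r → K} (hS0 : S ≠ 0)
    (hS : S ᵥ* (C.map (algebraMap F K) * (parityCheck R).transpose) = 0) :
    (MaxMin r β R) *ᵥ maxMinor C = 0 := by
  classical
  funext ⟨J, i⟩
  have hdet : (C.map (algebraMap F K) *
      ((parityCheck R).transpose.submatrix id (J.1.orderEmbOfFin J.2))).det = 0 := by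
    rw [← Matrix.exists_vecMul_eq_zero_iff]
    refine ⟨S, hS0, ?_⟩
    funext l
    exact congrFun hS (J.1.orderEmbOfFin J.2 l)
  rw [det_mul_eq_sum_minors] at hdet
  have h2 := congrArg (fun z => β.repr z i) hdet
  simp only [map_sum, Finsupp.finsetSum_apply, map_zero, Finsupp.zero_apply] at h2
  rw [Pi.zero_apply, ← h2]
  simp only [mulVec, dotProduct, MaxMin, Matrix.of_apply]
  refine Finset.sum_congr rfl fun T _ => ?_
  have h3 : ((C.map (algebraMap F K)).submatrix id (T.1.orderEmbOfFin T.2)).det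
      = algebraMap F K (maxMinor C T) := by
    rw [maxMinor, RingHom.map_det]
    rfl
  have h4 := det_parityCheck_transpose_submatrix hk R r T.1 T.2 J.1 J.2
  rw [h3, Matrix.submatrix_submatrix, Function.id_comp, Function.comp_id, h4, ← Algebra.smul_def,
    map_smul, Finsupp.smul_apply, smul_eq_mul, mul_comm]
  split_ifs <;> simp

theorem card_sub (n r : ℕ) : Fintype.card (Sub n r) = n.choose r := by
  rw [Fintype.card_finset_len, Fintype.card_fin]

/-- The rank of `MaxMin` makes its right kernel one-dimensional. -/
theorem eq_smul_maxMinor (hr : r ≤ n) (β : Module.Basis (Fin m) F K)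
    (R : Matrix (Fin (k + 1)) (Fin (n - k - 1)) K) {C : Matrix (Fin r) (Fin n) F}
    (hC : IsSystematic C) (hmem : (MaxMin r β R) *ᵥ maxMinor C = 0)
    (hrank : (MaxMin r β R).rank = n.choose r - 1) (v : Sub n r → F)
    (hv : (MaxMin r β R) *ᵥ v = 0) (T₀ : Sub n r) (hT₀ : T₀.1 = firstCols n r) (T : Sub n r) :
    v T = maxMinor C T * v T₀ := by
  have h1 := LinearMap.finrank_range_add_finrank_ker (MaxMin r β R).mulVecLin
  have h2 : Module.finrank F (LinearMap.range (MaxMin r β R).mulVecLin) = n.choose r - 1 := hrank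
  have hpos : 0 < n.choose r := Nat.choose_pos hr
  rw [h2, Module.finrank_pi, card_sub] at h1
  have h3 : Module.finrank F (LinearMap.ker (MaxMin r β R).mulVecLin) = 1 := by omega
  have hone := maxMinor_firstCols hr hC T₀ hT₀
  have hc0 : (⟨maxMinor C, by rwa [LinearMap.mem_ker]⟩ :
      LinearMap.ker (MaxMin r β R).mulVecLin) ≠ 0 := by
    intro h
    have h0 : maxMinor C T₀ = 0 := congrFun (congrArg Subtype.val h) T₀
    exact one_ne_zero (hone.symm.trans h0)
  obtain ⟨a, ha⟩ := (finrank_eq_one_iff_of_nonzero' _ hc0).1 h3 ⟨v, by rwa [LinearMap.mem_ker]⟩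
  have ha' : a • maxMinor C = v := congrArg Subtype.val ha
  rw [← ha', Pi.smul_apply, Pi.smul_apply, hone, smul_eq_mul, smul_eq_mul, mul_one, mul_comm]

end Decoding

/-! ### Computing the minors of a matrix over the extension -/

section Minors

set_option linter.unusedSectionVars false

open Matrix

/-- The matrix of all minors of order `t`, with rows and columns taken in increasing order. -/
def compound {S : Type*} [CommRing S] {a b : ℕ} (R : Matrix (Fin a) (Fin b) S) (t : ℕ) :
    Matrix (Fin t ↪o Fin a) (Fin t ↪o Fin b) S :=
  Matrix.of fun f g => (R.submatrix f g).det

theorem card_orderEmb (t a : ℕ) : Fintype.card (Fin t ↪o Fin a) = a.choose t := by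
  rw [← Nat.card_eq_fintype_card, Nat.card_congr Set.powersetCard.ofFinEmbEquiv,
    Set.powersetCard.card, Nat.card_fin]

theorem compound_succ {S : Type*} [CommRing S] {a b : ℕ} (R : Matrix (Fin a) (Fin b) S) {t : ℕ}
    (f : Fin (t + 1) ↪o Fin a) (g : Fin (t + 1) ↪o Fin b) :
    compound R (t + 1) f g = ∑ j : Fin (t + 1), (-1) ^ (j : ℕ) *
      (compound R t ((Fin.succOrderEmb t).trans f) ((Fin.succAboveOrderEmb j).trans g)
        * R (f 0) (g j)) := by
  rw [compound, Matrix.of_apply, Matrix.det_succ_row_zero]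
  refine Finset.sum_congr rfl fun j _ => ?_
  rw [mul_assoc, mul_comm (compound R t _ _)]
  rfl

variable {Ω : Type*} {E : Ω → Type} [∀ ω, Field (E ω)] {K : Ω → Type} [∀ ω, Field (K ω)]
  [∀ ω, Algebra (E ω) (K ω)] {m s : ℕ} {X : Set (∀ ω, E ω)} {A : Set Ω}

theorem coord_sum (β : ∀ ω, Module.Basis (Fin m) (E ω) (K ω)) {ι : Type*} (I : Finset ι)
    (x : ι → ∀ ω, K ω) (l : Fin m) : coord β (∑ i ∈ I, x i) l = ∑ i ∈ I, coord β (x i) l := by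
  funext ω
  simp [coord, Finset.sum_apply]

/-- A sign costs one operation. -/
theorem Computes.sign_coord {β : ∀ ω, Module.Basis (Fin m) (E ω) (K ω)} {x : ∀ ω, K ω} {l : Fin m}
    (h : coord β x l ∈ X) (n : ℕ) : Computes A X {coord β ((-1) ^ n * x) l} 1 := by
  rcases neg_one_pow_eq_or (∀ ω, K ω) n with hn | hn
  · rw [hn, one_mul]
    exact Computes.of_subset (Set.singleton_subset_iff.2 h) zero_le_one
  · have : coord β (-1 * x) l = - coord β x l := by
      funext ω
      simp [coord]
    rw [hn, this]
    exact Computes.neg h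

variable {α : ∀ ω, K ω} {β : ∀ ω, Module.Basis (Fin (s + 1)) (E ω) (K ω)}

/-- The minors of order `t + 1` from those of order `t`, by Laplace expansion along the first row.
All the products of an entry with a minor are obtained from one product of matrices over the base
field: the matrices of the multiplications by the entries of `R`, stacked, times the coordinate
columns of the minors. -/
theorem computes_compound_succ (hβ : ∀ ω i, β ω i = α ω ^ (i : ℕ)) {w A₀ : ℝ}
    (hf : FastMul E w A₀) {p q : ℕ}
    {R : Matrix (Fin p) (Fin q) (∀ ω, K ω)} (d a b e t : ℕ) (hd : 1 ≤ d)
    (ha : p * q * (s + 1) ≤ a * d) (hb : s + 1 ≤ b * d) (he : p.choose t * q.choose t ≤ e * d)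
    (hR : ∀ i j, ∀ l ≤ s, coords β (α ^ l * R i j) ⊆ X)
    (hC : matReps (coords β) (compound R t) ⊆ X) :
    Computes Set.univ X (matReps (coords β) (compound R (t + 1)))
      (a * b * e * ((A₀ + 1) * (d : ℝ) ^ w)
        + p.choose (t + 1) * (q.choose (t + 1) * ((s + 1 : ℕ) * (2 * (t + 1 : ℕ))))) := by
  set M : Matrix ((Fin p × Fin q) × Fin (s + 1)) (Fin (s + 1)) (∀ ω, E ω) :=
    Matrix.of fun x l => coord β (α ^ (l : ℕ) * R x.1.1 x.1.2) x.2 with hM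
  set N : Matrix (Fin (s + 1)) ((Fin t ↪o Fin p) × (Fin t ↪o Fin q)) (∀ ω, E ω) :=
    Matrix.of fun l x => coord β (compound R t x.1 x.2) l with hN
  have hMN : ∀ i j f g l, (M * N) ((i, j), l) (f, g) = coord β (compound R t f g * R i j) l := by
    intro i j f g l
    rw [coord_mul α β hβ, Matrix.mul_apply]
    exact Finset.sum_congr rfl fun _ _ => mul_comm _ _
  have h1 : Computes Set.univ X (entrySet (M * N)) (a * b * e * ((A₀ + 1) * (d : ℝ) ^ w)) := by
    refine hf.mul_le d a b e hd (by simpa using ha) (by simpa using hb)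
      (by simpa [card_orderEmb] using he) (entrySet_subset fun x l => ?_)
      (entrySet_subset fun l x => ?_) le_rfl
    · exact hR _ _ _ (Nat.lt_succ_iff.1 l.isLt) (coord_mem β _ _)
    · exact hC (rep_subset_matReps (rep := coords β) (compound R t) _ _ (coord_mem β _ _))
  refine h1.andThen ?_
  rw [← card_orderEmb, ← card_orderEmb]
  refine Computes.mat fun f g => Computes.coords fun l => ?_
  rw [compound_succ, coord_sum]
  have h2 := Computes.iUnion (A := Set.univ) (X := X ∪ entrySet (M * N))
    (fun j : Fin (t + 1) => Computes.sign_coord (l := l) (by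
      rw [← hMN]
      exact Or.inr (mem_entrySet _ _ _) :
      coord β (compound R t ((Fin.succOrderEmb t).trans f) ((Fin.succAboveOrderEmb j).trans g)
        * R (f 0) (g j)) l ∈ X ∪ entrySet (M * N)) (j : ℕ))
  refine (h2.andThen (Computes.sum Finset.univ fun j _ => ?_)).mono le_rfl le_rfl ?_
  · exact Or.inr (Set.mem_iUnion.2 ⟨j, rfl⟩)
  · simp
    linarith

/-- All the minors of order at most `T`, when each level costs at most `c`. -/
theorem computes_compound_of_le (hβ : ∀ ω i, β ω i = α ω ^ (i : ℕ)) {p q : ℕ}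
    {R : Matrix (Fin p) (Fin q) (∀ ω, K ω)} {c : ℝ} (T : ℕ) (hT : 1 ≤ T)
    (hR : matReps (coords β) R ⊆ X)
    (h : ∀ t, 1 ≤ t → t < T → ∀ Y ⊇ X, matReps (coords β) (compound R t) ⊆ Y →
      Computes Set.univ Y (matReps (coords β) (compound R (t + 1))) c) :
    Computes Set.univ X (⋃ t ∈ Finset.range (T + 1), matReps (coords β) (compound R t))
      ((s + 1 : ℕ) + (T - 1 : ℕ) * c) := by
  induction T, hT using Nat.le_induction with
  | base =>
    have h0 : Computes Set.univ X (coords β 1) ((s + 1 : ℕ) * 1) := by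
      refine Computes.coords fun i => ?_
      have h1 : ∀ ω, (1 : K ω) = β ω 0 := fun ω => by rw [hβ]; simp
      have h2 : coord β 1 i = if i = 0 then 1 else 0 := by
        funext ω
        simp only [coord, Pi.one_apply, h1, Module.Basis.repr_self, Finsupp.single_apply]
        by_cases hi : i = 0
        · rw [if_pos hi, if_pos hi.symm, Pi.one_apply]
        · rw [if_neg hi, if_neg (Ne.symm hi), Pi.zero_apply]
      rw [h2]
      split_ifs
      · exact Computes.one
      · exact Computes.zero.mono le_rfl le_rfl zero_le_one
    refine (h0.trans (Computes.of_subset le_rfl le_rfl)).mono le_rfl ?_ (by simp)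
    refine Set.iUnion₂_subset fun t ht => matReps_subset fun f g => ?_
    have : t = 0 ∨ t = 1 := by
      have := Finset.mem_range.1 ht
      omega
    rcases this with rfl | rfl
    · refine Set.subset_union_left.trans' (subset_of_eq ?_)
      simp [compound]
    · refine Set.subset_union_right.trans' (Set.subset_union_left.trans' (Set.Subset.trans ?_ hR))
      rw [compound, Matrix.of_apply, Matrix.det_fin_one]
      exact rep_subset_matReps (rep := coords β) R _ _
  | succ T hT ih =>
    have h1 := ih fun t ht htT => h t ht (by omega)
    have h2 := h T hT (by omega) (X ∪ ⋃ t ∈ Finset.range (T + 1), matReps (coords β) (compound R t))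
      Set.subset_union_left (Set.subset_union_right.trans' (by
        exact Set.subset_biUnion_of_mem (u := fun t => matReps (coords β) (compound R t))
          (by simp : T ∈ (Finset.range (T + 1) : Set ℕ))))
    refine (h1.trans h2).mono le_rfl ?_ ?_
    · refine Set.iUnion₂_subset fun t ht => ?_
      rcases Finset.mem_range_succ_iff.1 ht |>.lt_or_eq with ht | rfl
      · exact Set.subset_union_left.trans' (Set.subset_biUnion_of_mem
          (u := fun t => matReps (coords β) (compound R t))
          (by simpa using ht : t ∈ (Finset.range (T + 1) : Set ℕ)))
      · exact Set.subset_union_right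
    · have : ((T + 1 - 1 : ℕ) : ℝ) = (T - 1 : ℕ) + 1 := by
        have : T + 1 - 1 = (T - 1) + 1 := by omega
        rw [this]
        push_cast
        ring
      rw [this]
      linarith

/-- The matrices `MaxMin` of the instances. -/
noncomputable def maxMinVar {n k : ℕ} (r : ℕ) (β : ∀ ω, Module.Basis (Fin m) (E ω) (K ω))
    (R : Matrix (Fin (k + 1)) (Fin (n - k - 1)) (∀ ω, K ω)) :
    Matrix (Sub (n - k - 1) r × Fin m) (Sub n r) (∀ ω, E ω) :=
  Matrix.of fun Ji T ω => MaxMin r (β ω) (Matrix.of fun i j => R i j ω) Ji T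

/-- Once the minors of `R` are there, `MaxMin` only needs signs. -/
theorem computes_maxMinVar {n k r : ℕ} {β : ∀ ω, Module.Basis (Fin m) (E ω) (K ω)}
    {R : Matrix (Fin (k + 1)) (Fin (n - k - 1)) (∀ ω, K ω)}
    (h : ∀ t ≤ min r (k + 1), matReps (coords β) (compound R t) ⊆ X) :
    Computes Set.univ X (entrySet (maxMinVar r β R))
      ((n - k - 1).choose r * m * n.choose r : ℕ) := by
  have h0 : ∀ Ji T, Computes Set.univ X {maxMinVar r β R Ji T} 1 := by
    intro Ji T
    have hzero : Computes Set.univ X {(0 : ∀ ω, E ω)} 1 :=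
      Computes.zero.mono le_rfl le_rfl zero_le_one
    by_cases hT : tailPart k T.1 ⊆ Ji.1.1
    · by_cases hc : (Ji.1.1 \ tailPart k T.1).card = (headPart k T.1).card
      · have hx := (rep_subset_matReps (rep := coords β) _ _ _).trans
          (h (headPart k T.1).card (le_min ?_ ?_)) (coord_mem β (compound R (headPart k T.1).card
            ((headPart k T.1).orderEmbOfFin rfl)
            ((Ji.1.1 \ tailPart k T.1).orderEmbOfFin hc)) Ji.2)
        · refine (Computes.sign_coord (A := Set.univ) hx
            (signExp (tailPart k T.1) Ji.1.1)).singleton_congr fun ω _ => ?_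
          simp only [maxMinVar, MaxMin, Matrix.of_apply, if_pos hT, minor, dif_pos hc, coord]
          congr 2
          simp only [Pi.mul_apply, Pi.pow_apply, Pi.neg_apply, Pi.one_apply]
          congr 1
          exact RingHom.map_det (Pi.evalRingHom K ω) _
        · rw [← hc]
          exact (Finset.card_le_card Finset.sdiff_subset).trans_eq Ji.1.2
        · exact (Finset.card_le_univ _).trans_eq (Fintype.card_fin _)
      · refine hzero.singleton_congr fun ω _ => ?_
        simp [maxMinVar, MaxMin, minor, hc]
    · refine hzero.singleton_congr fun ω _ => ?_
      simp [maxMinVar, MaxMin, hT]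
  refine (Computes.mat h0).mono le_rfl le_rfl (le_of_eq ?_)
  simp

end Minors

/-! ### Binomial coefficients and the size of the problem -/

section Numbers

/-- Binomial coefficients increase towards the middle. -/
theorem choose_le_choose_of_add_le {n a b : ℕ} (h : a ≤ b) (hn : a + b ≤ n) :
    n.choose a ≤ n.choose b := by
  have h1 := Nat.choose_mul (n := n) h
  have h2 : b.choose a ≤ (n - a).choose (b - a) := by
    rw [← Nat.choose_symm h]
    exact Nat.choose_le_choose _ (by omega)
  have h3 : 0 < b.choose a := Nat.choose_pos h
  have h4 : n.choose a * b.choose a ≤ n.choose b * b.choose a := by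
    rw [h1]
    exact Nat.mul_le_mul_left _ h2
  exact Nat.le_of_mul_le_mul_right h4 h3

theorem le_choose {a t : ℕ} (h1 : 1 ≤ t) (h2 : t < a) : a ≤ a.choose t := by
  rcases Nat.lt_or_ge a (1 + t) with h | h
  · omega
  · simpa using choose_le_choose_of_add_le h1 h

theorem mul_choose_le {a t : ℕ} (h : t < a) :
    a * a.choose t ≤ (t + 1) ^ 2 * a.choose (t + 1) := by
  have h1 := Nat.choose_succ_right_eq a t
  obtain ⟨d, rfl⟩ : ∃ d, a = t + 1 + d := ⟨a - (t + 1), by omega⟩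
  have h2 : t + 1 + d - t = d + 1 := by omega
  rw [h2] at h1
  calc (t + 1 + d) * (t + 1 + d).choose t
      ≤ ((t + 1) * (d + 1)) * (t + 1 + d).choose t := Nat.mul_le_mul_right _ (by nlinarith)
    _ = (t + 1) ^ 2 * (t + 1 + d).choose (t + 1) := by
      rw [mul_assoc, mul_comm (d + 1), ← h1]
      ring

theorem choose_mul_choose_le {a b c : ℕ} (d : ℕ) :
    a.choose c * b.choose d ≤ (a + b).choose (c + d) := by
  rw [Nat.add_choose_eq]
  exact Finset.single_le_sum (f := fun ij : ℕ × ℕ => a.choose ij.1 * b.choose ij.2)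
    (fun _ _ => Nat.zero_le _) (by simp : (c, d) ∈ Finset.HasAntidiagonal.antidiagonal (c + d))

/-- The minors of order `t ≤ r` of a matrix with `h` rows and `l` columns are not more than the
entries of `MaxMin` over one basis element. -/
theorem card_minors_le {h l n r t : ℕ} (hn : h + l = n) (ht : t ≤ r) (hr : r ≤ l) :
    h.choose t * l.choose t ≤ l.choose r * n.choose r := by
  have h1 : l.choose t ≤ l.choose r * r.choose t := by
    rw [Nat.choose_mul ht]
    exact Nat.le_mul_of_pos_right _ (Nat.choose_pos (by omega))
  have h2 : h.choose t * r.choose (r - t) ≤ (h + r).choose (t + (r - t)) :=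
    choose_mul_choose_le _
  rw [Nat.choose_symm ht, Nat.add_sub_cancel' ht] at h2
  have h3 : (h + r).choose r ≤ n.choose r := Nat.choose_le_choose _ (by omega)
  calc h.choose t * l.choose t ≤ h.choose t * (l.choose r * r.choose t) :=
        Nat.mul_le_mul_left _ h1
    _ = l.choose r * (h.choose t * r.choose t) := by ring
    _ ≤ l.choose r * n.choose r := Nat.mul_le_mul_left _ (h2.trans h3)

/-- The pairs of an entry and a minor of order `t < r`. -/
theorem mul_card_minors_le {h l n r t : ℕ} (hn : h + l = n) (ht : t < r) (hr : r ≤ l) (hh : t < h) :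
    (h * l) * (h.choose t * l.choose t) ≤ (t + 1) ^ 4 * (l.choose r * n.choose r) := by
  have h1 := mul_choose_le hh
  have h2 := mul_choose_le (ht.trans_le hr)
  calc (h * l) * (h.choose t * l.choose t) = (h * h.choose t) * (l * l.choose t) := by ring
    _ ≤ ((t + 1) ^ 2 * h.choose (t + 1)) * ((t + 1) ^ 2 * l.choose (t + 1)) :=
      Nat.mul_le_mul h1 h2
    _ = (t + 1) ^ 4 * (h.choose (t + 1) * l.choose (t + 1)) := by ring
    _ ≤ _ := Nat.mul_le_mul_left _ (card_minors_le hn ht hr)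

theorem four_choose_two_ge {n : ℕ} (h : 2 ≤ n) : n * n ≤ 4 * n.choose 2 := by
  have h1 := Nat.choose_succ_right_eq n 1
  rw [Nat.choose_one_right] at h1
  obtain ⟨d, rfl⟩ : ∃ d, n = d + 2 := ⟨n - 2, by omega⟩
  have h2 : d + 2 - 1 = d + 1 := by omega
  rw [h2] at h1
  norm_num at h1
  nlinarith

theorem twelve_choose_three_ge {n : ℕ} (h : 6 ≤ n) : n * n * n ≤ 12 * n.choose 3 := by
  have h1 := Nat.choose_succ_right_eq n 1
  have h2 := Nat.choose_succ_right_eq n 2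
  rw [Nat.choose_one_right] at h1
  obtain ⟨d, rfl⟩ : ∃ d, n = d + 6 := ⟨n - 6, by omega⟩
  have h3 : d + 6 - 1 = d + 5 := by omega
  have h4 : d + 6 - 2 = d + 4 := by omega
  rw [h3] at h1
  rw [h4] at h2
  norm_num at h1 h2
  nlinarith

/-- The operations of the last phase are dominated by the number of columns of `MaxMin`
times the number of its rows. -/
theorem sq_mul_sub_max_le {h l n r : ℕ} (hn : h + l = n) (hr : 2 ≤ r) (hl : r ≤ l) (hh : 2 ≤ h) :
    n * n * (n - max r h) ≤ 12 * (min r h * (l.choose r * n.choose r)) := by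
  have hN2 : n * n ≤ 4 * n.choose r :=
    (four_choose_two_ge (by omega)).trans
      (Nat.mul_le_mul_left _ (choose_le_choose_of_add_le hr (by omega)))
  have hb : 1 ≤ l.choose r := Nat.choose_pos hl
  rcases le_or_gt r h with hrh | hrh
  · rw [max_eq_right hrh, min_eq_left hrh]
    have h1 : n - h = l := by omega
    have h2 : l ≤ r * l.choose r := by
      rcases hl.lt_or_eq with hlt | rfl
      · exact (le_choose (by omega) hlt).trans (Nat.le_mul_of_pos_left _ (by omega))
      · simp
    rw [h1]
    calc n * n * l ≤ 4 * n.choose r * (r * l.choose r) := Nat.mul_le_mul hN2 h2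
      _ ≤ 12 * n.choose r * (r * l.choose r) := by gcongr; norm_num
      _ = _ := by ring
  · rw [max_eq_left hrh.le, min_eq_right hrh.le]
    -- `n.choose r` is quadratic in `n` if `n - r = 2`, and otherwise it is at least cubic
    have h3 : n * n * (n - r) ≤ 12 * n.choose r := by
      rcases Nat.lt_or_ge (n - r) 3 with hq | hq
      · calc n * n * (n - r) ≤ 4 * n.choose r * 3 := Nat.mul_le_mul hN2 hq.le
          _ = _ := by ring
      · calc n * n * (n - r) ≤ n * n * n := Nat.mul_le_mul_left _ (Nat.sub_le _ _)
          _ ≤ 12 * n.choose 3 := twelve_choose_three_ge (by omega)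
          _ ≤ 12 * n.choose r :=
            Nat.mul_le_mul_left _ (choose_le_choose_of_add_le (by omega) (by omega))
    refine h3.trans (Nat.mul_le_mul_left _ ?_)
    calc n.choose r = 1 * (1 * n.choose r) := by ring
      _ ≤ h * (l.choose r * n.choose r) := by gcongr; omega

/-- For `u ≤ n / 2` the binomial coefficient is `n / u` times one which is at least `2 ^ (u - 1)`. -/
theorem two_pow_mul_le {n r u : ℕ} (hu : 1 ≤ u) (hur : u ≤ r) (hn : u + r ≤ n) :
    n * 2 ^ (u - 1) ≤ u * n.choose r := by
  obtain ⟨v, rfl⟩ : ∃ v, u = v + 1 := ⟨u - 1, by omega⟩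
  obtain ⟨l, rfl⟩ : ∃ l, n = l + 1 := ⟨n - 1, by omega⟩
  have h1 : (l + 1) * l.choose v = (l + 1).choose (v + 1) * (v + 1) :=
    Nat.add_one_mul_choose_eq l v
  have h2 : 2 ^ v ≤ l.choose v := by
    calc 2 ^ v ≤ v.centralBinom := by
          induction v with
          | zero => simp
          | succ v ih =>
            have h3 := Nat.succ_mul_centralBinom_succ v
            have h4 := ih (by omega) (by omega) (by omega) (by
              exact Nat.add_one_mul_choose_eq l v)
            rw [pow_succ]
            nlinarith
      _ = (2 * v).choose v := rfl
      _ ≤ l.choose v := Nat.choose_le_choose _ (by omega)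
  calc (l + 1) * 2 ^ (v + 1 - 1) ≤ (l + 1) * l.choose v := Nat.mul_le_mul_left _ h2
    _ = (v + 1) * (l + 1).choose (v + 1) := by rw [h1, mul_comm]
    _ ≤ (v + 1) * (l + 1).choose r :=
      Nat.mul_le_mul_left _ (choose_le_choose_of_add_le hur (by omega))

/-- Powers of the order of the minors are absorbed by the growth of the binomial coefficient. -/
theorem exists_growth_bound {δ : ℝ} (hδ : 0 < δ) :
    ∃ c : ℝ, 1 ≤ c ∧ ∀ n r u : ℕ, 1 ≤ u → u ≤ r → u + r ≤ n →
      (u : ℝ) ^ 5 * (n : ℝ) ^ δ ≤ c * (n.choose r : ℝ) ^ δ := by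
  set j := ⌈5 + δ⌉₊ with hj
  set a := δ * Real.log 2 with ha
  have ha0 : 0 < a := mul_pos hδ (Real.log_pos one_lt_two)
  set c := (j.factorial : ℝ) / a ^ j * (2 : ℝ) ^ δ with hc
  have hc0 : 0 ≤ c := by positivity
  refine ⟨c + 1, by linarith, fun n r u hu hur hn => ?_⟩
  have hu0 : (0 : ℝ) < u := by exact_mod_cast hu
  have hu1 : (1 : ℝ) ≤ u := by exact_mod_cast hu
  -- the power of `u` against the exponential
  have h1 : (u : ℝ) ^ 5 * (u : ℝ) ^ δ ≤ c * ((2 : ℝ) ^ (u - 1)) ^ δ := by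
    have e1 : (u : ℝ) ^ 5 * (u : ℝ) ^ δ ≤ (u : ℝ) ^ j := by
      rw [← Real.rpow_natCast, ← Real.rpow_natCast, ← Real.rpow_add hu0]
      refine Real.rpow_le_rpow_of_exponent_le hu1 ?_
      push_cast
      exact Nat.le_ceil _
    have e2 : (a * u) ^ j / (j.factorial : ℝ) ≤ Real.exp (a * u) :=
      Real.pow_div_factorial_le_exp _ (by positivity) _
    have e3 : Real.exp (a * u) = (2 : ℝ) ^ δ * ((2 : ℝ) ^ (u - 1)) ^ δ := by
      rw [← Real.mul_rpow (by norm_num) (by positivity), ← pow_succ', Nat.sub_add_cancel hu,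
        ← Real.rpow_natCast, ← Real.rpow_mul (by norm_num), Real.rpow_def_of_pos (by norm_num), ha]
      congr 1
      ring
    rw [e3, div_le_iff₀ (by positivity), mul_pow] at e2
    calc (u : ℝ) ^ 5 * (u : ℝ) ^ δ ≤ (u : ℝ) ^ j := e1
      _ = a ^ j * (u : ℝ) ^ j / a ^ j := by field_simp
      _ ≤ ((2 : ℝ) ^ δ * ((2 : ℝ) ^ (u - 1)) ^ δ * j.factorial) / a ^ j := by gcongr
      _ = c * ((2 : ℝ) ^ (u - 1)) ^ δ := by rw [hc]; ring
  have h2 : (n : ℝ) * 2 ^ (u - 1) ≤ u * n.choose r := by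
    exact_mod_cast two_pow_mul_le hu hur hn
  have h3 := Real.rpow_le_rpow (by positivity) h2 hδ.le
  rw [Real.mul_rpow (by positivity) (by positivity),
    Real.mul_rpow (by positivity) (by positivity)] at h3
  have h4 : (0 : ℝ) < ((2 : ℝ) ^ (u - 1)) ^ δ := by positivity
  have h5 : (0 : ℝ) ≤ (n.choose r : ℝ) ^ δ := by positivity
  refine le_of_mul_le_mul_right ?_ h4
  calc (u : ℝ) ^ 5 * (n : ℝ) ^ δ * ((2 : ℝ) ^ (u - 1)) ^ δ
      = (u : ℝ) ^ 5 * ((n : ℝ) ^ δ * ((2 : ℝ) ^ (u - 1)) ^ δ) := by ring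
    _ ≤ (u : ℝ) ^ 5 * ((u : ℝ) ^ δ * (n.choose r : ℝ) ^ δ) := by gcongr
    _ = ((u : ℝ) ^ 5 * (u : ℝ) ^ δ) * (n.choose r : ℝ) ^ δ := by ring
    _ ≤ (c * ((2 : ℝ) ^ (u - 1)) ^ δ) * (n.choose r : ℝ) ^ δ := by gcongr
    _ ≤ (c + 1) * (n.choose r : ℝ) ^ δ * ((2 : ℝ) ^ (u - 1)) ^ δ := by nlinarith [mul_nonneg h5 h4.le]

end Numbers

/-! ### The cost of the three phases -/

section Phases

set_option linter.unusedSectionVars false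

open Matrix

variable {Ω : Type*} {E : Ω → Type} [∀ ω, Field (E ω)] {K : Ω → Type} [∀ ω, Field (K ω)]
  [∀ ω, Algebra (E ω) (K ω)] {s n k r : ℕ} {X : Set (∀ ω, E ω)}
  {α : ∀ ω, K ω} {β : ∀ ω, Module.Basis (Fin (s + 1)) (E ω) (K ω)} {w A₀ c : ℝ}

/-- The number of blocks of size `n` that cover `x` rows. -/
theorem exists_blocks {n x : ℕ} (hn : 1 ≤ n) :
    ∃ a : ℕ, x ≤ a * n ∧ (a : ℝ) ≤ x / n + 1 := by
  refine ⟨x / n + 1, ?_, ?_⟩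
  · have h1 := Nat.div_add_mod x n
    have h2 := Nat.mod_lt x (by omega : n > 0)
    nlinarith
  · push_cast
    have := @Nat.cast_div_le ℝ _ _ _ x n
    linarith

/-- A level of the computation of the minors. -/
theorem computes_compound_succ_le (hβ : ∀ ω i, β ω i = α ω ^ (i : ℕ)) (hf : FastMul E w A₀)
    {R : Matrix (Fin (k + 1)) (Fin (n - k - 1)) (∀ ω, K ω)} {t : ℕ} (ht : 1 ≤ t) (htk : t < k + 1)
    (htr : t < r) (hrn : r ≤ n - k - 1)
    (hR : ∀ i j, ∀ l ≤ s, coords β (α ^ l * R i j) ⊆ X)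
    (hC : matReps (coords β) (compound R t) ⊆ X) :
    Computes Set.univ X (matReps (coords β) (compound R (t + 1)))
      ((4 * A₀ + 6) * ((min r (k + 1) : ℕ) : ℝ) ^ 4 * (n : ℝ) ^ (w - 2) *
        ((1 + (s + 1 : ℕ) / (n : ℝ)) *
          ((s + 1 : ℕ) * ((n - k - 1).choose r * n.choose r : ℕ)))) := by
  have hn : k + 1 + (n - k - 1) = n := by omega
  set l := n - k - 1 with hl
  set u := min r (k + 1) with hu
  have htu : t + 1 ≤ u := by omega
  set D := (k + 1).choose t * l.choose t with hD
  set P := (k + 1) * l with hP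
  set B := l.choose r * n.choose r with hB
  have hn1 : 1 ≤ n := by omega
  have hnP : n ≤ P := by rw [hP, ← hn]; nlinarith [(by omega : 2 ≤ l)]
  have hPD : P ≤ D := Nat.mul_le_mul (le_choose ht htk) (le_choose ht (by omega))
  have hD1 : P * D ≤ u ^ 4 * B :=
    (mul_card_minors_le hn htr hrn htk).trans (Nat.mul_le_mul_right _ (Nat.pow_le_pow_left htu 4))
  have hD2 : (k + 1).choose (t + 1) * l.choose (t + 1) ≤ B := card_minors_le hn htr hrn
  -- both `P` and `D` are at least `n`, so that rounding up the numbers of blocks costs a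
  -- factor two; only the inner dimension, the degree of the extension, may be smaller than `n`
  obtain ⟨a, ha, ha'⟩ := exists_blocks (x := P * (s + 1)) hn1
  obtain ⟨b, hb, hb'⟩ := exists_blocks (x := s + 1) hn1
  obtain ⟨e, he, he'⟩ := exists_blocks (x := D) hn1
  refine (computes_compound_succ hβ hf n a b e t hn1 ha hb he hR hC).mono le_rfl le_rfl ?_
  have hn0 : (0 : ℝ) < n := by exact_mod_cast hn1
  have hn1' : (1 : ℝ) ≤ n := by exact_mod_cast hn1
  set m : ℝ := ((s + 1 : ℕ) : ℝ) with hm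
  have hm1 : 1 ≤ m := by rw [hm]; exact_mod_cast Nat.succ_pos s
  have hnP' : (n : ℝ) ≤ P := by exact_mod_cast hnP
  have hnD' : (n : ℝ) ≤ D := by exact_mod_cast hnP.trans hPD
  have hD1' : (P : ℝ) * D ≤ (u : ℝ) ^ 4 * B := by exact_mod_cast hD1
  have hD2' : ((k + 1).choose (t + 1) : ℝ) * l.choose (t + 1) ≤ B := by exact_mod_cast hD2
  have ha2 : (a : ℝ) ≤ 2 * (P * m / n) := by
    have : (1 : ℝ) ≤ P * m / n := by
      rw [le_div_iff₀ hn0]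
      nlinarith
    refine ha'.trans ?_
    rw [Nat.cast_mul]
    linarith
  have he2 : (e : ℝ) ≤ 2 * (D / n) := by
    have : (1 : ℝ) ≤ D / n := by
      rw [le_div_iff₀ hn0]
      linarith
    linarith
  have hb2 : (b : ℝ) ≤ 1 + m / n := by linarith
  have hw : (n : ℝ) ^ w = (n : ℝ) ^ (w - 2) * (n : ℝ) ^ 2 := by
    rw [← Real.rpow_natCast, ← Real.rpow_add hn0]
    congr 1
    push_cast
    ring
  have hA := hf.nonneg
  set δ : ℝ := (n : ℝ) ^ (w - 2) with hδ
  have hδ1 : 1 ≤ δ := Real.one_le_rpow hn1' (by have := hf.exponent; linarith)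
  set G : ℝ := 1 + m / n with hG
  have hG1 : 1 ≤ G := by
    have : 0 ≤ m / n := by positivity
    linarith
  have h1 : (a * b * e : ℝ) * ((A₀ + 1) * (n : ℝ) ^ w)
      ≤ 4 * (A₀ + 1) * (u : ℝ) ^ 4 * δ * (G * (m * B)) := by
    calc (a * b * e : ℝ) * ((A₀ + 1) * (n : ℝ) ^ w)
        ≤ ((2 * (P * m / n)) * G * (2 * (D / n))) * ((A₀ + 1) * (n : ℝ) ^ w) := by gcongr
      _ = 4 * (A₀ + 1) * (P * D) * δ * (G * m) := by
        rw [hw]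
        field_simp
        ring
      _ ≤ 4 * (A₀ + 1) * ((u : ℝ) ^ 4 * B) * δ * (G * m) := by gcongr
      _ = _ := by ring
  have hu1 : (1 : ℝ) ≤ u := by exact_mod_cast (by omega : 1 ≤ u)
  have h2 : ((k + 1).choose (t + 1) : ℝ) * (l.choose (t + 1) * (m * (2 * (t + 1 : ℕ))))
      ≤ 2 * (u : ℝ) ^ 4 * δ * (G * (m * B)) := by
    have h3 : ((t + 1 : ℕ) : ℝ) ≤ (u : ℝ) ^ 4 := by
      have h4 : ((t + 1 : ℕ) : ℝ) ≤ u := by exact_mod_cast htu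
      exact h4.trans (le_self_pow₀ hu1 (by norm_num))
    calc ((k + 1).choose (t + 1) : ℝ) * (l.choose (t + 1) * (m * (2 * (t + 1 : ℕ))))
        = 2 * (t + 1 : ℕ) * (1 * (m * ((k + 1).choose (t + 1) * l.choose (t + 1)))) := by ring
      _ ≤ 2 * (u : ℝ) ^ 4 * (G * (m * B)) := by gcongr
      _ ≤ 2 * (u : ℝ) ^ 4 * δ * (G * (m * B)) := by
        have : 0 ≤ 2 * (u : ℝ) ^ 4 := by positivity
        exact mul_le_mul_of_nonneg_right (le_mul_of_one_le_right this hδ1) (by positivity)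
  calc _ ≤ _ := add_le_add h1 h2
    _ = _ := by ring

/-- The construction of `MaxMin`. -/
theorem computes_build (hβ : ∀ ω i, β ω i = α ω ^ (i : ℕ)) (hf : FastMul E w A₀)
    (hgrowth : ∀ n r u : ℕ, 1 ≤ u → u ≤ r → u + r ≤ n →
      (u : ℝ) ^ 5 * (n : ℝ) ^ (w - 2) ≤ c * (n.choose r : ℝ) ^ (w - 2))
    (hr : 1 ≤ r) (hrn : r ≤ n - k - 1)
    {R : Matrix (Fin (k + 1)) (Fin (n - k - 1)) (∀ ω, K ω)}
    (hα : coords β (α ^ (s + 1)) ⊆ X) (hR : matReps (coords β) R ⊆ X) :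
    Computes Set.univ X (entrySet (maxMinVar r β R))
      (((4 * A₀ + 6) * c + 34) * ((1 + (s + 1 : ℕ) / (n : ℝ)) *
        ((s + 1 : ℕ) * (n - k - 1).choose r * (n.choose r : ℝ) ^ (w - 1)))) := by
  have hn : k + 1 + (n - k - 1) = n := by omega
  set u := min r (k + 1) with hu
  set G : ℝ := 1 + (s + 1 : ℕ) / (n : ℝ) with hG
  have hn0 : (0 : ℝ) < n := by exact_mod_cast (by omega : 0 < n)
  set m : ℝ := ((s + 1 : ℕ) : ℝ) with hm
  have hm1 : 1 ≤ m := by rw [hm]; exact_mod_cast Nat.succ_pos s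
  have hGm : 0 ≤ m / n := by positivity
  have hG1 : 1 ≤ G := by linarith
  have hb : (1 : ℝ) ≤ (n - k - 1).choose r := by exact_mod_cast Nat.choose_pos hrn
  have hN : (1 : ℝ) ≤ n.choose r := by exact_mod_cast Nat.choose_pos (by omega : r ≤ n)
  have hδ := hf.exponent
  have hA := hf.nonneg
  have hN2 : (n.choose r : ℝ) ^ (w - 1) = (n.choose r : ℝ) ^ (w - 2) * n.choose r := by
    rw [← Real.rpow_add_one (by linarith)]
    congr 1
    ring
  have hNδ : 1 ≤ (n.choose r : ℝ) ^ (w - 2) := Real.one_le_rpow hN (by linarith)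
  rw [hN2]
  set δ := (n.choose r : ℝ) ^ (w - 2) with hδdef
  -- the entries of `MaxMin` over one basis element
  set B : ℝ := (((n - k - 1).choose r * n.choose r : ℕ) : ℝ) with hB
  have hB1 : 1 ≤ B := by rw [hB, Nat.cast_mul]; nlinarith
  have hT : (m * (n - k - 1).choose r * (δ * n.choose r) : ℝ) = δ * (m * B) := by
    rw [hB, Nat.cast_mul]
    ring
  rw [hT]
  have hfin : (((n - k - 1).choose r * (s + 1) * n.choose r : ℕ) : ℝ) = m * B := by
    rw [hB, hm]
    push_cast
    ring
  -- the powers of the generator times the entries of `R`, needed for minors of order two and more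
  obtain ⟨Z, p, hp, hZ, hZR⟩ : ∃ (Z : Set (∀ ω, E ω)) (p : ℝ), p ≤ 32 * ((m / n) * (m * B)) ∧
      Computes Set.univ X Z p ∧
      (2 ≤ u → ∀ i j, ∀ l ≤ s, coords β (α ^ l * R i j) ⊆ Z) := by
    by_cases h2 : 2 ≤ u
    · have h3 := Computes.iUnion (A := Set.univ) (X := X) fun x : Fin (k + 1) × Fin (n - k - 1) =>
        computes_generator_pow_mul (A := Set.univ) α β hβ hα
          ((rep_subset_matReps (rep := coords β) R x.1 x.2).trans hR) s
      refine ⟨_, _, ?_, h3, ?_⟩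
      · have h4 := mul_card_minors_le (t := 1) hn (by omega) hrn (by omega)
        rw [Nat.choose_one_right, Nat.choose_one_right] at h4
        have h5 : n ≤ (k + 1) * (n - k - 1) := by nlinarith [(by omega : 1 ≤ k), (by omega : 2 ≤ n - k - 1)]
        have h6 : ((k + 1) * (n - k - 1)) * n ≤ 16 * ((n - k - 1).choose r * n.choose r) :=
          (Nat.mul_le_mul_left _ h5).trans h4
        have h7 : (((k + 1) * (n - k - 1) : ℕ) : ℝ) * n ≤ 16 * B := by
          rw [hB]
          exact_mod_cast h6
        have hs : (s : ℝ) ≤ m := by rw [hm]; push_cast; linarith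
        rw [Fintype.card_prod, Fintype.card_fin, Fintype.card_fin]
        calc (((k + 1) * (n - k - 1) : ℕ) : ℝ) * (s * (m * 2)) ≤ (((k + 1) * (n - k - 1) : ℕ) : ℝ) * (m * (m * 2)) := by
              gcongr
          _ = ((((k + 1) * (n - k - 1) : ℕ) : ℝ) * n) * (2 * (m * m) / n) := by field_simp
          _ ≤ (16 * B) * (2 * (m * m) / n) := by gcongr
          _ = _ := by ring
      · intro _ i j t ht
        refine Set.Subset.trans ?_ (Set.subset_iUnion _ (i, j))
        exact Set.subset_biUnion_of_mem (u := fun t => coords β (α ^ t * R i j))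
          (by simpa using Nat.lt_succ_iff.2 ht : t ∈ (Finset.range (s + 1) : Set ℕ))
    · exact ⟨∅, 0, by positivity, Computes.of_subset (Set.empty_subset _) le_rfl,
        fun h => absurd h h2⟩
  set q : ℝ := (4 * A₀ + 6) * (u : ℝ) ^ 4 * (n : ℝ) ^ (w - 2) * (G * (m * B)) with hq
  have h1 := computes_compound_of_le (X := X ∪ Z) hβ (R := R) (c := q) u (by omega)
    (hR.trans Set.subset_union_left) (fun t ht htu Y hY hC =>
      computes_compound_succ_le hβ hf ht (by omega) (by omega) hrn
        (fun i j a ha => (hZR (by omega) i j a ha).trans (Set.subset_union_right.trans hY)) hC)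
  have h2 := computes_maxMinVar (n := n) (r := r) (R := R)
    (X := X ∪ Z ∪ ⋃ t ∈ Finset.range (u + 1), matReps (coords β) (compound R t)) (fun t ht =>
      Set.subset_union_right.trans' (by
        exact Set.subset_biUnion_of_mem (u := fun t => matReps (coords β) (compound R t))
          (Finset.mem_coe.2 (Finset.mem_range.2 (Nat.lt_succ_iff.2 ht)))))
  refine ((hZ.andThen (h1.andThen h2))).mono le_rfl le_rfl ?_
  rw [hfin]
  have hmB : 1 ≤ m * B := by nlinarith
  have hlev : ((u - 1 : ℕ) : ℝ) * q ≤ (4 * A₀ + 6) * c * (G * (δ * (m * B))) := by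
    have hg := hgrowth n r u (by omega) (by omega) (by omega)
    have hu1 : ((u - 1 : ℕ) : ℝ) ≤ u := by exact_mod_cast Nat.sub_le _ _
    calc ((u - 1 : ℕ) : ℝ) * q ≤ u * q := by
          refine mul_le_mul_of_nonneg_right hu1 ?_
          positivity
      _ = (4 * A₀ + 6) * ((u : ℝ) ^ 5 * (n : ℝ) ^ (w - 2)) * (G * (m * B)) := by rw [hq]; ring
      _ ≤ (4 * A₀ + 6) * (c * δ) * (G * (m * B)) := by gcongr
      _ = _ := by ring
  have h5 : m * B ≤ G * (δ * (m * B)) := by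
    have : m * B ≤ δ * (m * B) := le_mul_of_one_le_left (by linarith) hNδ
    exact this.trans (le_mul_of_one_le_left (by linarith) hG1)
  have h6 : m ≤ m * B := le_mul_of_one_le_right (by linarith) hB1
  have h7 : (m / n) * (m * B) ≤ G * (δ * (m * B)) := by
    have h8 : m / n ≤ G := by linarith
    have h9 : m * B ≤ δ * (m * B) := le_mul_of_one_le_left (by linarith) hNδ
    exact mul_le_mul h8 h9 (by linarith) (by linarith)
  linarith

end Phases

section LastPhases

set_option linter.unusedSectionVars false

open Matrix

variable {Ω : Type*} {E : Ω → Type} [∀ ω, Field (E ω)] {L : Ω → Type} [∀ ω, Field (L ω)]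
  {n : ℕ} {X X₀ : Set (∀ ω, E ω)} {rep : (∀ ω, L ω) → Set (∀ ω, E ω)} {c : ℝ}

/-- A vector in the row spaces of two systematic matrices `(I P')` and `(I Q')`, found from the
coefficients of its expansion in the rows of the first matrix, when the intersection of the row
spaces is spanned by this vector on each instance. -/
theorem FieldModel.systematic_intersection (hm : FieldModel X₀ rep c) (h0 : X₀ ⊆ X) {u v : ℕ}
    (hu : 1 ≤ u) (huv : u ≤ v) (hv : v < n) {P : Matrix (Fin u) (Fin n) (∀ ω, L ω)}
    {Q : Matrix (Fin v) (Fin n) (∀ ω, L ω)} (hP : IsSystematic P) (hQ : IsSystematic Q)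
    (hPX : matReps rep P ⊆ X) (hQX : matReps rep Q ⊆ X) {e : Fin n → ∀ ω, L ω}
    (heP : headVec (huv.trans hv.le) e ᵥ* P = e) (heQ : headVec hv.le e ᵥ* Q = e)
    (he : e ⟨0, by omega⟩ = 1)
    (huniq : ∀ x : Fin n → ∀ ω, L ω, headVec (huv.trans hv.le) x ᵥ* P = x →
      headVec hv.le x ᵥ* Q = x → ∀ j, x j = e j * x ⟨0, by omega⟩) :
    Computes Set.univ X (vecReps rep e) (27 * ((u : ℝ) ^ 2 * n * (n - v : ℕ)) * c) := by
  have hun := huv.trans hv.le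
  have hc := hm.nonneg
  -- the equations say that the coordinates from `v` on are determined by the first `v` ones
  set B : Matrix (Fin (n - v)) (Fin u) (∀ ω, L ω) := Matrix.of fun j l =>
    P l ⟨v + j, by omega⟩ - ∑ i : Fin v, P l ⟨i, by omega⟩ * Q i ⟨v + j, by omega⟩ with hB
  have hBx : ∀ (x : Fin u → ∀ ω, L ω) (j : Fin (n - v)), (B *ᵥ x) j = (x ᵥ* P) ⟨v + j, by omega⟩
      - (headVec hv.le (x ᵥ* P) ᵥ* Q) ⟨v + j, by omega⟩ := by
    intro x j
    simp only [hB, Matrix.mulVec, Matrix.vecMul, _root_.dotProduct, Matrix.of_apply, headVec,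
      _root_.sub_mul, Finset.sum_sub_distrib, Finset.sum_mul]
    congr 1
    · exact Finset.sum_congr rfl fun _ _ => mul_comm _ _
    · rw [Finset.sum_comm]
      exact Finset.sum_congr rfl fun _ _ => Finset.sum_congr rfl fun _ _ => by ring
  have hker : ∀ x : Fin u → ∀ ω, L ω, B *ᵥ x = 0 → headVec hv.le (x ᵥ* P) ᵥ* Q = x ᵥ* P := by
    intro x hx
    funext j
    rcases Nat.lt_or_ge j.val v with hj | hj
    · exact hQ.vecMul_apply hv.le _ ⟨j, hj⟩
    · have h1 := hBx x ⟨j - v, by omega⟩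
      rw [hx, Pi.zero_apply] at h1
      have h2 : (⟨v + (j - v), by omega⟩ : Fin n) = j := Fin.ext (by simp; omega)
      simp only [h2] at h1
      exact (sub_eq_zero.1 h1.symm).symm
  have hhead : ∀ x : Fin u → ∀ ω, L ω, headVec hun (x ᵥ* P) = x := fun x =>
    funext fun i => hP.vecMul_apply hun x i
  have hBe : B *ᵥ headVec hun e = 0 := by
    funext j
    rw [hBx, heP, heQ, sub_self]
    rfl
  have : Nonempty (Fin u) := ⟨⟨0, hu⟩⟩
  have h1 : Computes Set.univ X (matReps rep B)
      (Fintype.card (Fin (n - v)) * (Fintype.card (Fin u) * ((2 * v + 1) * c + c))) := by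
    refine Computes.mat fun j l => ?_
    have s1 := hm.sum_mul h0 (x := fun i : Fin v => P l ⟨i, by omega⟩)
      (y := fun i : Fin v => Q i ⟨v + j, by omega⟩) Finset.univ
      (fun i _ => (rep_subset_matReps P _ _).trans hPX)
      (fun i _ => (rep_subset_matReps Q _ _).trans hQX)
    rw [Finset.card_univ, Fintype.card_fin] at s1
    exact s1.andThen (hm.sub (h0.trans Set.subset_union_left)
      ((rep_subset_matReps P _ _).trans (hPX.trans Set.subset_union_left))
      Set.subset_union_right)
  obtain ⟨M, hM, hMv, h2⟩ := hm.exists_kernelProjector (X := X ∪ matReps rep B)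
    (h0.trans Set.subset_union_left) (M := B) Set.subset_union_right
  have h3 := hm.normalize (X := X ∪ matReps rep B ∪ matReps rep M) (K := M) (v := headVec hun e)
    (i₀ := ⟨0, hu⟩) (h0.trans (Set.subset_union_left.trans Set.subset_union_left))
    Set.subset_union_right (fun j l => by
      have h4 := huniq ((fun i => M i l) ᵥ* P) (by rw [hhead]) (hker _ (by
        funext a
        exact congrFun (congrFun hM a) l)) ⟨j, by omega⟩
      have h5 : ∀ i : Fin u, ((fun i => M i l) ᵥ* P) ⟨i, by omega⟩ = M i l := fun i =>
        congrFun (hhead _) i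
      rw [h5 j, h5 ⟨0, hu⟩] at h4
      exact h4) (hMv _ hBe) he
  have h4 := hm.vecMul (X := X ∪ matReps rep B ∪ matReps rep M ∪ vecReps rep (headVec hun e))
    (M := P) (x := headVec hun e)
    (h0.trans (Set.subset_union_left.trans (Set.subset_union_left.trans Set.subset_union_left)))
    (hPX.trans (Set.subset_union_left.trans (Set.subset_union_left.trans Set.subset_union_left)))
    Set.subset_union_right
  rw [heP] at h4
  refine (h1.andThen (h2.andThen (h3.andThen h4))).mono le_rfl le_rfl ?_
  simp only [Fintype.card_fin]
  have hu' : (1 : ℝ) ≤ u := by exact_mod_cast hu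
  have hvn : ((v : ℝ)) + 1 ≤ n := by exact_mod_cast hv
  have huv' : (u : ℝ) ≤ v := by exact_mod_cast huv
  have hd : (1 : ℝ) ≤ (n - v : ℕ) := by exact_mod_cast (by omega : 1 ≤ n - v)
  generalize ((n - v : ℕ) : ℝ) = d at hd ⊢
  have hun2 : (u : ℝ) ≤ u ^ 2 := by nlinarith
  have e1 : d * (u * ((2 * v + 1) * c + c)) ≤ 2 * (u ^ 2 * n * d) * c := by
    calc d * (u * ((2 * v + 1) * c + c)) = 2 * (u * (v + 1) * d) * c := by ring
      _ ≤ 2 * (u ^ 2 * n * d) * c := by gcongr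
  have e2 : (13 * d + 1) * (u : ℝ) ^ 2 * c ≤ 14 * (u ^ 2 * n * d) * c := by
    have : (13 * d + 1) * (u : ℝ) ^ 2 ≤ (14 * d) * (u ^ 2 * n) := by
      have : (1 : ℝ) ≤ n := by linarith
      gcongr ?_ * ?_
      · linarith
      · exact le_mul_of_one_le_right (by positivity) this
    calc (13 * d + 1) * (u : ℝ) ^ 2 * c ≤ (14 * d) * (u ^ 2 * n) * c := by gcongr
      _ = _ := by ring
  have e3 : (4 * (u : ℝ) + 1) * c + u * ((2 * u + 1) * c) ≤ 8 * (u ^ 2 * n * d) * c := by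
    have h8 : (u : ℝ) ^ 2 * 1 * 1 ≤ u ^ 2 * n * d := by
      gcongr
      linarith
    calc (4 * (u : ℝ) + 1) * c + u * ((2 * u + 1) * c) = (2 * u ^ 2 + 5 * u + 1) * c := by ring
      _ ≤ (8 * (u ^ 2 * n * d)) * c := by
        gcongr
        nlinarith
  have e4 : (n : ℝ) * ((2 * u + 1) * c) ≤ 3 * (u ^ 2 * n * d) * c := by
    calc (n : ℝ) * ((2 * u + 1) * c) = ((2 * u + 1) * n * 1) * c := by ring
      _ ≤ ((3 * u ^ 2) * n * d) * c := by
        gcongr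
        nlinarith
      _ = _ := by ring
  linarith

variable {K : Ω → Type} [∀ ω, Field (K ω)] [∀ ω, Algebra (E ω) (K ω)] {s k r : ℕ}
  {α : ∀ ω, K ω} {β : ∀ ω, Module.Basis (Fin (s + 1)) (E ω) (K ω)} {w A₀ : ℝ}

/-- The kernel vector of `MaxMin` and the matrix `C`. -/
theorem computes_solve (hf : FastMul E w A₀) (hr : 1 ≤ r) (hrn : r ≤ n - k - 1)
    (hover : n.choose r ≤ (s + 1) * (n - k - 1).choose r + 1)
    {M : Matrix (Sub (n - k - 1) r × Fin (s + 1)) (Sub n r) (∀ ω, E ω)} (hM : entrySet M ⊆ X)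
    {v : Sub n r → ∀ ω, E ω} (T₀ : Sub n r) (hv : M *ᵥ v = 0) (hv0 : v T₀ = 1)
    (huniq : ∀ u, M *ᵥ u = 0 → ∀ T, u T = v T * u T₀)
    {C : Matrix (Fin r) (Fin n) (∀ ω, E ω)} (hC : IsSystematic C)
    (hCv : ∀ (i : Fin r) (j : Fin n), r ≤ j.val → ∃ T, C i j = (-1) ^ (r + (i.val + 1)) * v T) :
    Computes Set.univ X (Set.range v ∪ entrySet C)
      ((3 * (FastMul.blockConst w A₀ + 18) + 2) *
        ((s + 1 : ℕ) * (n - k - 1).choose r * (n.choose r : ℝ) ^ (w - 1))) := by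
  set N := n.choose r with hN
  set b := (n - k - 1).choose r with hb
  have hN2 : 2 ≤ N := by
    have h1 : n ≤ N := le_choose hr (by omega)
    omega
  have hN1 : (1 : ℝ) ≤ N := by exact_mod_cast (by omega : 1 ≤ N)
  have hN0 : (0 : ℝ) < N := by linarith
  -- blocks with as many rows as there are columns
  obtain ⟨q, hq, hq'⟩ := exists_blocks (n := N) (x := (s + 1) * b) (by omega)
  have hmb : 1 ≤ (s + 1) * b := by omega
  have hq1 : 1 ≤ q := by
    rcases Nat.eq_zero_or_pos q with rfl | h
    · omega
    · exact h
  have h1 := hf.kernelVector hM q hq1 (by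
    rw [Fintype.card_prod, card_sub, card_sub, Fintype.card_fin, mul_comm]
    exact hq) hv hv0 huniq
  have h2 := Computes.iUnion (A := Set.univ) (X := X ∪ Set.range v) (fun T : Sub n r =>
    Computes.neg (Or.inr ⟨T, rfl⟩ : v T ∈ X ∪ Set.range v))
  have h3 : Computes Set.univ (X ∪ Set.range v ∪ ⋃ T, {-v T}) ({1} ∪ {0}) (1 + 0) :=
    Computes.one.union Computes.zero
  refine (h1.trans (h2.trans h3)).mono le_rfl ?_ ?_
  · refine Set.union_subset Set.subset_union_left (entrySet_subset fun i j => ?_)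
    rcases Nat.lt_or_ge j.val r with hj | hj
    · right
      right
      rw [hC i j hj]
      split_ifs
      · exact Or.inl rfl
      · exact Or.inr rfl
    · obtain ⟨T, hT⟩ := hCv i j hj
      rw [hT]
      rcases neg_one_pow_eq_or (∀ ω, E ω) (r + (i.val + 1)) with h | h
      · rw [h, one_mul]
        exact Or.inl ⟨T, rfl⟩
      · rw [h, neg_one_mul]
        exact Or.inr (Or.inl (Set.mem_iUnion.2 ⟨T, rfl⟩))
  · have hw := hf.exponent
    have hB := FastMul.blockConst_nonneg hw hf.nonneg
    rw [card_sub, ← hN]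
    have hmb' : (1 : ℝ) ≤ (s + 1 : ℕ) * b := by exact_mod_cast hmb
    have hq3 : (q : ℝ) * N ≤ 3 * ((s + 1 : ℕ) * b) := by
      have h4 : (q : ℝ) * N ≤ (((s + 1) * b : ℕ) / (N : ℝ) + 1) * N := by gcongr
      have h5 : (((s + 1) * b : ℕ) / (N : ℝ) + 1) * N = ((s + 1 : ℕ) * b : ℝ) + N := by
        rw [add_mul, div_mul_cancel₀ _ hN0.ne', one_mul, Nat.cast_mul]
      have h6 : (N : ℝ) ≤ (s + 1 : ℕ) * b + 1 := by exact_mod_cast hover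
      linarith
    have hNw : (N : ℝ) ^ w = N * (N : ℝ) ^ (w - 1) := by
      rw [Real.rpow_sub_one hN0.ne']
      field_simp
    have hN3 : (N : ℝ) ≤ (N : ℝ) ^ (w - 1) := by
      nth_rewrite 1 [← Real.rpow_one (N : ℝ)]
      exact Real.rpow_le_rpow_of_exponent_le hN1 (by linarith)
    generalize (N : ℝ) ^ (w - 1) = y at hNw hN3 ⊢
    generalize ((s + 1 : ℕ) : ℝ) = m at hmb' hq3 ⊢
    have h7 : (FastMul.blockConst w A₀ + 18) * (q * (N : ℝ) ^ w)
        ≤ 3 * (FastMul.blockConst w A₀ + 18) * (m * b * y) := by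
      calc (FastMul.blockConst w A₀ + 18) * (q * (N : ℝ) ^ w)
          = (FastMul.blockConst w A₀ + 18) * ((q * N) * y) := by rw [hNw]; ring
        _ ≤ (FastMul.blockConst w A₀ + 18) * ((3 * (m * b)) * y) := by
          have : 0 ≤ y := by linarith
          gcongr
        _ = _ := by ring
    have h8 : y ≤ m * b * y := le_mul_of_one_le_left (by linarith) hmb'
    linarith

/-- The vectors `S` and `S C`: the second one is the common vector of the row spaces of `C` and
`(I R)`, normalized, and the first one consists of its first coordinates. -/
theorem computes_finish (hβ : ∀ ω i, β ω i = α ω ^ (i : ℕ)) (hw : 2 < w)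
    (hc : 1 ≤ c) (hgrowth : ∀ n r u : ℕ, 1 ≤ u → u ≤ r → u + r ≤ n →
      (u : ℝ) ^ 5 * (n : ℝ) ^ (w - 2) ≤ c * (n.choose r : ℝ) ^ (w - 2))
    (hr : 1 ≤ r) (hrn : r ≤ n - k - 1) (hn1 : 0 < n) {C : Matrix (Fin r) (Fin n) (∀ ω, K ω)}
    {R : Matrix (Fin (k + 1)) (Fin n) (∀ ω, K ω)}
    (hC : IsSystematic C) (hR : IsSystematic R)
    (hα : coords β (α ^ (s + 1)) ⊆ X) (hCX : matReps (coords β) C ⊆ X)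
    (hRX : matReps (coords β) R ⊆ X) {e : Fin n → ∀ ω, K ω}
    (heC : headVec (by omega) e ᵥ* C = e) (heR : headVec (by omega) e ᵥ* R = e)
    (he : e ⟨0, hn1⟩ = 1)
    (huniq : ∀ x : Fin n → ∀ ω, K ω, headVec (by omega) x ᵥ* C = x →
      headVec (by omega) x ᵥ* R = x → ∀ j, x j = e j * x ⟨0, hn1⟩) :
    Computes Set.univ X (vecReps (coords β) e)
      (12960 * c * ((1 + (s + 1 : ℕ) / (n : ℝ)) *
        ((s + 1 : ℕ) * (n - k - 1).choose r * (n.choose r : ℝ) ^ (w - 1)))) := by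
  have hn : k + 1 + (n - k - 1) = n := by omega
  have hn0 : (0 : ℝ) < n := by exact_mod_cast (by omega : 0 < n)
  have hm := fieldModel_ext α β hβ
  set m : ℝ := ((s + 1 : ℕ) : ℝ) with hmdef
  have hm0 : 0 ≤ m := Nat.cast_nonneg _
  set N := n.choose r with hN
  set b := (n - k - 1).choose r with hb
  have hN1 : (1 : ℝ) ≤ N := by exact_mod_cast Nat.choose_pos (by omega : r ≤ n)
  have hN2 : (N : ℝ) ^ (w - 1) = (N : ℝ) ^ (w - 2) * N := by
    rw [← Real.rpow_add_one (by linarith)]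
    congr 1
    ring
  have hbound : 0 ≤ 12960 * c * ((1 + m / n) * (m * b * (N : ℝ) ^ (w - 1))) := by positivity
  have hcost : 2 ≤ min r (k + 1) → 27 * (((min r (k + 1) : ℕ) : ℝ) ^ 2 * n
      * (n - max r (k + 1) : ℕ)) * (40 * m ^ 2)
      ≤ 12960 * c * ((1 + m / n) * (m * b * (N : ℝ) ^ (w - 1))) := by
    intro h2
    have h3 := sq_mul_sub_max_le hn (by omega) hrn (by omega)
    set u := min r (k + 1) with hu
    have h4 : (n : ℝ) * n * (n - max r (k + 1) : ℕ) ≤ 12 * (u * (b * N)) := by exact_mod_cast h3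
    have h5 := hgrowth n r u (by omega) (by omega) (by omega)
    have hu1 : (1 : ℝ) ≤ u := by exact_mod_cast (by omega : 1 ≤ u)
    have h6 : (u : ℝ) ^ 3 ≤ c * (N : ℝ) ^ (w - 2) := by
      have h7 : (1 : ℝ) ≤ (n : ℝ) ^ (w - 2) :=
        Real.one_le_rpow (by exact_mod_cast (by omega : 1 ≤ n)) (by linarith)
      refine (pow_le_pow_right₀ hu1 (by norm_num : 3 ≤ 5)).trans (le_trans ?_ h5)
      exact le_mul_of_one_le_right (by positivity) h7
    generalize ((n - max r (k + 1) : ℕ) : ℝ) = d at h4 ⊢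
    calc 27 * ((u : ℝ) ^ 2 * n * d) * (40 * m ^ 2)
        = 1080 * (m * (m / n)) * u ^ 2 * (n * n * d) := by field_simp; ring
      _ ≤ 1080 * (m * (m / n)) * u ^ 2 * (12 * (u * (b * N))) := by gcongr
      _ = 12960 * ((m / n) * (m * b * N)) * u ^ 3 := by ring
      _ ≤ 12960 * ((1 + m / n) * (m * b * N)) * (c * (N : ℝ) ^ (w - 2)) := by
        gcongr
        linarith
      _ = _ := by rw [hN2]; ring
  -- the rows of the matrix with fewer rows are used to expand the common vector
  have key : ∀ {u v : ℕ} (hu : u = min r (k + 1)) (hv : v = max r (k + 1))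
      {P : Matrix (Fin u) (Fin n) (∀ ω, K ω)} {Q : Matrix (Fin v) (Fin n) (∀ ω, K ω)},
      IsSystematic P → IsSystematic Q → matReps (coords β) P ⊆ X → matReps (coords β) Q ⊆ X →
      headVec (by omega) e ᵥ* P = e → headVec (by omega) e ᵥ* Q = e →
      (∀ x : Fin n → ∀ ω, K ω, headVec (by omega) x ᵥ* P = x →
        headVec (by omega) x ᵥ* Q = x → ∀ j, x j = e j * x ⟨0, hn1⟩) →
      Computes Set.univ X (vecReps (coords β) e)
        (12960 * c * ((1 + m / n) * (m * b * (N : ℝ) ^ (w - 1)))) := by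
    intro u v hu hv P Q hP hQ hPX hQX heP heQ huniq
    by_cases h2 : 2 ≤ u
    · refine (hm.systematic_intersection hα (by omega) (by omega) (by omega) hP hQ hPX hQX heP heQ
        he huniq).mono le_rfl le_rfl ?_
      subst hu hv
      exact hcost h2
    -- a matrix with a single row spans the multiples of this row, whose first entry is `1`
    · obtain rfl : u = 1 := by omega
      refine Computes.of_subset (vecReps_subset fun j => ?_) hbound
      have h3 : e j = P 0 j := by
        rw [← heP]
        simp only [Matrix.vecMul, _root_.dotProduct, Fin.sum_univ_one]
        have h4 : headVec (by omega) e (0 : Fin 1) = 1 := he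
        rw [h4, one_mul]
      rw [h3]
      exact (rep_subset_matReps P 0 j).trans hPX
  rcases le_total r (k + 1) with h | h
  · exact key (min_eq_left h).symm (max_eq_right h).symm hC hR hCX hRX heC heR huniq
  · exact key (min_eq_right h).symm (max_eq_left h).symm hR hC hRX hCX heR heC
      fun x h1 h2 => huniq x h2 h1

end LastPhases

/-! ### Algorithms for the three phases -/

section Algorithms

open Matrix

/-- A finite field of characteristic `p` with an extension of degree `m`, given by a basis of
powers of a generator. -/
structure SimpleExtension (p m : ℕ) : Type 1 where
  F : Type
  K : Type
  [fieldF : Field F]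
  [finite : Finite F]
  [charP : CharP F p]
  [fieldK : Field K]
  [algebra : Algebra F K]
  α : K
  β : Module.Basis (Fin m) F K
  basis_eq : ∀ i, β i = α ^ (i : ℕ)

attribute [instance] SimpleExtension.fieldF SimpleExtension.finite SimpleExtension.charP
  SimpleExtension.fieldK SimpleExtension.algebra

variable {p s n k r : ℕ} {w A₀ c : ℝ}

/-- The inputs of the first phase. -/
structure BuildInput (p m n k : ℕ) : Type 1 extends SimpleExtension p m where
  R : Matrix (Fin (k + 1)) (Fin (n - k - 1)) K

/-- One program serves all base fields and matrices `R`: the family of instances over which the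
variables are formed is the type of all inputs. -/
theorem exists_build (hmul : MatMulBound p w A₀) (hw : 2 < w)
    (hgrowth : ∀ n r u : ℕ, 1 ≤ u → u ≤ r → u + r ≤ n →
      (u : ℝ) ^ 5 * (n : ℝ) ^ (w - 2) ≤ c * (n.choose r : ℝ) ^ (w - 2))
    (hr : 1 ≤ r) (hrn : r ≤ n - k - 1) :
    ∃ P : Alg (InputIdx (s + 1) n k) ((Sub (n - k - 1) r × Fin (s + 1)) × Sub n r),
      ∀ (F K : Type) [Field F] [Finite F] [CharP F p] [Field K] [Algebra F K]
        (α : K) (β : Module.Basis (Fin (s + 1)) F K) (_ : ∀ i, β i = α ^ (i : ℕ))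
        (R : Matrix (Fin (k + 1)) (Fin (n - k - 1)) K),
        P.output (encode α β R) = (fun x => MaxMin r β R x.1 x.2) ∧
        (P.cost (encode α β R) : ℝ) ≤ ((4 * |A₀| + 6) * c + 34) *
          ((1 + (s + 1 : ℕ) / (n : ℝ)) *
            ((s + 1 : ℕ) * (n - k - 1).choose r * (n.choose r : ℝ) ^ (w - 1))) := by
  set x : InputIdx (s + 1) n k → ∀ ω : BuildInput p (s + 1) n k, ω.F :=
    fun i ω => encode ω.α ω.β ω.R i with hx
  have h := computes_build (Ω := BuildInput p (s + 1) n k) (E := fun ω => ω.F) (K := fun ω => ω.K)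
    (X := Set.range x) (α := fun ω => ω.α) (β := fun ω => ω.β) (fun ω i => ω.basis_eq i)
    (hmul.fastMul hw) hgrowth hr hrn (R := Matrix.of fun i j ω => ω.R i j)
    (by rintro _ ⟨l, rfl⟩; exact ⟨Sum.inr l, rfl⟩)
    (matReps_subset (by rintro i j _ ⟨l, rfl⟩; exact ⟨Sum.inl (i, j, l), rfl⟩))
  obtain ⟨P, hP⟩ := (h.mono le_rfl (Y' := Set.range
    fun (y : (Sub (n - k - 1) r × Fin (s + 1)) × Sub n r) (ω : BuildInput p (s + 1) n k) =>
      MaxMin r ω.β ω.R y.1 y.2) (by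
    rintro _ ⟨y, rfl⟩
    exact mem_entrySet (maxMinVar r (fun ω : BuildInput p (s + 1) n k => ω.β)
      (Matrix.of fun i j ω => ω.R i j)) y.1 y.2) le_rfl).exists_alg
  refine ⟨P, ?_⟩
  intro F K _ _ _ _ _ α β hβ R
  exact hP ⟨⟨F, K, α, β, hβ⟩, R⟩

/-- The inputs of the second phase: a matrix whose right kernel is spanned by a vector with
component `1` at the first columns, which determines the matrix `C`. -/
structure SolveInput (p m n k r : ℕ) : Type 1 where
  F : Type
  [fieldF : Field F]
  [finite : Finite F]
  [charP : CharP F p]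
  M : Matrix (Sub (n - k - 1) r × Fin m) (Sub n r) F
  v : Sub n r → F
  C : Matrix (Fin r) (Fin n) F
  kernel : M *ᵥ v = 0
  one : ∀ T : Sub n r, T.1 = firstCols n r → v T = 1
  unique : ∀ u, M *ᵥ u = 0 → ∀ T₀ : Sub n r, T₀.1 = firstCols n r → ∀ T, u T = v T * u T₀
  systematic : IsSystematic C
  read : ∀ (i : Fin r) (j : Fin n), r ≤ j.val → ∀ T : Sub n r,
    T.1 = insert j ((firstCols n r).filter fun t => t.val ≠ i.val) →
    C i j = (-1) ^ (r + (i.val + 1)) * v T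

attribute [instance] SolveInput.fieldF SolveInput.finite SolveInput.charP

theorem card_exchange (hr : r ≤ n) (i : Fin r) (j : Fin n) (hj : r ≤ j.val) :
    (insert j ((firstCols n r).filter fun t => t.val ≠ i.val)).card = r := by
  have h1 : (firstCols n r).filter (fun t => t.val ≠ i.val)
      = (firstCols n r).erase ⟨i, by omega⟩ := by
    ext t
    simp only [Finset.mem_filter, Finset.mem_erase, ne_eq, Fin.ext_iff]
    exact and_comm
  rw [Finset.card_insert_of_notMem, h1, Finset.card_erase_of_mem, card_firstCols hr]
  · have := i.isLt
    omega
  · simp [firstCols]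
  · simp [firstCols]
    omega

theorem exists_solve (hmul : MatMulBound p w A₀) (hw : 2 < w) (hr : 1 ≤ r) (hrn : r ≤ n - k - 1)
    (hover : n.choose r ≤ (s + 1) * (n - k - 1).choose r + 1) :
    ∃ P : Alg ((Sub (n - k - 1) r × Fin (s + 1)) × Sub n r) (Sub n r ⊕ (Fin r × Fin n)),
      ∀ ω : SolveInput p (s + 1) n k r,
        P.output (fun x => ω.M x.1 x.2) = Sum.elim ω.v (fun x => ω.C x.1 x.2) ∧
        (P.cost (fun x => ω.M x.1 x.2) : ℝ) ≤ (3 * (FastMul.blockConst w |A₀| + 18) + 2) *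
          ((s + 1 : ℕ) * (n - k - 1).choose r * (n.choose r : ℝ) ^ (w - 1)) := by
  have hrn' : r ≤ n := by omega
  set x : (Sub (n - k - 1) r × Fin (s + 1)) × Sub n r → ∀ ω : SolveInput p (s + 1) n k r, ω.F :=
    fun i ω => ω.M i.1 i.2 with hx
  have h := computes_solve (Ω := SolveInput p (s + 1) n k r) (E := fun ω => ω.F)
    (X := Set.range x) (hmul.fastMul hw) hr hrn hover (M := Matrix.of fun i j ω => ω.M i j)
    (entrySet_subset fun i j => ⟨(i, j), rfl⟩) (v := fun T ω => ω.v T)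
    ⟨firstCols n r, card_firstCols hrn'⟩
    (by
      funext i ω
      have := congrFun ω.kernel i
      simpa [Matrix.mulVec, dotProduct, Finset.sum_apply] using this)
    (funext fun ω => ω.one _ rfl)
    (fun u hu T => funext fun ω => ω.unique (fun T => u T ω) (by
      funext i
      have := congrFun (congrFun hu i) ω
      simpa [Matrix.mulVec, dotProduct, Finset.sum_apply] using this) _ rfl T)
    (C := Matrix.of fun i j ω => ω.C i j)
    (fun i j hj => funext fun ω => by
      rw [Matrix.of_apply, ω.systematic i j hj]
      split_ifs <;> rfl)
    (fun i j hj => ⟨⟨_, card_exchange hrn' i j hj⟩, funext fun ω => ω.read i j hj _ rfl⟩)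
  obtain ⟨P, hP⟩ := (h.mono le_rfl (Y' := Set.range
    fun (y : Sub n r ⊕ (Fin r × Fin n)) (ω : SolveInput p (s + 1) n k r) =>
      (Sum.elim ω.v (fun x => ω.C x.1 x.2) y : ω.F)) (by
    rintro _ ⟨T | ij, rfl⟩
    · exact Or.inl ⟨T, rfl⟩
    · exact Or.inr (mem_entrySet (Matrix.of fun i j (ω : SolveInput p (s + 1) n k r) => ω.C i j)
        ij.1 ij.2)) le_rfl).exists_alg
  exact ⟨P, hP⟩

/-- The inputs of the last phase: matrices `(I R)` and `C` whose row spaces over the extension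
meet in the multiples of a vector with first coordinate `1`. -/
structure FinishInput (p m n k r : ℕ) (hr : r ≤ n) (hk : k + 1 ≤ n) : Type 1 extends
    SimpleExtension p m where
  R : Matrix (Fin (k + 1)) (Fin (n - k - 1)) K
  C : Matrix (Fin r) (Fin n) F
  e : Fin n → K
  systematic : IsSystematic C
  mem_left : headVec hr e ᵥ* C.map (algebraMap F K) = e
  mem_right : headVec hk e ᵥ* sysGen R = e
  one : e ⟨0, by omega⟩ = 1
  unique : ∀ x : Fin n → K, headVec hr x ᵥ* C.map (algebraMap F K) = x →
    headVec hk x ᵥ* sysGen R = x → ∀ j, x j = e j * x ⟨0, by omega⟩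

theorem isSystematic_sysGen {K : Type} [Field K] (R : Matrix (Fin (k + 1)) (Fin (n - k - 1)) K) :
    IsSystematic (sysGen R) := fun i j hj => by
  rw [sysGen, Matrix.of_apply, dif_neg (by omega)]

theorem vecMul_apply_pi {Ω : Type*} {K : Ω → Type} [∀ ω, Field (K ω)] {a b : ℕ}
    (x : Fin a → ∀ ω, K ω) (M : Matrix (Fin a) (Fin b) (∀ ω, K ω)) (ω : Ω) (j : Fin b) :
    (x ᵥ* M) j ω = ((fun i => x i ω) ᵥ* (Matrix.of fun i j => M i j ω)) j := by
  simp [Matrix.vecMul, dotProduct, Finset.sum_apply]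

theorem exists_finish (hw : 2 < w) (hc : 1 ≤ c)
    (hgrowth : ∀ n r u : ℕ, 1 ≤ u → u ≤ r → u + r ≤ n →
      (u : ℝ) ^ 5 * (n : ℝ) ^ (w - 2) ≤ c * (n.choose r : ℝ) ^ (w - 2))
    (hr : 1 ≤ r) (hrn : r ≤ n - k - 1) :
    ∃ P : Alg (InputIdx (s + 1) n k ⊕ (Fin r × Fin n))
        ((Fin r × Fin (s + 1)) ⊕ (Fin n × Fin (s + 1))),
      ∀ ω : FinishInput p (s + 1) n k r (by omega) (by omega),
        P.output (Sum.elim (encode ω.α ω.β ω.R) (fun x => ω.C x.1 x.2))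
          = Sum.elim (fun x => ω.β.repr (headVec (by omega) ω.e x.1) x.2)
            (fun x => ω.β.repr (ω.e x.1) x.2) ∧
        (P.cost (Sum.elim (encode ω.α ω.β ω.R) (fun x => ω.C x.1 x.2)) : ℝ) ≤
          1 + 12960 * c * ((1 + (s + 1 : ℕ) / (n : ℝ)) *
            ((s + 1 : ℕ) * (n - k - 1).choose r * (n.choose r : ℝ) ^ (w - 1))) := by
  have hrn' : r ≤ n := by omega
  have hk : k + 1 ≤ n := by omega
  set Ω := FinishInput p (s + 1) n k r hrn' hk with hΩ
  set x : InputIdx (s + 1) n k ⊕ (Fin r × Fin n) → ∀ ω : Ω, ω.F :=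
    fun i ω => Sum.elim (encode ω.α ω.β ω.R) (fun x => ω.C x.1 x.2) i with hx
  set β : ∀ ω : Ω, Module.Basis (Fin (s + 1)) ω.F ω.K := fun ω => ω.β with hβ
  set X : Set (∀ ω : Ω, ω.F) := Set.range x ∪ ({1} ∪ {0}) with hX
  -- the elements of the base field have vanishing higher coordinates
  have hbase : ∀ (y : ∀ ω : Ω, ω.F), y ∈ X →
      coords β (fun ω => algebraMap ω.F ω.K (y ω)) ⊆ X := by
    rintro y hy _ ⟨l, rfl⟩
    have h1 : ∀ ω : Ω, algebraMap ω.F ω.K (y ω) = y ω • ω.β 0 := fun ω => by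
      rw [ω.basis_eq, Fin.val_zero, pow_zero, Algebra.algebraMap_eq_smul_one]
    have h2 : coord β (fun ω => algebraMap ω.F ω.K (y ω)) l = if l = 0 then y else 0 := by
      funext ω
      simp only [coord, h1, hβ, map_smul, Module.Basis.repr_self, Finsupp.smul_apply,
        Finsupp.single_apply, smul_eq_mul]
      by_cases hl : l = 0
      · rw [if_pos hl, if_pos hl.symm, mul_one]
      · rw [if_neg hl, if_neg (Ne.symm hl), mul_zero, Pi.zero_apply]
    rw [h2]
    split_ifs
    · exact hy
    · exact Or.inr (Or.inr rfl)
  have h0 : (0 : ∀ ω : Ω, ω.F) ∈ X := Or.inr (Or.inr rfl)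
  have h1 : (1 : ∀ ω : Ω, ω.F) ∈ X := Or.inr (Or.inl rfl)
  have hzero : coords β (0 : ∀ ω : Ω, ω.K) ⊆ X := by
    have := hbase 0 h0
    simp only [Pi.zero_apply, map_zero] at this
    exact this
  have hone : coords β (1 : ∀ ω : Ω, ω.K) ⊆ X := by
    have := hbase 1 h1
    simp only [Pi.one_apply, map_one] at this
    exact this
  have h := computes_finish (Ω := Ω) (E := fun ω => ω.F) (K := fun ω => ω.K) (X := X)
    (α := fun ω => ω.α) (β := β) (fun ω i => ω.basis_eq i) hw hc hgrowth hr hrn (by omega)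
    (C := Matrix.of fun i j ω => algebraMap ω.F ω.K (ω.C i j))
    (R := Matrix.of fun i j ω => sysGen ω.R i j) (e := fun j ω => ω.e j)
    (fun i j hj => funext fun ω => by
      rw [Matrix.of_apply, ω.systematic i j hj]
      split_ifs <;> simp)
    (fun i j hj => funext fun ω => by
      rw [Matrix.of_apply, isSystematic_sysGen ω.R i j hj]
      split_ifs <;> rfl)
    (by rintro _ ⟨l, rfl⟩; exact Or.inl ⟨Sum.inl (Sum.inr l), rfl⟩)
    (matReps_subset fun i j => hbase _ (Or.inl ⟨Sum.inr (i, j), rfl⟩))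
    (matReps_subset fun i j => by
      by_cases hj : k + 1 ≤ j.val
      · have h2 : (Matrix.of fun i j (ω : Ω) => sysGen ω.R i j) i j
            = fun ω => ω.R i ⟨j - (k + 1), by omega⟩ := funext fun ω => by
          rw [Matrix.of_apply, sysGen, Matrix.of_apply, dif_pos hj]
        rw [h2]
        rintro _ ⟨l, rfl⟩
        exact Or.inl ⟨Sum.inl (Sum.inl (i, ⟨j - (k + 1), by omega⟩, l)), rfl⟩
      · have h2 : (Matrix.of fun i j (ω : Ω) => sysGen ω.R i j) i j
            = if j.val = i.val then 1 else 0 := funext fun ω => by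
          rw [Matrix.of_apply, sysGen, Matrix.of_apply, dif_neg hj]
          split_ifs <;> rfl
        rw [h2]
        split_ifs
        · exact hone
        · exact hzero)
    (funext fun j => funext fun ω => (vecMul_apply_pi _ _ ω j).trans (congrFun ω.mem_left j))
    (funext fun j => funext fun ω => (vecMul_apply_pi _ _ ω j).trans (congrFun ω.mem_right j))
    (funext fun ω => ω.one)
    (fun y hy1 hy2 j => funext fun ω => ω.unique (fun j => y j ω)
      (funext fun j => ((vecMul_apply_pi _ _ ω j).symm.trans (congrFun (congrFun hy1 j) ω)))
      (funext fun j => ((vecMul_apply_pi _ _ ω j).symm.trans (congrFun (congrFun hy2 j) ω))) j)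
  have h2 : Computes Set.univ (Set.range x) ({1} ∪ {0}) (1 + 0) :=
    Computes.one.union Computes.zero
  obtain ⟨P, hP⟩ := ((h2.andThen h).mono le_rfl (Y' := Set.range
    fun (y : (Fin r × Fin (s + 1)) ⊕ (Fin n × Fin (s + 1))) (ω : Ω) =>
      (Sum.elim (fun x => ω.β.repr (headVec hrn' ω.e x.1) x.2)
        (fun x => ω.β.repr (ω.e x.1) x.2) y : ω.F)) (by
    rintro _ ⟨y | y, rfl⟩
    · exact rep_subset_vecReps (rep := coords β) (fun j (ω : Ω) => ω.e j) ⟨y.1, by omega⟩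
        (coord_mem β _ y.2)
    · exact rep_subset_vecReps (rep := coords β) (fun j (ω : Ω) => ω.e j) y.1
        (coord_mem β _ y.2)) (by rw [add_zero])).exists_alg
  exact ⟨P, hP⟩

end Algorithms

/-! ### The decoder -/

section Decoder

open Matrix

theorem headVec_vecMul_sysGen {K : Type} [Field K] {n k : ℕ} (hk : k + 1 ≤ n)
    (R : Matrix (Fin (k + 1)) (Fin (n - k - 1)) K) (x : Fin n → K) :
    headVec hk x ᵥ* sysGen R = x ↔ x ᵥ* (parityCheck R).transpose = 0 := by
  have h1 : ∀ j : Fin (n - k - 1), (headVec hk x ᵥ* sysGen R) ⟨k + 1 + j, by omega⟩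
      = ∑ i : Fin (k + 1), x ⟨i, by omega⟩ * R i j := fun j => by
    simp only [Matrix.vecMul, dotProduct, headVec, sysGen, Matrix.of_apply]
    refine Finset.sum_congr rfl fun i _ => ?_
    rw [dif_pos (by simp)]
    congr 2
    exact Fin.ext (by simp)
  constructor
  · intro h
    funext j
    rw [vecMul_parityCheck_transpose hk, ← h1, h, sub_self]
    rfl
  · intro h
    funext j
    rcases Nat.lt_or_ge j.val (k + 1) with hj | hj
    · exact (isSystematic_sysGen R).vecMul_apply hk _ ⟨j, hj⟩
    · have h2 := congrFun h ⟨j - (k + 1), by omega⟩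
      rw [vecMul_parityCheck_transpose hk, ← h1, Pi.zero_apply, sub_eq_zero] at h2
      have h3 : (⟨k + 1 + (j - (k + 1)), by omega⟩ : Fin n) = j := Fin.ext (by simp; omega)
      simp only [h3] at h2
      exact h2.symm

namespace IsInstance

variable {F K : Type} [Field F] [Field K] [Algebra F K] {m n k r : ℕ}
  {β : Module.Basis (Fin m) F K} {R : Matrix (Fin (k + 1)) (Fin (n - k - 1)) K}
  {𝒞 : Submodule K (Fin n → K)} {y e : Fin n → K}

theorem head_ne_zero (h : IsInstance r β R 𝒞 y e) (hr : r ≤ n) (hr1 : 1 ≤ r) :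
    e ⟨0, by omega⟩ ≠ 0 :=
  LinearIndependent.ne_zero (v := headVec hr e) ⟨0, hr1⟩ (h.linearIndependent_headVec hr)

/-- A solution of the linear system for the support with first component `1` is the normalized
support of the error. -/
theorem solution_eq (h : IsInstance r β R 𝒞 y e) (hk : k + 1 ≤ n) (hr : r ≤ n) (hr1 : 1 ≤ r)
    {C : Matrix (Fin r) (Fin n) F} (hC : IsSystematic C)
    (hCe : headVec hr e ᵥ* C.map (algebraMap F K) = e) {S : Fin r → K}
    (hS : S ᵥ* (C.map (algebraMap F K) * (parityCheck R).transpose) = 0) :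
    S = (S ⟨0, hr1⟩ * (e ⟨0, by omega⟩)⁻¹) • headVec hr e := by
  obtain ⟨a, ha⟩ := h.exists_smul_of_solution hk hr hC hCe hS
  have h1 : S ⟨0, hr1⟩ = a * e ⟨0, by omega⟩ := congrFun ha ⟨0, hr1⟩
  rw [h1, mul_assoc, mul_inv_cancel₀ (h.head_ne_zero hr hr1), mul_one]
  exact ha

end IsInstance

/-- The constant in the cost of the decoder: the contributions of the three phases, and one more
operation for writing down the constant `1` in the last phase. -/
noncomputable def decoderConst (ω A₀ c : ℝ) : ℝ :=
  ((4 * |A₀| + 6) * c + 34) + (3 * (FastMul.blockConst ω |A₀| + 18) + 2) + 12960 * c + 1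

/-- For fixed parameters the algorithms of the three phases form a decoder. -/
theorem exists_decoder {ω A₀ c : ℝ} (hω : 2 < ω) (hc : 1 ≤ c)
    (hgrowth : ∀ n r u : ℕ, 1 ≤ u → u ≤ r → u + r ≤ n →
      (u : ℝ) ^ 5 * (n : ℝ) ^ (ω - 2) ≤ c * (n.choose r : ℝ) ^ (ω - 2))
    {p : ℕ} (hmul : MatMulBound p ω A₀) {m n k r : ℕ} (hn0 : 0 < n)
    (hr : 1 ≤ r) (hrn : r ≤ n - k - 1)
    (hover : n.choose r ≤ m * (n - k - 1).choose r + 1) :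
    ∃ D : Decoder m n k r,
      ∀ (F K : Type) [Field F] [Finite F] [CharP F p] [Field K] [Algebra F K]
        (α : K) (β : Module.Basis (Fin m) F K) (_ : ∀ i, β i = α ^ (i : ℕ))
        (R : Matrix (Fin (k + 1)) (Fin (n - k - 1)) K)
        (𝒞 : Submodule K (Fin n → K)) (y e : Fin n → K)
        (_ : IsInstance r β R 𝒞 y e)
        (_ : (MaxMin r β R).rank = n.choose r - 1),
        D.Executes α β R ∧
        D.result β (encode α β R) = (e ⟨0, hn0⟩)⁻¹ • e ∧
        e ⟨0, hn0⟩ ≠ 0 ∧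
        (D.solveCost (encode α β R) : ℝ) ≤
          decoderConst ω A₀ c * (m * (n - k - 1).choose r * (n.choose r : ℝ) ^ (ω - 1)) ∧
        (D.totalCost (encode α β R) : ℝ) ≤
          decoderConst ω A₀ c * (1 + (m : ℝ) / n) *
            (m * (n - k - 1).choose r * (n.choose r : ℝ) ^ (ω - 1)) := by
  set B₁ : ℝ := (4 * |A₀| + 6) * c + 34 with hB₁
  set B₂ : ℝ := 3 * (FastMul.blockConst ω |A₀| + 18) + 2 with hB₂
  set B₃ : ℝ := 12960 * c with hB₃
  have hB₁0 : 0 ≤ B₁ := by positivity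
  have hB₂0 : 0 ≤ B₂ := by
    have := FastMul.blockConst_nonneg hω (abs_nonneg A₀)
    positivity
  have hB₃0 : 0 ≤ B₃ := by positivity
  have hconst : decoderConst ω A₀ c = B₁ + B₂ + B₃ + 1 := rfl
  rw [hconst]
  have hn : r ≤ n := by omega
  have hk : k + 1 ≤ n := by omega
  have hN : 2 ≤ n.choose r := by
    have h1 : n ≤ n.choose r := le_choose hr (by omega)
    omega
  -- the degree of the extension is positive, since otherwise there are not enough equations
  obtain ⟨s, rfl⟩ : ∃ s, m = s + 1 := ⟨m - 1, by
    rcases Nat.eq_zero_or_pos m with rfl | h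
    · omega
    · omega⟩
  obtain ⟨P₁, hP₁⟩ := exists_build (s := s) hmul hω hgrowth hr hrn
  obtain ⟨P₂, hP₂⟩ := exists_solve hmul hω hr hrn hover
  obtain ⟨P₃, hP₃⟩ := exists_finish (p := p) (s := s) hω hc hgrowth hr hrn
  refine ⟨⟨P₁, P₂, P₃⟩, ?_⟩
  intro F K _ _ _ _ _ α β hβ R 𝒞 y e hinst hrank
  set D : Decoder (s + 1) n k r := ⟨P₁, P₂, P₃⟩ with hD
  have he0 := hinst.head_ne_zero hn hr
  obtain ⟨C, hC, hCe⟩ := hinst.exists_coefficients hn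
  have heH := hinst.error_parityCheck hk
  have hsol : headVec hn e ᵥ* (C.map (algebraMap F K) * (parityCheck R).transpose) = 0 := by
    rw [← Matrix.vecMul_vecMul, hCe, heH]
  have hS0 : headVec hn e ≠ 0 := fun h => he0 (congrFun h ⟨0, hr⟩)
  have hmem := maxMin_mulVec_maxMinor hk β R C hS0 hsol
  have hkeru := eq_smul_maxMinor hn β R hC hmem hrank
  set T₀ : Sub n r := ⟨firstCols n r, card_firstCols hn⟩ with hT₀
  -- the normalized error
  set x : Fin n → K := (e ⟨0, hn0⟩)⁻¹ • e with hx
  have hxhead : ∀ {a : ℕ} (ha : a ≤ n), headVec ha x = (e ⟨0, hn0⟩)⁻¹ • headVec ha e :=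
    fun ha => rfl
  have hxC : headVec hn x ᵥ* C.map (algebraMap F K) = x := by
    rw [hxhead, Matrix.smul_vecMul, hCe]
  have hxR : headVec hk x ᵥ* sysGen R = x := by
    rw [headVec_vecMul_sysGen, hx, Matrix.smul_vecMul, heH, smul_zero]
  have hx1 : x ⟨0, hn0⟩ = 1 := inv_mul_cancel₀ he0
  have hxu : ∀ z : Fin n → K, headVec hn z ᵥ* C.map (algebraMap F K) = z →
      headVec hk z ᵥ* sysGen R = z → ∀ j, z j = x j * z ⟨0, hn0⟩ := by
    intro z h1 h2 j
    have h3 := hinst.solution_eq hk hn hr hC hCe (S := headVec hn z) (by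
      rw [← Matrix.vecMul_vecMul, h1, (headVec_vecMul_sysGen hk R z).1 h2])
    have h4 : z = (z ⟨0, hn0⟩ * (e ⟨0, hn0⟩)⁻¹) • e := by
      conv_lhs => rw [← h1, h3, Matrix.smul_vecMul, hCe]
      rfl
    conv_lhs => rw [h4]
    simp only [hx, Pi.smul_apply, smul_eq_mul]
    ring
  obtain ⟨h11, h12⟩ := hP₁ F K α β hβ R
  obtain ⟨h21, h22⟩ := hP₂ ⟨F, MaxMin r β R, maxMinor C, C, hmem, maxMinor_firstCols hn hC,
    fun u hu T₁ hT₁ T => hkeru u hu T₁ hT₁ T, hC, fun i j hj T hT => maxMinor_exchange hn hC i j hj T hT⟩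
  obtain ⟨h31, h32⟩ := hP₃ ⟨⟨F, K, α, β, hβ⟩, R, C, x, hC, hxC, hxR, hx1, hxu⟩
  simp only at h21 h22 h31 h32
  set inp := encode α β R with hinp
  have hentries : D.entries inp = fun z => MaxMin r β R z.1 z.2 := h11
  have hout : D.solve.output (D.entries inp) = Sum.elim (maxMinor C) (fun z => C z.1 z.2) := by
    rw [hentries]
    exact h21
  have hvec : D.kernelVec inp = maxMinor C := funext fun T => congrFun hout (Sum.inl T)
  have hcoeffs : D.coeffs inp = C :=
    Matrix.ext fun i j => congrFun hout (Sum.inr (i, j))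
  have hlast : D.lastInput inp = Sum.elim inp (fun z => C z.1 z.2) := by
    rw [Decoder.lastInput, hcoeffs]
  have hfin : D.finish.output (D.lastInput inp) = Sum.elim
      (fun z => β.repr (headVec hn x z.1) z.2) (fun z => β.repr (x z.1) z.2) := by
    rw [hlast]
    exact h31
  have hsupp : D.supportVec β inp = headVec hn x := funext fun i => by
    rw [Decoder.supportVec, hfin]
    exact β.sum_repr (headVec hn x i)
  have hres : D.result β inp = x := funext fun i => by
    rw [Decoder.result, hfin]
    exact β.sum_repr (x i)
  have hT0 : (1 : ℝ) ≤ (s + 1 : ℕ) * (n - k - 1).choose r * (n.choose r : ℝ) ^ (ω - 1) := by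
    have h1 : (1 : ℝ) ≤ (n.choose r : ℝ) ^ (ω - 1) :=
      Real.one_le_rpow (by exact_mod_cast (by omega : 1 ≤ n.choose r)) (by linarith)
    have h2 : (1 : ℝ) ≤ (s + 1 : ℕ) * (n - k - 1).choose r := by
      exact_mod_cast Nat.mul_pos (Nat.succ_pos s) (Nat.choose_pos hrn)
    exact one_le_mul_of_one_le_of_one_le h2 h1
  have hsolve : (D.solveCost inp : ℝ)
      ≤ B₂ * ((s + 1 : ℕ) * (n - k - 1).choose r * (n.choose r : ℝ) ^ (ω - 1)) := by
    rw [Decoder.solveCost, hentries]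
    exact h22
  have hG : (1 : ℝ) ≤ 1 + ((s + 1 : ℕ) : ℝ) / n := by
    have : (0 : ℝ) ≤ ((s + 1 : ℕ) : ℝ) / n := by positivity
    linarith
  refine ⟨?_, hres, he0, ?_, ?_⟩
  · refine ⟨fun Ji T => congrFun hentries (Ji, T), ?_, ?_, ?_, ?_, ?_, ?_, ?_, ?_, ?_⟩
    · rw [hvec]
      exact hmem
    · rw [hvec]
      exact maxMinor_firstCols hn hC
    · intro v hv hv1
      rw [hvec]
      funext T
      rw [hkeru v hv T₀ rfl T, hv1 T₀ rfl, mul_one]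
    · rw [hcoeffs]
      exact hC
    · rw [hcoeffs, hvec]
      exact maxMinor_exchange hn hC
    · rw [hcoeffs, hsupp, hxhead, Matrix.smul_vecMul, hsol, smul_zero]
    · intro i hi
      rw [hsupp]
      have : i = ⟨0, hr⟩ := Fin.ext hi
      rw [this]
      exact hx1
    · intro S hS hS1
      rw [hcoeffs] at hS
      rw [hsupp, hxhead, hinst.solution_eq hk hn hr hC hCe hS, hS1 _ rfl, one_mul]
    · rw [hres, hcoeffs, hsupp, hxC]
  · refine hsolve.trans (mul_le_mul_of_nonneg_right (by linarith) (by linarith))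
  · have h1 : (D.build.cost inp : ℝ) ≤ B₁ * ((1 + (s + 1 : ℕ) / (n : ℝ)) *
        ((s + 1 : ℕ) * (n - k - 1).choose r * (n.choose r : ℝ) ^ (ω - 1))) := h12
    have h2 : (D.finish.cost (D.lastInput inp) : ℝ) ≤ 1 + B₃ * ((1 + (s + 1 : ℕ) / (n : ℝ)) *
        ((s + 1 : ℕ) * (n - k - 1).choose r * (n.choose r : ℝ) ^ (ω - 1))) := by
      rw [hlast]
      exact h32
    have h3 : (D.totalCost inp : ℝ)
        = D.build.cost inp + D.solveCost inp + D.finish.cost (D.lastInput inp) := by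
      rw [Decoder.totalCost, Decoder.solveCost]
      push_cast
      ring
    rw [h3]
    generalize ((s + 1 : ℕ) : ℝ) * (n - k - 1).choose r * (n.choose r : ℝ) ^ (ω - 1) = T at *
    generalize (1 : ℝ) + ((s + 1 : ℕ) : ℝ) / n = G at *
    have h4 : T ≤ G * T := le_mul_of_one_le_left (by linarith) hG
    have h5 : B₂ * T ≤ B₂ * (G * T) := mul_le_mul_of_nonneg_left h4 hB₂0
    calc _ ≤ B₁ * (G * T) + B₂ * T + (1 + B₃ * (G * T)) := add_le_add (add_le_add h1 hsolve) h2
      _ ≤ (B₁ + B₂ + B₃ + 1) * G * T := by nlinarith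

end Decoder

end RankDecoding

open RankDecoding in
theorem mainTheorem3 (ω A₀ : ℝ) (hω : 2 < ω) :
    ∃ A : ℝ, ∀ p : ℕ, p.Prime → MatMulBound p ω A₀ →
      ∀ (m n k r : ℕ) (hr : 1 ≤ r) (hrn : r ≤ n - k - 1)
        (hover : n.choose r ≤ m * (n - k - 1).choose r + 1),
      ∃ D : Decoder m n k r,
        ∀ (F K : Type) [Field F] [Finite F] [CharP F p] [Field K] [Algebra F K]
          (α : K) (β : Module.Basis (Fin m) F K) (hβ : ∀ i, β i = α ^ (i : ℕ))
          (R : Matrix (Fin (k + 1)) (Fin (n - k - 1)) K)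
          (𝒞 : Submodule K (Fin n → K)) (y e : Fin n → K)
          (hinst : IsInstance r β R 𝒞 y e)
          (hrank : (MaxMin r β R).rank = n.choose r - 1),
          D.Executes α β R ∧
          D.result β (encode α β R) = (e ⟨0, by omega⟩)⁻¹ • e ∧
          e ⟨0, by omega⟩ ≠ 0 ∧
          (D.solveCost (encode α β R) : ℝ) ≤
            A * (m * (n - k - 1).choose r * (n.choose r : ℝ) ^ (ω - 1)) ∧
          (D.totalCost (encode α β R) : ℝ) ≤
            A * (1 + (m : ℝ) / n) *
              (m * (n - k - 1).choose r * (n.choose r : ℝ) ^ (ω - 1)) := by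
  obtain ⟨c, hc, hgrowth⟩ := exists_growth_bound (δ := ω - 2) (by linarith)
  exact ⟨decoderConst ω A₀ c, fun _ _ hmul _ _ _ _ hr hrn hover =>
    exists_decoder hω hc hgrowth hmul (by omega) hr hrn hover⟩
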